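/- **Proposition 4.1.** Let $V\subset\mathbb R^2$ be open and connected, $\epsilon>0$, $P>0$, and let $\mathcal O=\{(u,r,x^3,x^4): u\in\mathbb R,\ |r|<\epsilon,\ (x^3,x^4)\in V\}$ carry a metric in Gaussian null form $$\mathrm ds^2=r f\,\mathrm du^2+2\,\mathrm dr\,\mathrm du+2r\,h_A\,\mathrm du\,\mathrm dx^A+g_{AB}\,\mathrm dx^A\mathrm dx^B\qquad(A,B\in\{3,4\}),$$ of signature $(+,-,-,-)$, where $f,h_A,g_{AB}$ are smooth and $P$-periodic in $u$ and the matrix $(g_{AB})$ is symmetric and negative definite. Let $\mathcal O$ be time oriented so that $k=\partial/\partial u$ is future directed on the horizon $\mathcal N=\{r=0\}$. (Such a spacetime is called an elementary neighbourhood of $\mathcal N$.) Let $T_{ab}$ be a tensor field on $\mathcal O$ such that Einstein's equations $R_{ab}-\tfrac12 R\,g_{ab}=8\pi T_{ab}$ and the dominant energy condition hold on $\mathcal O$: for every future directed timelike vector $\xi^a$ the vector $T^a{}_b\xi^b$ is future directed timelike or null (possibly zero). Suppose that $\partial g_{AB}/\partial u=0$ on $\mathcal N$. Then there are a constant $\kappa_\circ\ge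 0$ and Gaussian null coordinates $(u',r',x'^3,x'^4)$ on an open neighbourhood of $\mathcal N$ in $\mathcal O$ such that on $\mathcal N$ $$f'=-2\kappa_\circ,\qquad \frac{\partial h'_A}{\partial u'}=0 ,$$ where $f',h'_A,g'_{AB}$ are the metric functions in the new coordinates. Consequently $k'=\partial/\partial u'$ satisfies $k'^a\nabla_ak'^b=\kappa_\circ k'^b$ on $\mathcal N$: the surface gravity is constant (a zeroth law), although $\mathcal N$ is not assumed to be a Killing horizon. Here "Gaussian null coordinates" means: they are smooth coordinates with smooth inverse; they range over $u'\in\mathbb R$, $x'\in V'$, $|r'|<\epsilon'(x')$, where $V'\subset\mathbb R^2$ is open and $\epsilon'$ is a continuous positive function on $V'$; $\mathcal N$ is the surface $r'=0$; in them the metric has the Gaussian null form above, with $f',h'_A,g'_{AB}$ smooth and $P$-periodic in $u'$ and $(g'_{AB})$ symmetric and negative definite; and $k'$ is future directed on $\mathcal N$ either for the given time orientation or for the reversed one. The translation $u'\mapsto u'+P$ is the translation $u\mapsto u+P$ in the first case and $u\mapsto u-P$ in the second. -/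

import Mathlib

open scoped ContDiff Matrix

namespace Horizon

/-- Coordinate space, with coordinates `(u, r, x³, x⁴)` in the positions `0, 1, 2, 3`. -/
abbrev Coord : Type := Fin 4 → ℝ

/-- The coordinate basis vector in direction `i`. -/
def basisVec (i : Fin 4) : Coord := Pi.single i 1

/-- The partial derivative `∂F/∂yⁱ` at `p`. -/
noncomputable def pd (i : Fin 4) (F : Coord → ℝ) (p : Coord) : ℝ :=
  fderiv ℝ F p (basisVec i)

/-- The pair `(x³, x⁴)` of a point. -/
def transverse (p : Coord) : Fin 2 → ℝ := ![p 2, p 3]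

/-- The coordinate region `u ∈ (-∞, ∞)`, `(x³, x⁴) ∈ V`, `|r| < ε (x³, x⁴)`. -/
def region (V : Set (Fin 2 → ℝ)) (ε : (Fin 2 → ℝ) → ℝ) : Set Coord :=
  {p | transverse p ∈ V ∧ |p 1| < ε (transverse p)}

section Geometry

/-- The scalar product `g_{ab} vᵃ wᵇ` at `p`. -/
def scalarProd (g : Coord → Matrix (Fin 4) (Fin 4) ℝ) (p v w : Coord) : ℝ :=
  v ⬝ᵥ (g p *ᵥ w)

/-- The Christoffel symbol `Γᵃ_{bc}` of the metric `g`. -/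
noncomputable def christoffel (g : Coord → Matrix (Fin 4) (Fin 4) ℝ) (a b c : Fin 4)
    (p : Coord) : ℝ :=
  (1 / 2 : ℝ) * ∑ d, (g p)⁻¹ a d *
    (pd b (fun y => g y d c) p + pd c (fun y => g y d b) p - pd d (fun y => g y b c) p)

/-- The Ricci tensor
`R_{bc} = ∂_a Γᵃ_{bc} - ∂_c Γᵃ_{ba} + Γᵃ_{ad} Γᵈ_{bc} - Γᵃ_{cd} Γᵈ_{ba}`. -/
noncomputable def ricci (g : Coord → Matrix (Fin 4) (Fin 4) ℝ) (p : Coord) :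
    Matrix (Fin 4) (Fin 4) ℝ :=
  Matrix.of fun b c =>
    (∑ a, (pd a (christoffel g a b c) p - pd c (christoffel g a b a) p)) +
      ∑ a, ∑ d, (christoffel g a a d p * christoffel g d b c p -
        christoffel g a c d p * christoffel g d b a p)

/-- The scalar curvature `g^{ab} R_{ab}`. -/
noncomputable def scalarCurv (g : Coord → Matrix (Fin 4) (Fin 4) ℝ) (p : Coord) : ℝ :=
  ∑ a, ∑ b, (g p)⁻¹ a b * ricci g p a b

/-- The Einstein tensor `R_{ab} - (1/2) R g_{ab}`. -/
noncomputable def einstein (g : Coord → Matrix (Fin 4) (Fin 4) ℝ) (p : Coord) :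
    Matrix (Fin 4) (Fin 4) ℝ :=
  ricci g p - (scalarCurv g p / 2) • g p

/-- `v` is a future directed timelike vector at `p`; the signature is `(+,-,-,-)` and the time
orientation is given by a timelike vector field `τ`. -/
def IsFutureTimelike (g : Coord → Matrix (Fin 4) (Fin 4) ℝ) (τ : Coord → Coord)
    (p v : Coord) : Prop :=
  0 < scalarProd g p v v ∧ 0 < scalarProd g p v (τ p)

/-- `v` is a future directed timelike or null vector at `p`. The zero vector counts as null, so
that the dominant energy condition below includes vacuum; a nonzero `v` with
`0 ≤ g(v, v)` cannot be orthogonal to `τ`. -/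
def IsFutureCausal (g : Coord → Matrix (Fin 4) (Fin 4) ℝ) (τ : Coord → Coord)
    (p v : Coord) : Prop :=
  0 ≤ scalarProd g p v v ∧ 0 ≤ scalarProd g p v (τ p)

/-- The dominant energy condition on `Ω` for `T_{ab}`: for every future directed timelike `ξᵃ` the
vector `Tᵃ_b ξᵇ = g^{ac} T_{cb} ξᵇ` is future directed timelike or null. -/
def DominantEnergy (g T : Coord → Matrix (Fin 4) (Fin 4) ℝ) (τ : Coord → Coord)
    (Ω : Set Coord) : Prop :=
  ∀ p ∈ Ω, ∀ ξ : Coord, IsFutureTimelike g τ p ξ →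
    IsFutureCausal g τ p ((g p)⁻¹ *ᵥ (T p *ᵥ ξ))

end Geometry

/-- The functions `f`, `h_A`, `g_{AB}` in the Gaussian null form
`ds² = r f du² + 2 dr du + 2 r h_A du dx^A + g_{AB} dx^A dx^B` of a metric; `q` is `g_{AB}`. -/
structure NullForm where
  f : Coord → ℝ
  h : Coord → Fin 2 → ℝ
  q : Coord → Matrix (Fin 2) (Fin 2) ℝ

/-- The metric `ds² = r f du² + 2 dr du + 2 r h_A du dx^A + g_{AB} dx^A dx^B`. -/
def NullForm.metric (F : NullForm) (p : Coord) : Matrix (Fin 4) (Fin 4) ℝ :=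
  !![p 1 * F.f p,   1, p 1 * F.h p 0, p 1 * F.h p 1;
     1,             0, 0,             0;
     p 1 * F.h p 0, 0, F.q p 0 0,     F.q p 0 1;
     p 1 * F.h p 1, 0, F.q p 1 0,     F.q p 1 1]

/-- On the set `Ω` the functions `f`, `h_A`, `g_{AB}` are smooth and periodic in `u` with period
`P`, and `g_{AB}` is symmetric and negative definite. -/
structure NullForm.IsAdmissible (F : NullForm) (P : ℝ) (Ω : Set Coord) : Prop where
  smooth_f : ContDiffOn ℝ ∞ F.f Ω
  smooth_h : ∀ A, ContDiffOn ℝ ∞ (fun p => F.h p A) Ω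
  smooth_q : ∀ A B, ContDiffOn ℝ ∞ (fun p => F.q p A B) Ω
  periodic_f : ∀ p ∈ Ω, F.f (p + P • basisVec 0) = F.f p
  periodic_h : ∀ p ∈ Ω, F.h (p + P • basisVec 0) = F.h p
  periodic_q : ∀ p ∈ Ω, F.q (p + P • basisVec 0) = F.q p
  neg_def : ∀ p ∈ Ω, (-F.q p).PosDef

/-- A time oriented elementary spacetime neighborhood, written in its global Gaussian null
coordinates. -/
structure ElementaryNeighborhood where
  /-- the period in `u` -/
  P : ℝ
  P_pos : 0 < P
  /-- the range of `r` is `(-ε, ε)` -/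
  ε : ℝ
  ε_pos : 0 < ε
  /-- the range of `(x³, x⁴)` -/
  V : Set (Fin 2 → ℝ)
  V_open : IsOpen V
  V_connected : IsConnected V
  form : NullForm
  admissible : form.IsAdmissible P (region V fun _ => ε)
  /-- a timelike vector field that gives the time orientation -/
  τ : Coord → Coord
  τ_continuous : ContinuousOn τ (region V fun _ => ε)
  τ_timelike : ∀ p ∈ region V (fun _ => ε), 0 < scalarProd form.metric p (τ p) (τ p)
  /-- `k = ∂/∂u` (which is null where `r = 0`) is future directed on the surface `r = 0` -/
  k_future : ∀ p ∈ region V (fun _ => ε), p 1 = 0 →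
    0 < scalarProd form.metric p (basisVec 0) (τ p)

namespace ElementaryNeighborhood

/-- The coordinate region that represents the neighborhood. -/
def domain (N : ElementaryNeighborhood) : Set Coord := region N.V fun _ => N.ε

/-- The horizon, that is the surface `r = 0`. -/
def horizon (N : ElementaryNeighborhood) : Set Coord := {p | p ∈ N.domain ∧ p 1 = 0}

/-- The spacetime metric of the neighborhood. -/
def metric (N : ElementaryNeighborhood) : Coord → Matrix (Fin 4) (Fin 4) ℝ := N.form.metric

/-- Gaussian null coordinates `(u', r', x'³, x'⁴)` based on the horizon of `N`, for the time
orientation of `N` (`s = 1`) or for the opposite one (`s = -1`). They cover an open neighborhood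
of the horizon in `N`, and `toPoint` sends the new coordinates of a point to the old ones. -/
structure NullCoordinates (N : ElementaryNeighborhood) (s : ℤˣ) where
  /-- the range of `(x'³, x'⁴)` -/
  V : Set (Fin 2 → ℝ)
  V_open : IsOpen V
  /-- the range of `r'` above a point `x'` of `V` is `(-ε x', ε x')` -/
  ε : (Fin 2 → ℝ) → ℝ
  ε_continuous : ContinuousOn ε V
  ε_pos : ∀ x ∈ V, 0 < ε x
  form : NullForm
  admissible : form.IsAdmissible N.P (region V ε)
  toPoint : OpenPartialHomeomorph Coord Coord
  source_eq : toPoint.source = region V ε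
  target_subset : toPoint.target ⊆ N.domain
  horizon_subset : N.horizon ⊆ toPoint.target
  smooth : ContDiffOn ℝ ∞ toPoint toPoint.source
  smooth_symm : ContDiffOn ℝ ∞ toPoint.symm toPoint.target
  /-- the surface `r' = 0` is the horizon -/
  horizon_iff : ∀ p ∈ region V ε, toPoint p 1 = 0 ↔ p 1 = 0
  /-- in the new coordinates the spacetime metric is in Gaussian null form -/
  isometric : ∀ p ∈ region V ε, ∀ v w : Coord,
    scalarProd N.metric (toPoint p) (fderiv ℝ toPoint p v) (fderiv ℝ toPoint p w) =
      scalarProd form.metric p v w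
  /-- the translation of `u'` by the period is the translation of `u` by the period (in the
  opposite direction if the time orientation is reversed) -/
  equivariant : ∀ p ∈ region V ε,
    toPoint (p + N.P • basisVec 0) = toPoint p + (((s : ℤ) : ℝ) * N.P) • basisVec 0
  /-- `∂/∂u'` is future directed on the horizon with respect to the chosen time orientation -/
  k_future : ∀ p ∈ region V ε, p 1 = 0 →
    0 < scalarProd N.metric (toPoint p) (fderiv ℝ toPoint p (basisVec 0))
      (((s : ℤ) : ℝ) • N.τ (toPoint p))

end ElementaryNeighborhood

end Horizon

/-!
The dominant energy condition forces the momentum flux through the horizon to vanish: with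
`∂_u g_{AB} = 0` on `r = 0` the Ricci tensor satisfies `R_{uu} = 0`, so `T^a_u` is causal and
orthogonal to the null vector `∂_u`, hence proportional to it, and `R_{Au} = 0`. In Gaussian null
coordinates this equation reads `∂_A f = ∂_u h_A` (`ricci_horizon`, `pd_f_eq_pd_h`). Since `h_A` is
periodic in `u`, the integral of `f` over a period does not depend on the generator
(`exists_period_integral`), which singles out the constant `κ`: up to a factor it is the mean value
of `f`. The generators can then be given a parameter `U` of the same period `P`, smooth in `(u, x)`,
whose surface gravity is `κ`, by solving `f U_u + 2 U_uu = -2 κ U_u²` with the help of the primitive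
of `exp (-∫ f / 2)` (`exists_rescaling`). Where `κ` comes out negative, `-U` is used, which reverses
the time orientation.

The new coordinates are `U` on the horizon and an affine parameter `r` along the null geodesics that
leave the horizon orthogonally to the surfaces `U = const`. These geodesics are obtained as the
Hamiltonian flow of `g^{ab} ξ_a ξ_b / 2`. Smoothness of this flow is proved through the implicit
function theorem in a space of continuous curves (`contDiffOn_superposition`, `contDiffOn_flow`).
The method of characteristics (`canonical_form_eq`) gives `g(∂_r, ·) = dU` everywhere, that is, the
Gaussian null form of the pulled back metric up to a factor `r`, which comes from Hadamard's lemma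
(`rQuotient`). As the map is periodic and fixes the horizon, compactness in `u` makes it injective on
a region around the horizon whose width is a continuous function of `x` (`exists_injective_region`).

Finally, differentiation of `g(∂_r, ∂_b) = δᵇ_u` expresses the new `f` and `h_A` on the horizon by
tangential derivatives of the transition function `u = φ(u', x)` (`pd_one_pullback`): with
`v = ∂φ/∂u'` one has `f' = v f - 2 v_u' / v` and `h'_A = φ_A f + h_A - 2 v_A / v`. The first is
`-2 κ` by the choice of `U`. The equation `∂_A f = ∂_u h_A` then gives `∂_u' h'_A = ∂_A f' = 0`
(`pd_zero_of_transformed`).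
-/

namespace Horizon

open Set Filter Topology

/-! ### Composition operators and local inverses -/

section Superposition

variable {K : Type*} [TopologicalSpace K] {E F : Type*} [NormedAddCommGroup E]
  [NormedAddCommGroup F]

open Classical in
/-- The superposition operator `γ ↦ f ∘ γ` on continuous maps from a compact space, with the value
`0` where `f ∘ γ` is not continuous. -/
noncomputable def superposition (f : E → F) (γ : C(K, E)) : C(K, F) :=
  if h : Continuous (f ∘ γ) then ⟨f ∘ γ, h⟩ else 0

lemma superposition_apply {f : E → F} {Ω : Set E} (hf : ContinuousOn f Ω) {γ : C(K, E)}
    (hγ : ∀ t, γ t ∈ Ω) (t : K) : superposition f γ t = f (γ t) := by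
  have h : Continuous (f ∘ γ) := hf.comp_continuous γ.continuous hγ
  simp [superposition, h]

/-- The curves with values in `Ω`. -/
def curvesIn (K : Type*) [TopologicalSpace K] (Ω : Set E) : Set C(K, E) := {γ | ∀ t, γ t ∈ Ω}

lemma isOpen_curvesIn [CompactSpace K] {Ω : Set E} (hΩ : IsOpen Ω) : IsOpen (curvesIn K Ω) := by
  have h := ContinuousMap.isOpen_setOfPred_mapsTo (X := K) isCompact_univ hΩ
  convert h using 1
  ext γ
  simp [curvesIn, MapsTo]

variable [CompactSpace K] [NormedSpace ℝ E] [NormedSpace ℝ F]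

/-- Pointwise application of a continuous family of linear maps to a continuous family of
vectors. -/
noncomputable def pointwiseApply (K E F : Type*) [TopologicalSpace K] [CompactSpace K]
    [NormedAddCommGroup E] [NormedSpace ℝ E] [NormedAddCommGroup F] [NormedSpace ℝ F] :
    C(K, E →L[ℝ] F) →L[ℝ] C(K, E) →L[ℝ] C(K, F) :=
  LinearMap.mkContinuous₂
    (LinearMap.mk₂ ℝ
      (fun (A : C(K, E →L[ℝ] F)) (η : C(K, E)) => (⟨fun t => A t (η t), by fun_prop⟩ : C(K, F)))
      (fun _ _ _ => by ext; simp) (fun _ _ _ => by ext; simp)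
      (fun _ _ _ => by ext; simp) (fun _ _ _ => by ext; simp)) 1 (by
    intro A η
    rw [ContinuousMap.norm_le _ (by positivity)]
    intro t
    rw [one_mul]
    exact ((A t).le_opNorm (η t)).trans
      (mul_le_mul (A.norm_coe_le_norm t) (η.norm_coe_le_norm t) (by positivity) (by positivity)))

@[simp] lemma pointwiseApply_apply (A : C(K, E →L[ℝ] F)) (η : C(K, E)) (t : K) :
    pointwiseApply K E F A η t = A t (η t) := rfl

/-- The error of the linear approximation is small uniformly along a compact set. -/
lemma exists_uniform_linear_approx {f : E → F} {Ω : Set E} (hΩ : IsOpen Ω)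
    (hf : ContDiffOn ℝ 1 f Ω) {C : Set E} (hC : IsCompact C) (hCΩ : C ⊆ Ω) {ε : ℝ} (hε : 0 < ε) :
    ∃ δ > 0, ∀ y ∈ C, ∀ z, ‖z - y‖ < δ → ‖f z - f y - fderiv ℝ f y (z - y)‖ ≤ ε * ‖z - y‖ := by
  have hloc : ∀ y ∈ C, ∃ δ > 0, ∀ a ∈ Metric.ball y δ, ∀ b ∈ Metric.ball y δ,
      ‖f a - f b - fderiv ℝ f b (a - b)‖ ≤ ε * ‖a - b‖ := by
    intro y hy
    have hn : Ω ∈ 𝓝 y := hΩ.mem_nhds (hCΩ hy)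
    have hstrict := (hf.contDiffAt hn).hasStrictFDerivAt one_ne_zero
    have hcont : ContinuousAt (fderiv ℝ f) y :=
      (hf.continuousOn_fderiv_of_isOpen hΩ le_rfl).continuousAt hn
    have h1 := hstrict.isLittleO.def (half_pos hε)
    rw [nhds_prod_eq] at h1
    obtain ⟨δ₁, hδ₁, h1⟩ := Metric.nhds_basis_ball.prod_self.eventually_iff.1 h1
    obtain ⟨δ₂, hδ₂, h2⟩ := Metric.continuousAt_iff.1 hcont (ε / 2) (half_pos hε)
    refine ⟨min δ₁ δ₂, lt_min hδ₁ hδ₂, fun a ha b hb => ?_⟩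
    have ha1 := Metric.ball_subset_ball (min_le_left δ₁ δ₂) ha
    have hb1 := Metric.ball_subset_ball (min_le_left δ₁ δ₂) hb
    have hb2 := Metric.ball_subset_ball (min_le_right δ₁ δ₂) hb
    have e1 := h1 (mk_mem_prod ha1 hb1)
    have e2 := h2 hb2
    simp only at e1
    have e3 : f a - f b - fderiv ℝ f b (a - b) =
        (f a - f b - fderiv ℝ f y (a - b)) - (fderiv ℝ f b - fderiv ℝ f y) (a - b) := by
      simp
    rw [e3]
    refine (norm_sub_le _ _).trans ?_
    have e4 := (fderiv ℝ f b - fderiv ℝ f y).le_opNorm (a - b)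
    rw [dist_eq_norm] at e2
    nlinarith [norm_nonneg (a - b), norm_nonneg (fderiv ℝ f b - fderiv ℝ f y)]
  choose! δ hδ hloc using hloc
  obtain ⟨η, hη, hleb⟩ := lebesgue_number_lemma_of_metric (c := fun y : C => Metric.ball (y : E) (δ y))
    hC (fun y => Metric.isOpen_ball)
    (fun y hy => mem_iUnion.2 ⟨⟨y, hy⟩, Metric.mem_ball_self (hδ y hy)⟩)
  refine ⟨η, hη, fun y hy z hz => ?_⟩
  obtain ⟨i, hi⟩ := hleb y hy
  exact hloc i i.2 z (hi (by rwa [Metric.mem_ball, dist_eq_norm])) y (hi (Metric.mem_ball_self hη))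

lemma hasFDerivAt_superposition {f : E → F} {Ω : Set E} (hΩ : IsOpen Ω)
    (hf : ContDiffOn ℝ 1 f Ω) {γ : C(K, E)} (hγ : γ ∈ curvesIn K Ω) :
    HasFDerivAt (superposition f)
      (pointwiseApply K E F (superposition (fderiv ℝ f) γ)) γ := by
  refine .of_isLittleO (Asymptotics.isLittleO_iff.2 fun ε hε => ?_)
  obtain ⟨δ, hδ, happ⟩ := exists_uniform_linear_approx hΩ hf (isCompact_range γ.continuous)
    (range_subset_iff.2 hγ) hε
  filter_upwards [Metric.ball_mem_nhds γ hδ, (isOpen_curvesIn hΩ).mem_nhds hγ] with η hη hηΩ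
  rw [ContinuousMap.norm_le _ (by positivity)]
  intro t
  have h1 : ‖η t - γ t‖ ≤ ‖η - γ‖ := (η - γ).norm_coe_le_norm t
  rw [Metric.mem_ball, dist_eq_norm] at hη
  have h2 := happ (γ t) (mem_range_self t) (η t) (h1.trans_lt hη)
  simp only [ContinuousMap.sub_apply, pointwiseApply_apply,
    superposition_apply hf.continuousOn hηΩ, superposition_apply hf.continuousOn hγ,
    superposition_apply (hf.continuousOn_fderiv_of_isOpen hΩ le_rfl) hγ]
  exact h2.trans (by gcongr)

end Superposition

/-- Composition with a smooth map is a smooth operation on continuous curves. -/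
theorem contDiffOn_superposition.{u, v} {K : Type v} [TopologicalSpace K] [CompactSpace K]
    {E F : Type u} [NormedAddCommGroup E] [NormedSpace ℝ E] [NormedAddCommGroup F]
    [NormedSpace ℝ F] {f : E → F} {Ω : Set E} (hΩ : IsOpen Ω) (hf : ContDiffOn ℝ ∞ f Ω) :
    ContDiffOn ℝ ∞ (superposition (K := K) f) (curvesIn K Ω) := by
  rw [contDiffOn_infty]
  intro n
  induction n generalizing F with
  | zero =>
    rw [Nat.cast_zero, contDiffOn_zero]
    exact fun γ hγ => (hasFDerivAt_superposition hΩ (hf.of_le (by simp))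
      hγ).continuousAt.continuousWithinAt
  | succ n ih =>
    have hO := isOpen_curvesIn (K := K) hΩ
    rw [Nat.cast_succ, contDiffOn_succ_iff_fderiv_of_isOpen hO]
    have hd := fun γ hγ => hasFDerivAt_superposition (K := K) (γ := γ) hΩ (hf.of_le (by simp)) hγ
    refine ⟨fun γ hγ => (hd γ hγ).differentiableAt.differentiableWithinAt, by simp, ?_⟩
    have h1 : ContDiffOn ℝ ∞ (fderiv ℝ f) Ω := hf.fderiv_of_isOpen hΩ (by simp)
    have h2 : ContDiffOn ℝ n (fun γ => pointwiseApply K E F (superposition (fderiv ℝ f) γ))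
        (curvesIn K Ω) := by
      have h3 := ContinuousLinearMap.contDiff (𝕜 := ℝ) (E := C(K, E →L[ℝ] F))
        (F := C(K, E) →L[ℝ] C(K, F)) (n := n) (pointwiseApply K E F)
      exact ContDiff.comp_contDiffOn h3 (ih h1)
    exact h2.congr fun γ hγ => (hd γ hγ).fderiv

section LocalInverse

variable {E F : Type*} [NormedAddCommGroup E] [NormedSpace ℝ E] [CompleteSpace E]
  [NormedAddCommGroup F] [NormedSpace ℝ F]

lemma contDiffOn_symm_of_fderiv {e : OpenPartialHomeomorph E F}
    (he : ContDiffOn ℝ ∞ e e.source)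
    (hd : ∀ x ∈ e.source, ∃ A : E ≃L[ℝ] F, (A : E →L[ℝ] F) = fderiv ℝ e x) :
    ContDiffOn ℝ ∞ e.symm e.target := by
  intro y hy
  have hx := e.map_target hy
  obtain ⟨A, hA⟩ := hd _ hx
  have hc : ContDiffAt ℝ ∞ e (e.symm y) := he.contDiffAt (e.open_source.mem_nhds hx)
  refine (e.contDiffAt_symm (f₀' := A) hy ?_ hc).contDiffWithinAt
  rw [hA]
  exact (hc.differentiableAt (by simp)).hasFDerivAt

/-- The inverse function theorem with a smooth inverse on a whole neighborhood. -/
lemma exists_local_smooth_inverse {f : E → F} {S : Set E} (hS : IsOpen S)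
    (hf : ContDiffOn ℝ ∞ f S) {a : E} (ha : a ∈ S)
    (hd : ∃ A : E ≃L[ℝ] F, (A : E →L[ℝ] F) = fderiv ℝ f a) :
    ∃ e : OpenPartialHomeomorph E F, a ∈ e.source ∧ e.source ⊆ S ∧ (e : E → F) = f ∧
      ContDiffOn ℝ ∞ e.symm e.target := by
  obtain ⟨A, hA⟩ := hd
  have hc : ContDiffAt ℝ ∞ f a := hf.contDiffAt (hS.mem_nhds ha)
  have hfd : HasFDerivAt f (A : E →L[ℝ] F) a := by
    rw [hA]; exact (hc.differentiableAt (by simp)).hasFDerivAt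
  let e₀ := hc.toOpenPartialHomeomorph f hfd (by simp)
  let S' : Set E := S ∩ fderiv ℝ f ⁻¹' (range ContinuousLinearEquiv.toContinuousLinearMap)
  have hS' : IsOpen S' :=
    (hf.continuousOn_fderiv_of_isOpen hS (by simp)).isOpen_inter_preimage hS
      ContinuousLinearEquiv.isOpen
  let e := e₀.restrOpen S' hS'
  have hef : (e : E → F) = f := rfl
  have hsub : e.source ⊆ S' := inter_subset_right
  refine ⟨e, ⟨hc.mem_toOpenPartialHomeomorph_source hfd (by simp), ha, ⟨A, hA⟩⟩,
    hsub.trans inter_subset_left, hef, contDiffOn_symm_of_fderiv ?_ ?_⟩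
  · exact hf.mono (hsub.trans inter_subset_left)
  · exact fun x hx => (hsub hx).2

/-- An injective local diffeomorphism is a diffeomorphism onto its image. -/
lemma exists_smooth_inverse_of_injOn {f : E → F} {S : Set E} (hS : IsOpen S)
    (hf : ContDiffOn ℝ ∞ f S) (hinj : InjOn f S)
    (hd : ∀ x ∈ S, ∃ A : E ≃L[ℝ] F, (A : E →L[ℝ] F) = fderiv ℝ f x) :
    ∃ e : OpenPartialHomeomorph E F, e.source = S ∧ (e : E → F) = f ∧
      ContDiffOn ℝ ∞ e.symm e.target := by
  have hopen : IsOpenMap (S.domRestrict f) := by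
    rw [isOpenMap_iff_nhds_le]
    rintro ⟨x, hx⟩
    obtain ⟨e, hxe, heS, hef, -⟩ := exists_local_smooth_inverse hS hf hx (hd x hx)
    have h1 : map f (𝓝 x) = 𝓝 (f x) := by rw [← hef]; exact e.map_nhds_eq hxe
    have h2 : map (Subtype.val : S → E) (𝓝 ⟨x, hx⟩) = 𝓝 x := map_nhds_subtype_coe_eq_nhds hx (hS.mem_nhds hx)
    rw [show S.domRestrict f = f ∘ Subtype.val from rfl, ← Filter.map_map, h2, h1]
    rfl
  let e := OpenPartialHomeomorph.ofContinuousOpenRestrict (hinj.toPartialEquiv f S)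
    hf.continuousOn hopen hS
  exact ⟨e, rfl, rfl, contDiffOn_symm_of_fderiv (e := e) hf (fun x hx => hd x hx)⟩

end LocalInverse

/-! ### Parametric integrals and flows of smooth vector fields -/

section UnitInterval

open unitInterval

section Primitive

variable (E : Type*) [NormedAddCommGroup E] [NormedSpace ℝ E]

/-- The integral `s ↦ ∫₀ˢ γ` of a continuous curve on the unit interval, as a continuous linear
operator. -/
noncomputable def primitive : C(I, E) →L[ℝ] C(I, E) :=
  LinearMap.mkContinuous
    { toFun := fun γ => ⟨fun s => ∫ t in (0 : ℝ)..s, γ (projIcc 0 1 zero_le_one t),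
        (intervalIntegral.continuous_primitive
          (fun a b => (γ.continuous.comp continuous_projIcc).intervalIntegrable a b) 0).comp
          continuous_subtype_val⟩
      map_add' := fun γ η => by
        ext s
        exact intervalIntegral.integral_add
          ((γ.continuous.comp continuous_projIcc).intervalIntegrable _ _)
          ((η.continuous.comp continuous_projIcc).intervalIntegrable _ _)
      map_smul' := fun c γ => by
        ext s
        exact intervalIntegral.integral_smul c _ } 1 (by
    intro γ
    rw [ContinuousMap.norm_le _ (by positivity)]
    intro s
    have h := intervalIntegral.norm_integral_le_of_norm_le_const (a := (0 : ℝ)) (b := s)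
      (f := fun t => γ (projIcc 0 1 zero_le_one t)) (C := ‖γ‖)
      (fun t _ => γ.norm_coe_le_norm _)
    refine h.trans ?_
    rw [sub_zero, abs_of_nonneg s.2.1, one_mul]
    exact mul_le_of_le_one_right (by positivity) s.2.2)

variable {E}

lemma primitive_apply (γ : C(I, E)) (s : I) :
    primitive E γ s = ∫ t in (0 : ℝ)..s, γ (projIcc 0 1 zero_le_one t) := rfl

variable (E) in
/-- The constant curves, as a continuous linear map. -/
noncomputable def constCurve : E →L[ℝ] C(I, E) :=
  LinearMap.mkContinuous
    { toFun := fun x => ContinuousMap.const I x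
      map_add' := fun _ _ => rfl
      map_smul' := fun _ _ => rfl } 1 (by
    intro x
    rw [ContinuousMap.norm_le _ (by positivity)]
    intro s
    rw [one_mul]
    exact le_rfl)

@[simp] lemma constCurve_apply (x : E) (s : I) : constCurve E x s = x := rfl

end Primitive

/-- A parametric integral of a smooth function over the unit interval is smooth. -/
theorem contDiffOn_integral_param.{u} {E F : Type u} [NormedAddCommGroup E] [NormedSpace ℝ E]
    [NormedAddCommGroup F] [NormedSpace ℝ F] {G : E × ℝ → F} {Ω : Set (E × ℝ)}
    (hΩ : IsOpen Ω) (hG : ContDiffOn ℝ ∞ G Ω) {A : Set E}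
    (hA : ∀ x ∈ A, ∀ t ∈ Icc (0 : ℝ) 1, (x, t) ∈ Ω) :
    ContDiffOn ℝ ∞ (fun x => ∫ t in (0 : ℝ)..1, G (x, t)) A := by
  let c : C(I, E × ℝ) := ⟨fun t => (0, (t : ℝ)), by fun_prop⟩
  let ι : E → C(I, E × ℝ) := fun x =>
    ((constCurve (E × ℝ)).comp (ContinuousLinearMap.inl ℝ E ℝ)) x + c
  have hιt : ∀ x t, ι x t = (x, (t : ℝ)) := fun x t => by simp [ι, c]
  have hι : ContDiff ℝ ∞ ι := (ContinuousLinearMap.contDiff _).add contDiff_const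
  have hmaps : MapsTo ι A (curvesIn I Ω) := fun x hx t => by
    rw [hιt]; exact hA x hx t t.2
  have h1 : ContDiffOn ℝ ∞ (fun x => superposition G (ι x)) A :=
    (contDiffOn_superposition hΩ hG).comp hι.contDiffOn hmaps
  have h2 : ContDiffOn ℝ ∞
      (fun x => ((ContinuousMap.evalCLM ℝ (1 : I)).comp (primitive F)) (superposition G (ι x))) A :=
    ContDiff.comp_contDiffOn (ContinuousLinearMap.contDiff (𝕜 := ℝ) (E := C(I, F)) (F := F)
      ((ContinuousMap.evalCLM ℝ (1 : I)).comp (primitive F))) h1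
  refine h2.congr fun x hx => ?_
  simp only [ContinuousLinearMap.comp_apply, ContinuousMap.evalCLM_apply, primitive_apply]
  refine intervalIntegral.integral_congr fun t ht => ?_
  rw [uIcc_of_le zero_le_one] at ht
  rw [superposition_apply hG.continuousOn (hmaps hx), hιt, projIcc_of_mem zero_le_one ht]

section Flow

/-- `γ` is defined near the unit interval, where it runs in `Ω` along the vector field `r • X`,
starting at `z`. So `t ↦ γ (t / r)` is the integral curve of `X` from `z`. -/
structure IsTrajectory {E : Type*} [NormedAddCommGroup E] [NormedSpace ℝ E] (X : E → E)
    (Ω : Set E) (r : ℝ) (z : E) (γ : ℝ → E) : Prop where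
  start : γ 0 = z
  mem : ∀ t ∈ Icc (0 : ℝ) 1, γ t ∈ Ω
  hasDerivAt : ∀ t ∈ Icc (0 : ℝ) 1, HasDerivAt γ (r • X (γ t)) t

variable {E : Type*} [NormedAddCommGroup E] [NormedSpace ℝ E] {X : E → E} {Ω : Set E}

lemma IsTrajectory.scale {r : ℝ} {z : E} {γ : ℝ → E} (h : IsTrajectory X Ω r z γ) {c : ℝ}
    (hc : c ∈ Icc (0 : ℝ) 1) : IsTrajectory X Ω (r * c) z (fun t => γ (c * t)) where
  start := by simpa using h.start
  mem t ht := h.mem _ ⟨mul_nonneg hc.1 ht.1, mul_le_one₀ hc.2 ht.1 ht.2⟩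
  hasDerivAt t ht := by
    have h1 := h.hasDerivAt (c * t) ⟨mul_nonneg hc.1 ht.1, mul_le_one₀ hc.2 ht.1 ht.2⟩
    have h2 := h1.scomp t ((hasDerivAt_id t).const_mul c)
    rw [smul_smul, mul_one, mul_comm] at h2
    exact h2

lemma IsTrajectory.eqOn (hΩ : IsOpen Ω) (hX : ContDiffOn ℝ ∞ X Ω) {r : ℝ} {z : E}
    {γ η : ℝ → E} (hγ : IsTrajectory X Ω r z γ) (hη : IsTrajectory X Ω r z η) :
    EqOn γ η (Icc 0 1) := by
  have cγ : ContinuousOn γ (Icc 0 1) := fun t ht =>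
    (hγ.hasDerivAt t ht).continuousAt.continuousWithinAt
  have cη : ContinuousOn η (Icc 0 1) := fun t ht =>
    (hη.hasDerivAt t ht).continuousAt.continuousWithinAt
  set C : Set E := γ '' Icc 0 1 ∪ η '' Icc 0 1 with hC
  have hCc : IsCompact C := (isCompact_Icc.image_of_continuousOn cγ).union
    (isCompact_Icc.image_of_continuousOn cη)
  have hCΩ : C ⊆ Ω := by
    rintro y (⟨t, ht, rfl⟩ | ⟨t, ht, rfl⟩)
    exacts [hγ.mem t ht, hη.mem t ht]
  obtain ⟨k, hk⟩ := LocallyLipschitzOn.exists_lipschitzOnWith_of_compact (f := fun y => r • X y)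
    hCc (fun y hy => by
      have hc : ContDiffAt ℝ 1 (fun y => r • X y) y :=
        ((hX.contDiffAt (hΩ.mem_nhds (hCΩ hy))).of_le (by simp)).const_smul r
      obtain ⟨k, t, ht, hk⟩ := hc.exists_lipschitzOnWith
      exact ⟨k, t, mem_nhdsWithin_of_mem_nhds ht, hk⟩)
  have sub : Ico (0 : ℝ) 1 ⊆ Icc 0 1 := Ico_subset_Icc_self
  exact ODE_solution_unique_of_mem_Icc_right (v := fun _ y => r • X y) (s := fun _ => C) (K := k)
    (fun _ _ => hk) cγ (fun t ht => (hγ.hasDerivAt t (sub ht)).hasDerivWithinAt)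
    (fun t ht => Or.inl ⟨t, sub ht, rfl⟩) cη
    (fun t ht => (hη.hasDerivAt t (sub ht)).hasDerivWithinAt)
    (fun t ht => Or.inr ⟨t, sub ht, rfl⟩) (hγ.start.trans hη.start.symm)

open Classical in
/-- The flow of the vector field `X` on `Ω`, for the time `w.1` from the point `w.2`. Its value is
`w.2` where the trajectory does not exist. -/
noncomputable def flow (X : E → E) (Ω : Set E) (w : ℝ × E) : E :=
  if h : ∃ γ, IsTrajectory X Ω w.1 w.2 γ then h.choose 1 else w.2

lemma flow_eq (hΩ : IsOpen Ω) (hX : ContDiffOn ℝ ∞ X Ω) {r : ℝ} {z : E} {γ : ℝ → E}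
    (hγ : IsTrajectory X Ω r z γ) : flow X Ω (r, z) = γ 1 := by
  have h : ∃ γ, IsTrajectory X Ω r z γ := ⟨γ, hγ⟩
  rw [flow, dif_pos h]
  exact h.choose_spec.eqOn hΩ hX hγ ⟨zero_le_one, le_rfl⟩

/-- The pairs of a time and an initial point near which the flow exists and is smooth. -/
def flowDomain (X : E → E) (Ω : Set E) : Set (ℝ × E) :=
  {w | ∃ B : Set (ℝ × E), IsOpen B ∧ w ∈ B ∧ ContDiffOn ℝ ∞ (flow X Ω) B ∧
    ∀ y ∈ B, ∃ γ, IsTrajectory X Ω y.1 y.2 γ}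

lemma isOpen_flowDomain : IsOpen (flowDomain X Ω) := by
  rw [isOpen_iff_mem_nhds]
  rintro w ⟨B, hB, hw, h⟩
  filter_upwards [hB.mem_nhds hw] with y hy using ⟨B, hB, hy, h⟩

lemma contDiffOn_flow : ContDiffOn ℝ ∞ (flow X Ω) (flowDomain X Ω) := by
  rintro w ⟨B, hB, hw, h, -⟩
  exact (h.contDiffAt (hB.mem_nhds hw)).contDiffWithinAt

lemma exists_isTrajectory {w : ℝ × E} (hw : w ∈ flowDomain X Ω) :
    ∃ γ, IsTrajectory X Ω w.1 w.2 γ := by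
  obtain ⟨B, -, hw, -, h⟩ := hw
  exact h w hw

lemma flow_mem (hΩ : IsOpen Ω) (hX : ContDiffOn ℝ ∞ X Ω) {w : ℝ × E}
    (hw : w ∈ flowDomain X Ω) : flow X Ω w ∈ Ω := by
  obtain ⟨γ, hγ⟩ := exists_isTrajectory hw
  rw [flow_eq hΩ hX hγ]
  exact hγ.mem 1 ⟨zero_le_one, le_rfl⟩

lemma flow_zero (hΩ : IsOpen Ω) (hX : ContDiffOn ℝ ∞ X Ω) {z : E} (hz : z ∈ Ω) :
    flow X Ω (0, z) = z :=
  flow_eq hΩ hX (γ := fun _ => z) ⟨rfl, fun _ _ => hz, fun t _ => by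
    simpa using hasDerivAt_const t z⟩

lemma hasDerivAt_flow (hΩ : IsOpen Ω) (hX : ContDiffOn ℝ ∞ X Ω) {r : ℝ} {z : E}
    (hw : (r, z) ∈ flowDomain X Ω) :
    HasDerivAt (fun t => flow X Ω (t, z)) (X (flow X Ω (r, z))) r := by
  have hline : Continuous fun t : ℝ => (t, z) := by fun_prop
  have hne : ∀ r, r ≠ 0 → (r, z) ∈ flowDomain X Ω →
      HasDerivAt (fun t => flow X Ω (t, z)) (X (flow X Ω (r, z))) r := by
    intro r hr hw
    have hev : ∀ᶠ c : ℝ in 𝓝[>] 1, (r * c, z) ∈ flowDomain X Ω := by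
      have h1 : ContinuousAt (fun c : ℝ => (r * c, z)) 1 := by fun_prop
      exact (h1.eventually_mem (by simpa using isOpen_flowDomain.mem_nhds hw)).filter_mono
        nhdsWithin_le_nhds
    obtain ⟨c, hcd, hc⟩ := (hev.and self_mem_nhdsWithin).exists
    have hc1 : (1 : ℝ) < c := hc
    have hc0 : 0 < c := zero_lt_one.trans hc1
    have hrc : r * c ≠ 0 := mul_ne_zero hr hc0.ne'
    obtain ⟨γ, hγ⟩ := exists_isTrajectory hcd
    have hval : ∀ t, t / (r * c) ∈ Icc (0 : ℝ) 1 →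
        flow X Ω (t, z) = γ (t / (r * c)) := by
      intro t ht
      have h1 := flow_eq hΩ hX (hγ.scale ht)
      rwa [mul_one, mul_div_cancel₀ _ hrc] at h1
    have hr1 : r / (r * c) = c⁻¹ := by field_simp
    have hinv : c⁻¹ < 1 := inv_lt_one_of_one_lt₀ hc1
    have hmem : r / (r * c) ∈ Ioo (0 : ℝ) 1 := by
      rw [hr1]; exact ⟨inv_pos.2 hc0, hinv⟩
    have hnear : (fun t => flow X Ω (t, z)) =ᶠ[𝓝 r] fun t => γ (t / (r * c)) := by
      have h1 : ContinuousAt (fun t : ℝ => t / (r * c)) r := by fun_prop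
      filter_upwards [h1.eventually_mem (isOpen_Ioo.mem_nhds hmem)] with t ht
      exact hval t (Ioo_subset_Icc_self ht)
    have hd := (hγ.hasDerivAt _ (Ioo_subset_Icc_self hmem)).scomp r
      ((hasDerivAt_id r).div_const (r * c))
    rw [hnear.hasDerivAt_iff, hval r (Ioo_subset_Icc_self hmem)]
    rw [smul_smul, one_div, inv_mul_cancel₀ hrc, one_smul] at hd
    exact hd
  rcases ne_or_eq r 0 with hr | rfl
  · exact hne r hr hw
  -- At time zero both sides of the equation are continuous in the time.
  have hev : ∀ᶠ t in 𝓝 (0 : ℝ), (t, z) ∈ flowDomain X Ω :=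
    hline.continuousAt.eventually_mem (isOpen_flowDomain.mem_nhds hw)
  have hc : ContDiffAt ℝ ∞ (fun t => flow X Ω (t, z)) 0 :=
    ContDiffAt.comp (g := flow X Ω) (0 : ℝ)
      (contDiffOn_flow.contDiffAt (isOpen_flowDomain.mem_nhds hw))
      (by fun_prop : ContDiffAt ℝ ∞ (fun t : ℝ => (t, z)) 0)
  have hcd : ContinuousAt (deriv fun t => flow X Ω (t, z)) 0 :=
    (hc.continuousAt_fderiv (by simp)).clm_apply continuousAt_const
  have hXc : ContinuousAt (fun t => X (flow X Ω (t, z))) 0 :=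
    ContinuousAt.comp (g := X) (f := fun t => flow X Ω (t, z))
      (hX.continuousOn.continuousAt (hΩ.mem_nhds (flow_mem hΩ hX hw))) hc.continuousAt
  have heq : deriv (fun t => flow X Ω (t, z)) =ᶠ[𝓝[≠] 0] fun t => X (flow X Ω (t, z)) := by
    filter_upwards [self_mem_nhdsWithin, nhdsWithin_le_nhds hev] with t ht ht'
    exact (hne t ht ht').deriv
  have h0 := tendsto_nhds_unique_of_eventuallyEq (hcd.tendsto.mono_left nhdsWithin_le_nhds)
    (hXc.tendsto.mono_left nhdsWithin_le_nhds) heq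
  rw [← h0]
  exact (hc.differentiableAt (by simp)).hasDerivAt

end Flow

/-- Smooth dependence on initial conditions: the flow is smooth near time zero. The rescaled
trajectory on the unit interval solves `γ = z + r ∫ X ∘ γ` in the space of continuous curves,
whose linearization at `r = 0` is the identity. -/
theorem zero_mem_flowDomain.{u} {E : Type u} [NormedAddCommGroup E] [NormedSpace ℝ E]
    [CompleteSpace E] {X : E → E} {Ω : Set E} (hΩ : IsOpen Ω) (hX : ContDiffOn ℝ ∞ X Ω) {z₀ : E}
    (hz₀ : z₀ ∈ Ω) : ((0 : ℝ), z₀) ∈ flowDomain X Ω := by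
  let S : Set ((ℝ × E) × C(I, E)) := univ ×ˢ curvesIn I Ω
  have hS : IsOpen S := isOpen_univ.prod (isOpen_curvesIn hΩ)
  let Q : C(I, E) → C(I, E) := fun γ => primitive E (superposition X γ)
  have hQ : ContDiffOn ℝ ∞ Q (curvesIn I Ω) :=
    ContDiff.comp_contDiffOn (ContinuousLinearMap.contDiff (𝕜 := ℝ) (E := C(I, E))
      (F := C(I, E)) (primitive E)) (contDiffOn_superposition hΩ hX)
  let D : (ℝ × E) × C(I, E) → C(I, E) := fun w => w.2 - constCurve E w.1.2 - w.1.1 • Q w.2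
  have hQ2 : ContDiffOn ℝ ∞ (fun w : (ℝ × E) × C(I, E) => Q w.2) S :=
    hQ.comp contDiff_snd.contDiffOn fun w hw => hw.2
  have hcc : ContDiff ℝ ∞ (fun w : (ℝ × E) × C(I, E) => constCurve E w.1.2) :=
    ContDiff.comp (ContinuousLinearMap.contDiff (𝕜 := ℝ) (E := E) (F := C(I, E)) (constCurve E))
      (by fun_prop)
  have hD : ContDiffOn ℝ ∞ D S :=
    (contDiff_snd.contDiffOn.sub hcc.contDiffOn).sub
      (((contDiff_fst.comp contDiff_fst).contDiffOn).smul hQ2)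
  let Θ : (ℝ × E) × C(I, E) → (ℝ × E) × C(I, E) := fun w => (w.1, D w)
  have hΘ : ContDiffOn ℝ ∞ Θ S := contDiff_fst.contDiffOn.prodMk hD
  let w₀ : (ℝ × E) × C(I, E) := ((0, z₀), constCurve E z₀)
  have hw₀ : w₀ ∈ S := ⟨mem_univ _, fun t => hz₀⟩
  have hinv : ∃ A : ((ℝ × E) × C(I, E)) ≃L[ℝ] ((ℝ × E) × C(I, E)),
      (A : _ →L[ℝ] _) = fderiv ℝ Θ w₀ := by
    let M : (ℝ × E) →L[ℝ] C(I, E) :=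
      -((constCurve E).comp (ContinuousLinearMap.snd ℝ ℝ E)) -
        (ContinuousLinearMap.fst ℝ ℝ E).smulRight (Q w₀.2)
    refine ⟨(ContinuousLinearEquiv.refl ℝ (ℝ × E)).skewProd
      (ContinuousLinearEquiv.refl ℝ C(I, E)) M, ?_⟩
    symm
    apply HasFDerivAt.fderiv
    have h1 : HasFDerivAt (fun w : (ℝ × E) × C(I, E) => Q w.2) (fderiv ℝ (fun w => Q w.2) w₀) w₀ :=
      ((hQ2.contDiffAt (hS.mem_nhds hw₀)).differentiableAt (by simp)).hasFDerivAt
    have h2 : HasFDerivAt (fun w : (ℝ × E) × C(I, E) => w.1.1)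
      ((ContinuousLinearMap.fst ℝ ℝ E).comp (ContinuousLinearMap.fst ℝ (ℝ × E) C(I, E))) w₀ :=
      ContinuousLinearMap.hasFDerivAt ((ContinuousLinearMap.fst ℝ ℝ E).comp
        (ContinuousLinearMap.fst ℝ (ℝ × E) C(I, E)))
    have h3 : HasFDerivAt (fun w : (ℝ × E) × C(I, E) => constCurve E w.1.2)
      ((constCurve E).comp ((ContinuousLinearMap.snd ℝ ℝ E).comp
        (ContinuousLinearMap.fst ℝ (ℝ × E) C(I, E)))) w₀ :=
      ContinuousLinearMap.hasFDerivAt ((constCurve E).comp ((ContinuousLinearMap.snd ℝ ℝ E).comp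
        (ContinuousLinearMap.fst ℝ (ℝ × E) C(I, E))))
    have h4 := (hasFDerivAt_fst (𝕜 := ℝ) (p := w₀)).prodMk
      ((hasFDerivAt_snd.sub h3).sub (h2.smul h1))
    refine HasFDerivAt.congr_fderiv (f := Θ) h4 (ContinuousLinearMap.ext fun w => Prod.ext rfl ?_)
    change w.2 - constCurve E w.1.2 - ((0 : ℝ) • fderiv ℝ (fun w => Q w.2) w₀ w +
      w.1.1 • Q w₀.2) = w.2 + (-constCurve E w.1.2 - w.1.1 • Q w₀.2)
    rw [zero_smul]
    abel
  obtain ⟨e, hwe, heS, hef, hsm⟩ := exists_local_smooth_inverse hS hΘ hw₀ hinv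
  have hew₀ : e w₀ = ((0, z₀), 0) := by
    rw [hef]
    simp [Θ, D, w₀]
  let j : ℝ × E → (ℝ × E) × C(I, E) := fun w => (w, 0)
  have hj : ContDiff ℝ ∞ j := contDiff_id.prodMk contDiff_const
  let B : Set (ℝ × E) := j ⁻¹' e.target
  let Γ : ℝ × E → C(I, E) := fun w => (e.symm (j w)).2
  have hΓ : ∀ w ∈ B, Γ w ∈ curvesIn I Ω ∧ Γ w = constCurve E w.2 + w.1 • Q (Γ w) := by
    intro w hw
    have h1 : e (e.symm (j w)) = j w := e.right_inv hw
    have h2 := heS (e.map_target hw)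
    rw [hef] at h1
    have h3 : (e.symm (j w)).1 = w := congrArg Prod.fst h1
    have h4 : D (e.symm (j w)) = 0 := congrArg Prod.snd h1
    refine ⟨h2.2, ?_⟩
    simp only [D, h3] at h4
    rw [sub_sub, sub_eq_zero] at h4
    exact h4
  have htraj : ∀ w ∈ B, ∃ γ, IsTrajectory X Ω w.1 w.2 γ ∧ γ 1 = Γ w 1 := by
    intro w hw
    obtain ⟨hin, heq⟩ := hΓ w hw
    let ξ : ℝ → E := fun t => X (Γ w (projIcc 0 1 zero_le_one t))
    have hξ : Continuous ξ := hX.continuousOn.comp_continuous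
      ((Γ w).continuous.comp continuous_projIcc) fun t => hin _
    let γ : ℝ → E := fun s => w.2 + w.1 • ∫ t in (0 : ℝ)..s, ξ t
    have hγ : ∀ s (hs : s ∈ Icc (0 : ℝ) 1), γ s = Γ w ⟨s, hs⟩ := by
      intro s hs
      have h1 := congrArg (fun c : C(I, E) => c ⟨s, hs⟩) heq
      simp only [ContinuousMap.add_apply, constCurve_apply, ContinuousMap.smul_apply, Q,
        primitive_apply] at h1
      rw [h1]
      simp only [γ, ξ, superposition_apply hX.continuousOn hin]
    refine ⟨γ, ⟨by simp [γ], fun t ht => by rw [hγ t ht]; exact hin _, fun t ht => ?_⟩,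
      hγ 1 ⟨zero_le_one, le_rfl⟩⟩
    have h1 : HasDerivAt γ (w.1 • ξ t) t :=
      ((intervalIntegral.integral_hasDerivAt_right (hξ.intervalIntegrable _ _)
        (hξ.stronglyMeasurableAtFilter _ _) hξ.continuousAt).const_smul w.1).const_add w.2
    rwa [show ξ t = X (γ t) by rw [hγ t ht]; simp only [ξ, projIcc_of_mem zero_le_one ht]] at h1
  refine ⟨B, e.open_target.preimage hj.continuous, ?_, ?_, fun w hw => ?_⟩
  · change j (0, z₀) ∈ e.target
    rw [show j (0, z₀) = e w₀ from hew₀.symm]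
    exact e.map_source hwe
  · have h1 : ContDiffOn ℝ ∞ Γ B :=
      contDiff_snd.comp_contDiffOn (hsm.comp hj.contDiffOn fun w hw => hw)
    refine (ContDiff.comp_contDiffOn (ContinuousLinearMap.contDiff (𝕜 := ℝ) (E := C(I, E))
      (F := E) (ContinuousMap.evalCLM ℝ (1 : I))) h1).congr fun w hw => ?_
    obtain ⟨γ, hγ, h2⟩ := htraj w hw
    exact (flow_eq hΩ hX hγ).trans h2
  · obtain ⟨γ, hγ, -⟩ := htraj w hw
    exact ⟨γ, hγ⟩

end UnitInterval

/-! ### Coordinate calculus and the inverse metric -/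

section Calculus

variable {F G : Coord → ℝ} {p : Coord} {Ω : Set Coord} {i j : Fin 4}

lemma basisVec_apply (i j : Fin 4) : basisVec i j = if j = i then 1 else 0 := by
  simp [basisVec, Pi.single_apply]

lemma hasDerivAt_line (hF : DifferentiableAt ℝ F p) :
    HasDerivAt (fun t : ℝ => F (p + t • basisVec i)) (pd i F p) 0 := by
  have h1 : HasFDerivAt F (fderiv ℝ F p) (p + (0 : ℝ) • basisVec i) := by
    simpa using hF.hasFDerivAt
  have h2 : HasDerivAt (fun t : ℝ => p + t • basisVec i) (basisVec i) 0 := by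
    simpa using ((hasDerivAt_id (0 : ℝ)).smul_const (basisVec i)).const_add p
  exact h1.comp_hasDerivAt 0 h2

/-- A partial derivative vanishes along a coordinate line on which the function is constant;
differentiability is not needed, since `pd` has the value `0` otherwise. -/
lemma pd_eq_zero_of_line (h : ∀ᶠ t : ℝ in 𝓝 0, F (p + t • basisVec i) = F p) : pd i F p = 0 := by
  by_cases hF : DifferentiableAt ℝ F p
  · have h1 := hasDerivAt_line (i := i) hF
    have h2 : HasDerivAt (fun t : ℝ => F (p + t • basisVec i)) 0 0 :=
      (hasDerivAt_const (0 : ℝ) (F p)).congr_of_eventuallyEq h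
    exact h1.unique h2
  · simp [pd, fderiv_zero_of_not_differentiableAt hF]

lemma pd_congr (h : F =ᶠ[𝓝 p] G) : pd i F p = pd i G p := by rw [pd, pd, h.fderiv_eq]

lemma pd_congr_of_eqOn (hΩ : IsOpen Ω) (hp : p ∈ Ω) (h : EqOn F G Ω) : pd i F p = pd i G p :=
  pd_congr (h.eventuallyEq_of_mem (hΩ.mem_nhds hp))

lemma pd_add (hF : DifferentiableAt ℝ F p) (hG : DifferentiableAt ℝ G p) :
    pd i (fun y => F y + G y) p = pd i F p + pd i G p := by
  simp [pd, fderiv_fun_add hF hG]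

lemma pd_sub (hF : DifferentiableAt ℝ F p) (hG : DifferentiableAt ℝ G p) :
    pd i (fun y => F y - G y) p = pd i F p - pd i G p := by
  simp [pd, fderiv_fun_sub hF hG]

lemma pd_mul (hF : DifferentiableAt ℝ F p) (hG : DifferentiableAt ℝ G p) :
    pd i (fun y => F y * G y) p = pd i F p * G p + F p * pd i G p := by
  simp [pd, fderiv_fun_mul hF hG]; ring

lemma pd_const_mul (c : ℝ) (hF : DifferentiableAt ℝ F p) :
    pd i (fun y => c * F y) p = c * pd i F p := by
  simp [pd, fderiv_const_mul hF]

@[simp] lemma pd_const (c : ℝ) : pd i (fun _ => c) p = 0 := by simp [pd]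

lemma pd_coord (j : Fin 4) : pd i (fun y => y j) p = if j = i then 1 else 0 := by
  have h : HasFDerivAt (fun y : Coord => y j) (ContinuousLinearMap.proj (R := ℝ) j) p :=
    hasFDerivAt_apply j p
  rw [pd, h.fderiv, ContinuousLinearMap.proj_apply, basisVec_apply]

lemma differentiableAt_of_contDiffOn {n : WithTop ℕ∞} (hΩ : IsOpen Ω) (hF : ContDiffOn ℝ n F Ω)
    (hn : n ≠ 0) (hp : p ∈ Ω) : DifferentiableAt ℝ F p :=
  (hF.contDiffAt (hΩ.mem_nhds hp)).differentiableAt hn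

lemma contDiffOn_pd (hΩ : IsOpen Ω) (hF : ContDiffOn ℝ ∞ F Ω) (i : Fin 4) :
    ContDiffOn ℝ ∞ (pd i F) Ω :=
  (hF.fderiv_of_isOpen hΩ (by simp)).clm_apply contDiffOn_const

lemma pd_comm (hΩ : IsOpen Ω) (hF : ContDiffOn ℝ ∞ F Ω) (hp : p ∈ Ω) :
    pd i (pd j F) p = pd j (pd i F) p := by
  have hc := hF.contDiffAt (hΩ.mem_nhds hp)
  have hd : DifferentiableAt ℝ (fderiv ℝ F) p :=
    (hc.fderiv_right (m := 1) (by norm_cast)).differentiableAt (by simp)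
  have h : ∀ i j, pd i (pd j F) p = fderiv ℝ (fderiv ℝ F) p (basisVec i) (basisVec j) := by
    intro i j
    have h1 := (hd.hasFDerivAt.clm_apply (hasFDerivAt_const (basisVec j) p)).fderiv
    have h2 : pd j F = fun y => fderiv ℝ F y (basisVec j) := rfl
    rw [pd, h2, h1]
    simp
  rw [h, h]
  exact (hc.isSymmSndFDerivAt (by simp; norm_cast)) _ _

/-- Functions that agree on the surface `r = 0` have the same tangential derivatives there. -/
lemma pd_congr_horizon (hF : DifferentiableAt ℝ F p) (hG : DifferentiableAt ℝ G p) (hi : i ≠ 1)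
    (hp1 : p 1 = 0) (h : ∀ᶠ y in 𝓝 p, y 1 = 0 → F y = G y) : pd i F p = pd i G p := by
  rw [← sub_eq_zero, ← pd_sub hF hG]
  refine pd_eq_zero_of_line ?_
  have hc : Tendsto (fun t : ℝ => p + t • basisVec i) (𝓝 0) (𝓝 p) := by
    have : Continuous fun t : ℝ => p + t • basisVec i := by fun_prop
    simpa using this.tendsto 0
  filter_upwards [hc.eventually h] with t ht
  rw [ht (by simp [hp1, basisVec_apply, hi.symm]), h.self_of_nhds hp1, sub_self, sub_self]

lemma pd_eq_zero_of_horizon (hi : i ≠ 1) (hp1 : p 1 = 0) (h : ∀ᶠ y in 𝓝 p, y 1 = 0 → F y = 0) :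
    pd i F p = 0 := by
  refine pd_eq_zero_of_line ?_
  have hc : Tendsto (fun t : ℝ => p + t • basisVec i) (𝓝 0) (𝓝 p) := by
    have : Continuous fun t : ℝ => p + t • basisVec i := by fun_prop
    simpa using this.tendsto 0
  filter_upwards [hc.eventually h] with t ht
  rw [ht (by simp [hp1, basisVec_apply, hi.symm]), h.self_of_nhds hp1]

end Calculus

section Region

variable {V : Set (Fin 2 → ℝ)} {ε : (Fin 2 → ℝ) → ℝ}

lemma continuous_transverse : Continuous transverse := by
  unfold transverse
  refine continuous_pi fun i => ?_
  fin_cases i <;> simp <;> fun_prop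

lemma isOpen_cylinder (hV : IsOpen V) : IsOpen {p : Coord | transverse p ∈ V} :=
  hV.preimage continuous_transverse

lemma isOpen_region (hV : IsOpen V) (hε : ContinuousOn ε V) : IsOpen (region V ε) := by
  have h : ContinuousOn (fun p : Coord => ε (transverse p) - |p 1|) {p | transverse p ∈ V} :=
    (hε.comp continuous_transverse.continuousOn fun p hp => hp).sub (by fun_prop)
  have h2 := h.isOpen_inter_preimage (isOpen_cylinder hV) (isOpen_Ioi (a := 0))
  convert h2 using 1
  ext p
  simp [region]

end Region

/-- The projection `(u, r, x) ↦ (u, 0, x)` along the coordinate `r`. -/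
noncomputable def toHorizon : Coord →L[ℝ] Coord :=
  ContinuousLinearMap.id ℝ Coord -
    (ContinuousLinearMap.proj (R := ℝ) (φ := fun _ : Fin 4 => ℝ) 1).smulRight (basisVec 1)

lemma toHorizon_apply (p : Coord) (i : Fin 4) : toHorizon p i = if i = 1 then 0 else p i := by
  have h : toHorizon p i = p i - p 1 * basisVec 1 i := rfl
  rw [h, basisVec_apply]
  split_ifs with hi
  · simp [hi]
  · simp

@[simp] lemma toHorizon_one (p : Coord) : toHorizon p 1 = 0 := by simp [toHorizon_apply]

lemma toHorizon_of_ne (p : Coord) {i : Fin 4} (hi : i ≠ 1) : toHorizon p i = p i := by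
  simp [toHorizon_apply, hi]

@[simp] lemma transverse_toHorizon (p : Coord) : transverse (toHorizon p) = transverse p := by
  simp [transverse, toHorizon_apply]

lemma toHorizon_eq_self {p : Coord} (hp : p 1 = 0) : toHorizon p = p := by
  ext i
  rw [toHorizon_apply]
  split_ifs with hi
  · rw [hi, hp]
  · rfl

@[simp] lemma transverse_add_smul_zero (p : Coord) (t : ℝ) :
    transverse (p + t • basisVec 0) = transverse p := by
  simp [transverse, basisVec_apply]

lemma add_smul_zero_one (p : Coord) (t : ℝ) : (p + t • basisVec 0) 1 = p 1 := by
  simp [basisVec_apply]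

section MetricComponents

/-- The coefficients of `r du dyᵇ` in the metric, that is `f` for `b = 0` and `h_A` in the
transverse directions. -/
def NullForm.lin (F : NullForm) (b : Fin 4) (p : Coord) : ℝ :=
  ![F.f p, 0, F.h p 0, F.h p 1] b

/-- The vector `h^A = g^{AB} h_B`. -/
noncomputable def NullForm.hUp (F : NullForm) (p : Coord) : Fin 2 → ℝ := (F.q p)⁻¹ *ᵥ F.h p

/-- The inverse metric in Gaussian null coordinates. -/
noncomputable def NullForm.inv (F : NullForm) (p : Coord) : Matrix (Fin 4) (Fin 4) ℝ :=
  !![0, 1, 0, 0;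
     1, p 1 * (p 1 * (F.h p 0 * F.hUp p 0 + F.h p 1 * F.hUp p 1)) - p 1 * F.f p,
       -(p 1 * F.hUp p 0), -(p 1 * F.hUp p 1);
     0, -(p 1 * F.hUp p 0), (F.q p)⁻¹ 0 0, (F.q p)⁻¹ 0 1;
     0, -(p 1 * F.hUp p 1), (F.q p)⁻¹ 1 0, (F.q p)⁻¹ 1 1]

variable {F : NullForm} {p : Coord}

lemma isUnit_det_of_neg_posDef {A : Matrix (Fin 2) (Fin 2) ℝ} (hA : (-A).PosDef) :
    IsUnit A.det := by
  have h := hA.det_pos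
  rw [Matrix.det_neg] at h
  simp at h
  exact isUnit_iff_ne_zero.2 h.ne'

lemma symm_of_neg_posDef {A : Matrix (Fin 2) (Fin 2) ℝ} (hA : (-A).PosDef) (i j : Fin 2) :
    A i j = A j i := by
  have h := congrFun (congrFun hA.isHermitian.eq j) i
  simpa using h

lemma metric_mul_inv (hq : (-F.q p).PosDef) : F.metric p * F.inv p = 1 := by
  have hu := isUnit_det_of_neg_posDef hq
  have h1 := Matrix.mul_nonsing_inv (F.q p) hu
  have e : ∀ i j, F.q p i 0 * (F.q p)⁻¹ 0 j + F.q p i 1 * (F.q p)⁻¹ 1 j = (1 : Matrix _ _ ℝ) i j := by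
    intro i j
    rw [← h1, Matrix.mul_apply, Fin.sum_univ_two]
  have e00 := e 0 0
  have e01 := e 0 1
  have e10 := e 1 0
  have e11 := e 1 1
  have hh : ∀ i, F.q p i 0 * F.hUp p 0 + F.q p i 1 * F.hUp p 1 = F.h p i := by
    intro i
    have h2 : F.q p *ᵥ F.hUp p = F.h p := by
      rw [NullForm.hUp, Matrix.mulVec_mulVec, h1, Matrix.one_mulVec]
    rw [← h2]
    simp [Matrix.mulVec, dotProduct, Fin.sum_univ_two]
  have h0 := hh 0
  have h1' := hh 1
  have hQs : ∀ i j, (F.q p)⁻¹ i j = (F.q p)⁻¹ j i := by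
    intro i j
    have hs : (F.q p)ᵀ = F.q p := by ext i j; exact symm_of_neg_posDef hq j i
    have : ((F.q p)⁻¹)ᵀ = (F.q p)⁻¹ := by rw [Matrix.transpose_nonsing_inv, hs]
    exact congrFun (congrFun this j) i
  have hU : ∀ i, F.hUp p i = (F.q p)⁻¹ i 0 * F.h p 0 + (F.q p)⁻¹ i 1 * F.h p 1 := by
    intro i; simp [NullForm.hUp, Matrix.mulVec, dotProduct, Fin.sum_univ_two]
  have hQ := hQs 0 1
  have u0 := hU 0
  have u1 := hU 1
  simp at e00 e01 e10 e11
  ext i j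
  fin_cases i <;> fin_cases j <;>
    simp [NullForm.metric, NullForm.inv, Matrix.mul_apply, Fin.sum_univ_four] <;> grind

lemma inv_metric (hq : (-F.q p).PosDef) : (F.metric p)⁻¹ = F.inv p :=
  Matrix.inv_eq_right_inv (metric_mul_inv hq)

lemma metric_symm (hq : (-F.q p).PosDef) (i j : Fin 4) : F.metric p i j = F.metric p j i := by
  have h := symm_of_neg_posDef hq 0 1
  fin_cases i <;> fin_cases j <;> simp [NullForm.metric, h]

lemma isUnit_det_metric (hq : (-F.q p).PosDef) : IsUnit (F.metric p).det := by
  have h := congrArg Matrix.det (metric_mul_inv hq)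
  rw [Matrix.det_mul, Matrix.det_one] at h
  exact IsUnit.of_mul_eq_one _ h

end MetricComponents

/-! ### Curvature on the horizon -/

namespace NullForm.IsAdmissible

variable {F : NullForm} {P : ℝ} {Ω : Set Coord}

lemma contDiffOn_lin (hF : F.IsAdmissible P Ω) (b : Fin 4) : ContDiffOn ℝ ∞ (F.lin b) Ω := by
  fin_cases b
  exacts [hF.smooth_f, contDiffOn_const, hF.smooth_h 0, hF.smooth_h 1]

lemma contDiffOn_qInv (hF : F.IsAdmissible P Ω) (A B : Fin 2) : ContDiffOn ℝ ∞ (fun p => (F.q p)⁻¹ A B) Ω := by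
  have hdet : ContDiffOn ℝ ∞ (fun p => (F.q p).det) Ω := by
    simp only [Matrix.det_fin_two]
    exact ((hF.smooth_q 0 0).mul (hF.smooth_q 1 1)).sub ((hF.smooth_q 0 1).mul (hF.smooth_q 1 0))
  have hne : ∀ p ∈ Ω, (F.q p).det ≠ 0 := fun p hp =>
    (isUnit_det_of_neg_posDef (hF.neg_def p hp)).ne_zero
  have hadj : ContDiffOn ℝ ∞ (fun p => (F.q p).adjugate A B) Ω := by
    simp only [Matrix.adjugate_fin_two]
    fin_cases A <;> fin_cases B
    exacts [hF.smooth_q 1 1, (hF.smooth_q 0 1).neg, (hF.smooth_q 1 0).neg, hF.smooth_q 0 0]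
  refine ((hdet.inv hne).mul hadj).congr fun p _ => ?_
  simp [Matrix.inv_def]

lemma contDiffOn_hUp (hF : F.IsAdmissible P Ω) (A : Fin 2) : ContDiffOn ℝ ∞ (fun p => F.hUp p A) Ω := by
  refine (((hF.contDiffOn_qInv A 0).mul (hF.smooth_h 0)).add
    ((hF.contDiffOn_qInv A 1).mul (hF.smooth_h 1))).congr fun p _ => ?_
  simp [NullForm.hUp, Matrix.mulVec, dotProduct, Fin.sum_univ_two]

lemma contDiffOn_metric (hF : F.IsAdmissible P Ω) (a b : Fin 4) : ContDiffOn ℝ ∞ (fun p => F.metric p a b) Ω := by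
  have h1 : ContDiffOn ℝ ∞ (fun p : Coord => p 1) Ω := by fun_prop
  fin_cases a <;> fin_cases b
  exacts [h1.mul hF.smooth_f, contDiffOn_const, h1.mul (hF.smooth_h 0), h1.mul (hF.smooth_h 1),
    contDiffOn_const, contDiffOn_const, contDiffOn_const, contDiffOn_const,
    h1.mul (hF.smooth_h 0), contDiffOn_const, hF.smooth_q 0 0, hF.smooth_q 0 1,
    h1.mul (hF.smooth_h 1), contDiffOn_const, hF.smooth_q 1 0, hF.smooth_q 1 1]

lemma contDiffOn_inv (hF : F.IsAdmissible P Ω) (a b : Fin 4) : ContDiffOn ℝ ∞ (fun p => F.inv p a b) Ω := by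
  have h1 : ContDiffOn ℝ ∞ (fun p : Coord => p 1) Ω := by fun_prop
  have hA := fun A => (h1.mul (hF.contDiffOn_hUp A)).neg
  fin_cases a <;> fin_cases b
  exacts [contDiffOn_const, contDiffOn_const, contDiffOn_const, contDiffOn_const,
    contDiffOn_const,
    (h1.mul (h1.mul (((hF.smooth_h 0).mul (hF.contDiffOn_hUp 0)).add
      ((hF.smooth_h 1).mul (hF.contDiffOn_hUp 1))))).sub (h1.mul hF.smooth_f), hA 0, hA 1,
    contDiffOn_const, hA 0, hF.contDiffOn_qInv 0 0, hF.contDiffOn_qInv 0 1,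
    contDiffOn_const, hA 1, hF.contDiffOn_qInv 1 0, hF.contDiffOn_qInv 1 1]

end NullForm.IsAdmissible

lemma NullForm.metric_zero_right (F : NullForm) {b : Fin 4} (hb : b ≠ 1) (y : Coord) :
    F.metric y b 0 = y 1 * F.lin b y := by
  fin_cases b <;> simp [NullForm.metric, NullForm.lin] at hb ⊢

section Curvature

variable {F : NullForm} {P : ℝ} {Ω : Set Coord} {p : Coord}

/-- The derivatives of the metric components on the horizon: the components with an index `u` or
`r` have tangential derivative zero. -/
lemma pd_metric_eq_zero (hp1 : p 1 = 0) {i a b : Fin 4} (hi : i ≠ 1)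
    (hab : a = 0 ∨ a = 1 ∨ b = 0 ∨ b = 1) : pd i (fun y => F.metric y a b) p = 0 := by
  have h1 : ∃ c, ∀ y : Coord, y 1 = 0 → F.metric y a b = c := by
    fin_cases a <;> fin_cases b <;> simp [NullForm.metric] at hab ⊢ <;>
      first
      | exact ⟨0, fun y hy => by rw [hy, zero_mul]⟩
      | exact ⟨_, fun y _ => rfl⟩
  obtain ⟨c, hc⟩ := h1
  refine pd_eq_zero_of_line (Eventually.of_forall fun t => ?_)
  rw [hc _ (by simp [hp1, basisVec_apply, hi.symm]), hc _ hp1]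

lemma pd_metric_one (i b : Fin 4) :
    pd i (fun y => F.metric y 1 b) p = 0 ∧ pd i (fun y => F.metric y b 1) p = 0 := by
  fin_cases b <;> simp [NullForm.metric]

lemma pd_one_r_mul {G : Coord → ℝ} (hG : DifferentiableAt ℝ G p) (hp1 : p 1 = 0) :
    pd 1 (fun y => y 1 * G y) p = G p := by
  rw [pd_mul (by fun_prop) hG, pd_coord, hp1]
  simp

lemma pd_one_metric_zero (hF : F.IsAdmissible P Ω) (hΩ : IsOpen Ω) (hp : p ∈ Ω) (hp1 : p 1 = 0) :
    pd 1 (fun y => F.metric y 0 0) p = F.f p ∧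
    pd 1 (fun y => F.metric y 0 2) p = F.h p 0 ∧ pd 1 (fun y => F.metric y 2 0) p = F.h p 0 ∧
    pd 1 (fun y => F.metric y 0 3) p = F.h p 1 ∧ pd 1 (fun y => F.metric y 3 0) p = F.h p 1 := by
  have hd := fun {G : Coord → ℝ} (h : ContDiffOn ℝ ∞ G Ω) =>
    pd_one_r_mul (differentiableAt_of_contDiffOn hΩ h (by simp) hp) hp1
  exact ⟨hd hF.smooth_f, hd (hF.smooth_h 0), hd (hF.smooth_h 0), hd (hF.smooth_h 1),
    hd (hF.smooth_h 1)⟩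

lemma christoffel_eq_inv (hF : F.IsAdmissible P Ω) (hp : p ∈ Ω) (a b c : Fin 4) :
    christoffel F.metric a b c p = (1 / 2 : ℝ) * ∑ d, F.inv p a d *
      (pd b (fun y => F.metric y d c) p + pd c (fun y => F.metric y d b) p -
        pd d (fun y => F.metric y b c) p) := by
  rw [christoffel, inv_metric (hF.neg_def p hp)]

lemma contDiffOn_christoffel (hF : F.IsAdmissible P Ω) (hΩ : IsOpen Ω) (a b c : Fin 4) :
    ContDiffOn ℝ ∞ (christoffel F.metric a b c) Ω := by
  refine (contDiffOn_const.mul (ContDiffOn.sum fun d _ => (hF.contDiffOn_inv a d).mul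
    (((contDiffOn_pd hΩ (hF.contDiffOn_metric d c) b).add
      (contDiffOn_pd hΩ (hF.contDiffOn_metric d b) c)).sub
      (contDiffOn_pd hΩ (hF.contDiffOn_metric b c) d)))).congr fun p hp => christoffel_eq_inv hF hp a b c

lemma christoffel_zero (hF : F.IsAdmissible P Ω) (hp : p ∈ Ω) (b c : Fin 4) :
    christoffel F.metric 0 b c p = -(1 / 2 : ℝ) * pd 1 (fun y => F.metric y b c) p := by
  rw [christoffel_eq_inv hF hp, Fin.sum_univ_four, (pd_metric_one b c).1, (pd_metric_one c b).1]
  simp [NullForm.inv]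

lemma christoffel_one (hF : F.IsAdmissible P Ω) (hp : p ∈ Ω) (hp1 : p 1 = 0) (b c : Fin 4) :
    christoffel F.metric 1 b c p = (1 / 2 : ℝ) * (pd b (fun y => F.metric y 0 c) p +
      pd c (fun y => F.metric y 0 b) p - pd 0 (fun y => F.metric y b c) p) := by
  rw [christoffel_eq_inv hF hp, Fin.sum_univ_four]
  simp [NullForm.inv, hp1]

lemma christoffel_transverse (hF : F.IsAdmissible P Ω) (hp : p ∈ Ω) (hp1 : p 1 = 0)
    (b c : Fin 4) (A : Fin 2) :
    christoffel F.metric (![2, 3] A) b c p = (1 / 2 : ℝ) *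
      ((F.q p)⁻¹ A 0 * (pd b (fun y => F.metric y 2 c) p + pd c (fun y => F.metric y 2 b) p -
        pd 2 (fun y => F.metric y b c) p) +
      (F.q p)⁻¹ A 1 * (pd b (fun y => F.metric y 3 c) p + pd c (fun y => F.metric y 3 b) p -
        pd 3 (fun y => F.metric y b c) p)) := by
  rw [christoffel_eq_inv hF hp, Fin.sum_univ_four]
  fin_cases A <;> simp [NullForm.inv, hp1]

lemma metric_zero_comm (b : Fin 4) (y : Coord) : F.metric y 0 b = F.metric y b 0 := by
  fin_cases b <;> rfl

lemma pd_one_metric_lin (hF : F.IsAdmissible P Ω) (hΩ : IsOpen Ω) (hp : p ∈ Ω) (hp1 : p 1 = 0)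
    {b : Fin 4} (hb : b ≠ 1) : pd 1 (fun y => F.metric y b 0) p = F.lin b p := by
  simp only [F.metric_zero_right hb]
  exact pd_one_r_mul (differentiableAt_of_contDiffOn hΩ (hF.contDiffOn_lin b) (by simp) hp) hp1

/-- The derivatives `∂_u g_{ab}` vanish on the horizon if the `∂_u g_{AB}` do. -/
lemma pd_zero_metric (hp1 : p 1 = 0) (hq : ∀ A B, pd 0 (fun y => F.q y A B) p = 0) (a b : Fin 4) :
    pd 0 (fun y => F.metric y a b) p = 0 := by
  by_cases hab : a = 0 ∨ a = 1 ∨ b = 0 ∨ b = 1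
  · exact pd_metric_eq_zero hp1 (by simp) hab
  · fin_cases a <;> fin_cases b <;>
      first
      | exact hq _ _
      | exact absurd (by simp) hab

lemma christoffel_zero_lin (hF : F.IsAdmissible P Ω) (hΩ : IsOpen Ω) (hp : p ∈ Ω) (hp1 : p 1 = 0)
    {b : Fin 4} (hb : b ≠ 1) : christoffel F.metric 0 b 0 p = -(1 / 2 : ℝ) * F.lin b p := by
  rw [christoffel_zero hF hp, pd_one_metric_lin hF hΩ hp hp1 hb]

lemma christoffel_one_tangential (hF : F.IsAdmissible P Ω) (hp : p ∈ Ω) (hp1 : p 1 = 0)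
    (hq : ∀ A B, pd 0 (fun y => F.q y A B) p = 0) {b c : Fin 4} (hb : b ≠ 1) (hc : c ≠ 1) :
    christoffel F.metric 1 b c p = 0 := by
  rw [christoffel_one hF hp hp1, pd_metric_eq_zero hp1 hb (by simp),
    pd_metric_eq_zero hp1 hc (by simp), pd_zero_metric hp1 hq]
  simp

lemma christoffel_one_lin (hF : F.IsAdmissible P Ω) (hΩ : IsOpen Ω) (hp : p ∈ Ω) (hp1 : p 1 = 0)
    {b : Fin 4} (hb : b ≠ 1) : christoffel F.metric 1 b 1 p = (1 / 2 : ℝ) * F.lin b p ∧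
      christoffel F.metric 1 1 b p = (1 / 2 : ℝ) * F.lin b p := by
  have h : pd 1 (fun y => F.metric y 0 b) p = F.lin b p := by
    simp only [metric_zero_comm]
    exact pd_one_metric_lin hF hΩ hp hp1 hb
  rw [christoffel_one hF hp hp1, christoffel_one hF hp hp1, h, (pd_metric_one _ _).1,
    (pd_metric_one _ _).2, (pd_metric_one _ _).2]
  simp

lemma christoffel_transverse_zero (hF : F.IsAdmissible P Ω) (hp : p ∈ Ω) (hp1 : p 1 = 0)
    (hq : ∀ A B, pd 0 (fun y => F.q y A B) p = 0) {b : Fin 4} (hb : b ≠ 1) (A : Fin 2) :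
    christoffel F.metric (![2, 3] A) b 0 p = 0 ∧ christoffel F.metric (![2, 3] A) 0 b p = 0 := by
  have h2 := pd_metric_eq_zero (F := F) hp1 (i := 2) (a := b) (b := 0) (by simp) (by simp)
  have h3 := pd_metric_eq_zero (F := F) hp1 (i := 3) (a := b) (b := 0) (by simp) (by simp)
  have h2' := pd_metric_eq_zero (F := F) hp1 (i := 2) (a := 0) (b := b) (by simp) (by simp)
  have h3' := pd_metric_eq_zero (F := F) hp1 (i := 3) (a := 0) (b := b) (by simp) (by simp)
  have e2 := pd_metric_eq_zero (F := F) hp1 (a := 2) (b := 0) hb (by simp)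
  have e3 := pd_metric_eq_zero (F := F) hp1 (a := 3) (b := 0) hb (by simp)
  rw [christoffel_transverse hF hp hp1, christoffel_transverse hF hp hp1, h2, h3, h2', h3', e2, e3,
    pd_zero_metric hp1 hq, pd_zero_metric hp1 hq]
  simp

/-- A function whose derivative `∂_u` vanishes on the horizon is locally constant in `u` there. -/
lemma eventually_eq_of_pd_zero {G : Coord → ℝ} (hΩ : IsOpen Ω) (hG : ContDiffOn ℝ ∞ G Ω)
    (hp : p ∈ Ω) (hp1 : p 1 = 0) (h : ∀ y ∈ Ω, y 1 = 0 → pd 0 G y = 0) :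
    ∀ᶠ t : ℝ in 𝓝 0, G (p + t • basisVec 0) = G p := by
  have hc : Continuous fun t : ℝ => p + t • basisVec 0 := by fun_prop
  have hmem : ∀ᶠ t : ℝ in 𝓝 0, p + t • basisVec 0 ∈ Ω :=
    hc.continuousAt.eventually_mem (by simpa using hΩ.mem_nhds hp)
  obtain ⟨δ, hδ, hball⟩ := Metric.eventually_nhds_iff_ball.1 hmem
  have hd : ∀ t ∈ Metric.ball (0 : ℝ) δ, HasDerivAt (fun t : ℝ => G (p + t • basisVec 0)) 0 t := by
    intro t ht
    have h1 := hasDerivAt_line (i := 0) (differentiableAt_of_contDiffOn hΩ hG (by simp) (hball t ht))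
    rw [h _ (hball t ht) (by rw [add_smul_zero_one, hp1])] at h1
    have h2 := HasDerivAt.scomp_of_eq (g₁ := fun s : ℝ => G (p + t • basisVec 0 + s • basisVec 0))
      t h1 ((hasDerivAt_id t).sub_const t) (by simp)
    rw [smul_zero] at h2
    refine h2.congr_of_eventuallyEq (Eventually.of_forall fun s => ?_)
    simp only [Function.comp_apply, id]
    rw [add_assoc, ← add_smul, add_sub_cancel]
  filter_upwards [Metric.ball_mem_nhds (0 : ℝ) hδ] with t ht
  have := Metric.isOpen_ball.is_const_of_deriv_eq_zero (convex_ball (0 : ℝ) δ).isPreconnected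
    (fun s hs => (hd s hs).differentiableAt.differentiableWithinAt) (fun s hs => (hd s hs).deriv)
    ht (Metric.mem_ball_self hδ)
  simpa using this

lemma pd_zero_christoffel_transverse (hF : F.IsAdmissible P Ω) (hΩ : IsOpen Ω) (hp : p ∈ Ω)
    (hp1 : p 1 = 0) (hq : ∀ y ∈ Ω, y 1 = 0 → ∀ A B, pd 0 (fun y => F.q y A B) y = 0)
    {b c : Fin 4} (hb : b ≠ 1) (hc : c ≠ 1) (A : Fin 2) :
    pd 0 (christoffel F.metric (![2, 3] A) b c) p = 0 := by
  have hm : ∀ᶠ t : ℝ in 𝓝 0, p + t • basisVec 0 ∈ Ω := by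
    have hc : Continuous fun t : ℝ => p + t • basisVec 0 := by fun_prop
    exact hc.continuousAt.eventually_mem (by simpa using hΩ.mem_nhds hp)
  have hQ : ∀ᶠ t : ℝ in 𝓝 0, F.q (p + t • basisVec 0) = F.q p := by
    have h := fun A B => eventually_eq_of_pd_zero hΩ (hF.smooth_q A B) hp hp1
      fun y hy hy1 => hq y hy hy1 A B
    filter_upwards [h 0 0, h 0 1, h 1 0, h 1 1] with t h1 h2 h3 h4
    ext i j
    fin_cases i <;> fin_cases j
    exacts [h1, h2, h3, h4]
  have hd : ∀ i ≠ 1, ∀ a b, ∀ᶠ t : ℝ in 𝓝 0,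
      pd i (fun y => F.metric y a b) (p + t • basisVec 0) = pd i (fun y => F.metric y a b) p := by
    intro i hi a b
    refine eventually_eq_of_pd_zero hΩ (contDiffOn_pd hΩ (hF.contDiffOn_metric a b) i) hp hp1
      fun y hy hy1 => ?_
    rw [pd_comm hΩ (hF.contDiffOn_metric a b) hy]
    refine pd_eq_zero_of_horizon hi hy1 ?_
    filter_upwards [hΩ.mem_nhds hy] with z hz hz1
    exact pd_zero_metric hz1 (hq z hz hz1) a b
  refine pd_eq_zero_of_line ?_
  filter_upwards [hm, hQ, hd b hb 2 c, hd c hc 2 b, hd 2 (by simp) b c, hd b hb 3 c, hd c hc 3 b,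
    hd 3 (by simp) b c] with t h0 h1 h2 h3 h4 h5 h6 h7
  rw [christoffel_transverse hF h0 (by rw [add_smul_zero_one, hp1]), christoffel_transverse hF hp hp1, h1, h2, h3,
    h4, h5, h6, h7]

lemma pd_sum {ι : Type*} (s : Finset ι) {G : ι → Coord → ℝ} {i : Fin 4}
    (hG : ∀ d ∈ s, DifferentiableAt ℝ (G d) p) :
    pd i (fun y => ∑ d ∈ s, G d y) p = ∑ d ∈ s, pd i (G d) p := by
  simp [pd, fderiv_fun_sum hG]

/-- The only derivative of a Christoffel symbol off the horizon that enters `R_{b u}`. Only the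
first `r`-derivatives of the metric components that vanish at `r = 0` contribute. -/
lemma pd_one_christoffel_one (hF : F.IsAdmissible P Ω) (hΩ : IsOpen Ω) (hp : p ∈ Ω)
    (hp1 : p 1 = 0) (hq : ∀ y ∈ Ω, y 1 = 0 → ∀ A B, pd 0 (fun y => F.q y A B) y = 0)
    {b : Fin 4} (hb : b ≠ 1) :
    pd 1 (christoffel F.metric 1 b 0) p = (1 / 2 : ℝ) * (pd b F.f p + F.f p * F.lin b p) := by
  -- `B d / 2` is the Christoffel symbol with all indices lowered; the sum over `d` raises `d` to `1`.
  let B : Fin 4 → Coord → ℝ := fun d y => pd b (fun y => F.metric y d 0) y +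
    pd 0 (fun y => F.metric y d b) y - pd d (fun y => F.metric y b 0) y
  have hg := hF.contDiffOn_metric
  have hB : ∀ d, ContDiffOn ℝ ∞ (B d) Ω := fun d =>
    ((contDiffOn_pd hΩ (hg d 0) b).add (contDiffOn_pd hΩ (hg d b) 0)).sub
      (contDiffOn_pd hΩ (hg b 0) d)
  have hBd := fun d => differentiableAt_of_contDiffOn hΩ (hB d) (by simp) hp
  have hJd := fun d => differentiableAt_of_contDiffOn hΩ (hF.contDiffOn_inv 1 d) (by simp) hp
  have h1 : pd 1 (christoffel F.metric 1 b 0) p =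
      (1 / 2 : ℝ) * ∑ d, (pd 1 (fun y => F.inv y 1 d) p * B d p + F.inv p 1 d * pd 1 (B d) p) := by
    have e : EqOn (christoffel F.metric 1 b 0)
        (fun y => (1 / 2 : ℝ) * ∑ d, F.inv y 1 d * B d y) Ω :=
      fun y hy => christoffel_eq_inv hF hy 1 b 0
    have hm : ∀ d ∈ Finset.univ, DifferentiableAt ℝ (fun y => F.inv y 1 d * B d y) p :=
      fun d _ => (hJd d).fun_mul (hBd d)
    rw [pd_congr_of_eqOn hΩ hp e, pd_const_mul _ (DifferentiableAt.fun_sum hm), pd_sum _ hm]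
    simp only [pd_mul (hJd _) (hBd _)]
  have hq' := hq p hp hp1
  have B1 : B 1 p = -F.lin b p := by
    simp only [B, (pd_metric_one _ _).1, pd_one_metric_lin hF hΩ hp hp1 hb]
    simp
  have B2 : B 2 p = 0 := by
    simp only [B, pd_metric_eq_zero (F := F) hp1 hb (a := 2) (b := 0) (by simp),
      pd_zero_metric hp1 hq', pd_metric_eq_zero (F := F) hp1 (i := 2) (a := b) (b := 0) (by simp)
        (by simp)]
    simp
  have B3 : B 3 p = 0 := by
    simp only [B, pd_metric_eq_zero (F := F) hp1 hb (a := 3) (b := 0) (by simp),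
      pd_zero_metric hp1 hq', pd_metric_eq_zero (F := F) hp1 (i := 3) (a := b) (b := 0) (by simp)
        (by simp)]
    simp
  have J0 : pd 1 (fun y => F.inv y 1 0) p = 0 := by simp [NullForm.inv]
  have J1 : pd 1 (fun y => F.inv y 1 1) p = -F.f p := by
    have hs : ContDiffOn ℝ ∞ (fun y : Coord => y 1 *
        (F.h y 0 * F.hUp y 0 + F.h y 1 * F.hUp y 1) - F.f y) Ω :=
      ((by fun_prop : ContDiffOn ℝ ∞ (fun y : Coord => y 1) Ω).mul
        (((hF.smooth_h 0).mul (hF.contDiffOn_hUp 0)).add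
          ((hF.smooth_h 1).mul (hF.contDiffOn_hUp 1)))).sub hF.smooth_f
    have h2 := pd_one_r_mul (differentiableAt_of_contDiffOn hΩ hs (by simp) hp) hp1
    rw [hp1, zero_mul, zero_sub] at h2
    rw [← h2]
    congr 1
    ext y
    simp [NullForm.inv]
    ring
  have B0 : pd 1 (B 0) p = pd b F.f p := by
    have e : B 0 = pd b (fun y => F.metric y 0 0) := by
      ext y
      simp [B, metric_zero_comm b]
    rw [e, pd_comm hΩ (hg 0 0) hp]
    refine pd_congr_horizon (differentiableAt_of_contDiffOn hΩ (contDiffOn_pd hΩ (hg 0 0) 1)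
      (by simp) hp) (differentiableAt_of_contDiffOn hΩ hF.smooth_f (by simp) hp) hb hp1 ?_
    filter_upwards [hΩ.mem_nhds hp] with y hy hy1
    exact (pd_one_metric_zero hF hΩ hy hy1).1
  rw [h1, Fin.sum_univ_four, J0, J1, B0, B1, B2, B3]
  simp [NullForm.inv, hp1]

/-- On a horizon with `∂_u g_{AB} = 0` one has `R_{b u} = (∂_b f - ∂_u h_b) / 2` for the tangential
directions `b`, where `h_u` stands for `f`. -/
theorem ricci_horizon (hF : F.IsAdmissible P Ω) (hΩ : IsOpen Ω) (hp : p ∈ Ω) (hp1 : p 1 = 0)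
    (hq : ∀ y ∈ Ω, y 1 = 0 → ∀ A B, pd 0 (fun y => F.q y A B) y = 0) {b : Fin 4} (hb : b ≠ 1) :
    ricci F.metric p b 0 = (1 / 2 : ℝ) * (pd b F.f p - pd 0 (F.lin b) p) := by
  have hq' := hq p hp hp1
  have n0 : (0 : Fin 4) ≠ 1 := by simp
  have n2 : (2 : Fin 4) ≠ 1 := by simp
  have n3 : (3 : Fin 4) ≠ 1 := by simp
  have t2 : ∀ {y : Coord}, y ∈ Ω → y 1 = 0 → ∀ {c : Fin 4}, c ≠ 1 →
      christoffel F.metric 2 c 0 y = 0 ∧ christoffel F.metric 2 0 c y = 0 :=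
    fun {_} hy hy1 {_} hc => christoffel_transverse_zero hF hy hy1 (hq _ hy hy1) hc 0
  have t3 : ∀ {y : Coord}, y ∈ Ω → y 1 = 0 → ∀ {c : Fin 4}, c ≠ 1 →
      christoffel F.metric 3 c 0 y = 0 ∧ christoffel F.metric 3 0 c y = 0 :=
    fun {_} hy hy1 {_} hc => christoffel_transverse_zero hF hy hy1 (hq _ hy hy1) hc 1
  have d2 : pd 2 (christoffel F.metric 2 b 0) p = 0 := pd_eq_zero_of_horizon n2 hp1 (by
    filter_upwards [hΩ.mem_nhds hp] with y hy hy1 using (t2 hy hy1 hb).1)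
  have d3 : pd 3 (christoffel F.metric 3 b 0) p = 0 := pd_eq_zero_of_horizon n3 hp1 (by
    filter_upwards [hΩ.mem_nhds hp] with y hy hy1 using (t3 hy hy1 hb).1)
  have e2 : pd 0 (christoffel F.metric 2 b 2) p = 0 :=
    pd_zero_christoffel_transverse hF hΩ hp hp1 hq hb n2 0
  have e3 : pd 0 (christoffel F.metric 3 b 3) p = 0 :=
    pd_zero_christoffel_transverse hF hΩ hp hp1 hq hb n3 1
  have e1 : pd 0 (christoffel F.metric 1 b 1) p = (1 / 2 : ℝ) * pd 0 (F.lin b) p := by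
    have hl := differentiableAt_of_contDiffOn hΩ (hF.contDiffOn_lin b) (by simp) hp
    rw [← pd_const_mul _ hl]
    refine pd_congr_horizon (differentiableAt_of_contDiffOn hΩ
      (contDiffOn_christoffel hF hΩ 1 b 1) (by simp) hp) (hl.const_mul _) n0 hp1 ?_
    filter_upwards [hΩ.mem_nhds hp] with y hy hy1 using (christoffel_one_lin hF hΩ hy hy1 hb).1
  have z := fun {c d : Fin 4} => christoffel_one_tangential hF hp hp1 hq' (b := c) (c := d)
  have v01 : christoffel F.metric 0 0 1 p = 0 := by
    rw [christoffel_zero hF hp, (pd_metric_one _ _).2, mul_zero]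
  simp only [ricci, Matrix.of_apply, Fin.sum_univ_four]
  rw [d2, d3, e1, e2, e3, pd_one_christoffel_one hF hΩ hp hp1 hq hb,
    christoffel_zero_lin hF hΩ hp hp1 hb, christoffel_zero_lin hF hΩ hp hp1 n0,
    (christoffel_one_lin hF hΩ hp hp1 hb).1, (christoffel_one_lin hF hΩ hp hp1 n0).1,
    (christoffel_one_lin hF hΩ hp hp1 n0).2, z hb n0, z n0 n0, z n0 n2, z n0 n3, z hb n2, z hb n3,
    (t2 hp hp1 hb).1, (t2 hp hp1 n0).1, (t2 hp hp1 n2).1, (t2 hp hp1 n2).2, (t2 hp hp1 n3).2,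
    (t3 hp hp1 hb).1, (t3 hp hp1 n0).1, (t3 hp hp1 n3).1, (t3 hp hp1 n2).2, (t3 hp hp1 n3).2, v01]
  simp only [NullForm.lin, Matrix.cons_val_zero]
  ring

/-- In Gaussian null coordinates `∂_u` is a pregeodesic field on the horizon, with surface gravity
`-f / 2`. -/
lemma christoffel_horizon_geodesic (hF : F.IsAdmissible P Ω) (hΩ : IsOpen Ω) (hp : p ∈ Ω)
    (hp1 : p 1 = 0) (a : Fin 4) :
    christoffel F.metric a 0 0 p = -(1 / 2 : ℝ) * F.f p * basisVec 0 a := by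
  have z := fun (i a b : Fin 4) (hi : i ≠ 1) h =>
    pd_metric_eq_zero (F := F) hp1 hi (a := a) (b := b) h
  have h1 := (pd_one_metric_zero hF hΩ hp hp1).1
  rw [christoffel_eq_inv hF hp, Fin.sum_univ_four, z 0 0 0 (by simp) (by simp),
    z 0 1 0 (by simp) (by simp), z 0 2 0 (by simp) (by simp), z 0 3 0 (by simp) (by simp),
    z 2 0 0 (by simp) (by simp), z 3 0 0 (by simp) (by simp), h1]
  fin_cases a <;> simp [NullForm.inv, basisVec_apply, hp1]

end Curvature

/-! ### The dominant energy condition on the horizon -/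

section Energy

variable {g : Coord → Matrix (Fin 4) (Fin 4) ℝ} {p : Coord}

lemma scalarProd_eq_sum (v w : Coord) : scalarProd g p v w = ∑ i, ∑ j, v i * g p i j * w j := by
  simp only [scalarProd, dotProduct, Matrix.mulVec, Finset.mul_sum, mul_assoc]

lemma scalarProd_add_left (v v' w : Coord) :
    scalarProd g p (v + v') w = scalarProd g p v w + scalarProd g p v' w := by
  simp [scalarProd, add_dotProduct]

lemma scalarProd_add_right (v w w' : Coord) :
    scalarProd g p v (w + w') = scalarProd g p v w + scalarProd g p v w' := by
  simp [scalarProd, Matrix.mulVec_add, dotProduct_add]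

lemma scalarProd_smul_left (c : ℝ) (v w : Coord) :
    scalarProd g p (c • v) w = c * scalarProd g p v w := by
  simp [scalarProd]

lemma scalarProd_smul_right (c : ℝ) (v w : Coord) :
    scalarProd g p v (c • w) = c * scalarProd g p v w := by
  simp [scalarProd, Matrix.mulVec_smul]

lemma scalarProd_comm (hs : ∀ i j, g p i j = g p j i) (v w : Coord) :
    scalarProd g p v w = scalarProd g p w v := by
  rw [scalarProd_eq_sum, scalarProd_eq_sum, Finset.sum_comm]
  refine Finset.sum_congr rfl fun i _ => Finset.sum_congr rfl fun j _ => ?_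
  rw [hs]
  ring

/-- The dominant energy condition extends to null vectors `k` that have positive product with the
time orientation: `Tᵃ_b kᵇ` is not spacelike. -/
lemma DominantEnergy.nonneg_of_null {T : Coord → Matrix (Fin 4) (Fin 4) ℝ} {τ : Coord → Coord}
    {Ω : Set Coord} (h : DominantEnergy g T τ Ω) (hp : p ∈ Ω) (hs : ∀ i j, g p i j = g p j i)
    (hτ : 0 < scalarProd g p (τ p) (τ p)) {k : Coord} (hk : scalarProd g p k k = 0)
    (hkτ : 0 < scalarProd g p k (τ p)) :
    0 ≤ scalarProd g p ((g p)⁻¹ *ᵥ (T p *ᵥ k)) ((g p)⁻¹ *ᵥ (T p *ᵥ k)) := by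
  let W : ℝ → Coord := fun t => (g p)⁻¹ *ᵥ (T p *ᵥ (k + t • τ p))
  have hW : Continuous fun t => scalarProd g p (W t) (W t) := by
    have h1 : Continuous W := by
      simp only [W, Matrix.mulVec_add, Matrix.mulVec_smul]
      fun_prop
    simp only [scalarProd_eq_sum]
    fun_prop
  have hpos : ∀ t > 0, 0 ≤ scalarProd g p (W t) (W t) := by
    intro t ht
    refine (h p hp (k + t • τ p) ⟨?_, ?_⟩).1
    · simp only [scalarProd_add_left, scalarProd_add_right, scalarProd_smul_left,
        scalarProd_smul_right, hk, scalarProd_comm hs (τ p) k]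
      positivity
    · simp only [scalarProd_add_left, scalarProd_smul_left]
      positivity
  have hlim := (hW.tendsto 0).mono_left (nhdsWithin_le_nhds (s := Ioi 0))
  have := ge_of_tendsto hlim (eventually_nhdsWithin_of_forall hpos)
  simpa [W] using this

end Energy

lemma neg_of_neg_posDef {A : Matrix (Fin 2) (Fin 2) ℝ} (hA : (-A).PosDef) {w : Fin 2 → ℝ}
    (hw : 0 ≤ w ⬝ᵥ (A *ᵥ w)) : w = 0 := by
  by_contra hne
  have h := hA.dotProduct_mulVec_pos hne
  rw [Matrix.neg_mulVec, dotProduct_neg, star_trivial] at h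
  linarith

namespace ElementaryNeighborhood

variable (N : ElementaryNeighborhood)

lemma isOpen_domain : IsOpen N.domain := isOpen_region N.V_open continuousOn_const

/-- The dominant energy condition gives `R_{A u} = 0` on a horizon with `∂_u g_{AB} = 0`. There
`T_{uu} = 0`, so `Tᵃ_u` is causal and orthogonal to the null vector `∂_u`, hence proportional
to it. -/
theorem pd_f_eq_pd_h (N : ElementaryNeighborhood) {T : Coord → Matrix (Fin 4) (Fin 4) ℝ}
    (hEinstein : ∀ p ∈ N.domain, einstein N.metric p = (8 * Real.pi) • T p)
    (hDEC : DominantEnergy N.metric T N.τ N.domain)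
    (hq : ∀ p ∈ N.horizon, ∀ A B : Fin 2, pd 0 (fun y => N.form.q y A B) p = 0)
    {p : Coord} (hp : p ∈ N.horizon) {b : Fin 4} (hb : b ≠ 1) :
    pd b N.form.f p = pd 0 (N.form.lin b) p := by
  obtain ⟨hpD, hp1⟩ := hp
  have hF : N.form.IsAdmissible N.P N.domain := N.admissible
  have hq' := hF.neg_def p hpD
  have hricci := fun {b : Fin 4} (hb : b ≠ 1) => ricci_horizon hF N.isOpen_domain hpD hp1
    (fun y hy hy1 => hq y ⟨hy, hy1⟩) hb
  have hT : ∀ b ≠ 1, 8 * Real.pi * T p b 0 = ricci N.metric p b 0 := by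
    intro b hb
    have h1 := congrFun (congrFun (hEinstein p hpD) b) 0
    have h2 : N.metric p b 0 = 0 := by
      rw [ElementaryNeighborhood.metric, N.form.metric_zero_right hb, hp1, zero_mul]
    simp [einstein, h2] at h1
    exact h1.symm
  have hpi := Real.pi_pos
  have hT00 : T p 0 0 = 0 := by
    have h1 := hT 0 (by simp)
    have h2 := hricci (b := 0) (by simp)
    have h3 : N.form.lin 0 = N.form.f := rfl
    rw [ElementaryNeighborhood.metric] at h1
    rw [h2, h3, sub_self, mul_zero] at h1
    rcases mul_eq_zero.1 h1 with h | h
    · exact absurd h (by positivity)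
    · exact h
  have hk : scalarProd N.metric p (basisVec 0) (basisVec 0) = 0 := by
    simp [scalarProd, basisVec, ElementaryNeighborhood.metric, NullForm.metric, hp1]
  have hs : ∀ i j, N.metric p i j = N.metric p j i := metric_symm hq'
  have hcausal := hDEC.nonneg_of_null hpD hs (N.τ_timelike p hpD) hk (N.k_future p hpD hp1)
  have hTk : ∀ i, (T p *ᵥ basisVec 0) i = T p i 0 := by
    intro i; simp [basisVec]
  have hW : ∀ i, ((N.metric p)⁻¹ *ᵥ (T p *ᵥ basisVec 0)) i =
      ∑ j, N.form.inv p i j * T p j 0 := by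
    intro i
    rw [ElementaryNeighborhood.metric, inv_metric hq']
    simp only [Matrix.mulVec, dotProduct] at hTk ⊢
    simp only [hTk]
  set W := (N.metric p)⁻¹ *ᵥ (T p *ᵥ basisVec 0) with hWdef
  have hW1 : W 1 = 0 := by
    rw [hW, Fin.sum_univ_four, hT00]
    simp [NullForm.inv, hp1]
  have hprod : scalarProd N.metric p W W = ![W 2, W 3] ⬝ᵥ (N.form.q p *ᵥ ![W 2, W 3]) := by
    rw [scalarProd_eq_sum]
    simp [Fin.sum_univ_four, ElementaryNeighborhood.metric, NullForm.metric, hp1, hW1, dotProduct,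
      Matrix.mulVec, Fin.sum_univ_two]
    ring
  have hz := neg_of_neg_posDef hq' (hprod ▸ hcausal)
  have hu : IsUnit (N.metric p).det := isUnit_det_metric hq'
  have hgW : N.metric p *ᵥ W = T p *ᵥ basisVec 0 := by
    rw [hWdef, Matrix.mulVec_mulVec, Matrix.mul_nonsing_inv _ hu,
      Matrix.one_mulVec]
  have hW2 : W 2 = 0 := congrFun hz 0
  have hW3 : W 3 = 0 := congrFun hz 1
  have hTb : T p b 0 = 0 := by
    rw [← hTk, ← hgW]
    fin_cases b <;> simp [Matrix.mulVec, dotProduct, Fin.sum_univ_four, hW1, hW2, hW3,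
      ElementaryNeighborhood.metric, NullForm.metric, hp1] at hb ⊢
  have h1 := hT b hb
  have h2 := hricci hb
  rw [ElementaryNeighborhood.metric] at h1
  rw [hTb, mul_zero, h2] at h1
  linarith

end ElementaryNeighborhood

/-! ### A parameter of constant surface gravity on the generators -/

section Cylinder

/-- The points with transverse coordinates in `V`, with no restriction on `u` and `r`. -/
def cylinder (V : Set (Fin 2 → ℝ)) : Set Coord := {p | transverse p ∈ V}

variable {V : Set (Fin 2 → ℝ)} {G g : Coord → ℝ} {p : Coord}

lemma cylinder_open (hV : IsOpen V) : IsOpen (cylinder V) := isOpen_cylinder hV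

lemma add_mem_cylinder {t : ℝ} (hp : p ∈ cylinder V) : p + t • basisVec 0 ∈ cylinder V := by
  rwa [cylinder, mem_ofPred_eq, transverse_add_smul_zero]

lemma toHorizon_mem_cylinder (hp : p ∈ cylinder V) : toHorizon p ∈ cylinder V := by
  rwa [cylinder, mem_ofPred_eq, transverse_toHorizon]

lemma toHorizon_add (p : Coord) (t : ℝ) :
    toHorizon (p + t • basisVec 0) = toHorizon p + t • basisVec 0 := by
  ext i
  by_cases hi : i = 1 <;> simp [toHorizon_apply, basisVec_apply, hi]

lemma isPreconnected_cylinder (hV : IsPreconnected V) : IsPreconnected (cylinder V) := by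
  have h : cylinder V = (fun w : (ℝ × ℝ) × (Fin 2 → ℝ) => (![w.1.1, w.1.2, w.2 0, w.2 1] : Coord)) ''
      (univ ×ˢ V) := by
    ext p
    constructor
    · intro hp
      refine ⟨((p 0, p 1), transverse p), ⟨mem_univ _, hp⟩, ?_⟩
      ext i; fin_cases i <;> simp [transverse]
    · rintro ⟨⟨a, x⟩, ⟨-, hx⟩, rfl⟩
      have : transverse ![a.1, a.2, x 0, x 1] = x := by
        ext i; fin_cases i <;> simp [transverse]
      rwa [cylinder, mem_ofPred_eq, this]
  rw [h]
  refine (isPreconnected_univ.prod hV).image _ (Continuous.continuousOn ?_)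
  refine continuous_pi fun i => ?_
  fin_cases i <;> simp <;> fun_prop

lemma hasDerivAt_shift (hV : IsOpen V) (hG : ContDiffOn ℝ ∞ G (cylinder V)) (hp : p ∈ cylinder V)
    (t : ℝ) : HasDerivAt (fun t : ℝ => G (p + t • basisVec 0)) (pd 0 G (p + t • basisVec 0)) t := by
  have h1 := hasDerivAt_line (i := 0) (differentiableAt_of_contDiffOn (cylinder_open hV) hG
    (by simp) (add_mem_cylinder (t := t) hp))
  have h2 := HasDerivAt.scomp_of_eq (g₁ := fun s : ℝ => G (p + t • basisVec 0 + s • basisVec 0))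
      t h1 ((hasDerivAt_id t).sub_const t) (by simp)
  rw [one_smul] at h2
  refine h2.congr_of_eventuallyEq (Eventually.of_forall fun s => ?_)
  simp only [Function.comp_apply, id]
  rw [add_assoc, ← add_smul, add_sub_cancel]

lemma shift_eq_of_pd_zero (hV : IsOpen V) (hG : ContDiffOn ℝ ∞ G (cylinder V))
    (h : ∀ y ∈ cylinder V, pd 0 G y = 0) (hp : p ∈ cylinder V) (t : ℝ) :
    G (p + t • basisVec 0) = G p := by
  have h1 : ∀ t, HasDerivAt (fun t : ℝ => G (p + t • basisVec 0)) 0 t := fun t => by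
    have := hasDerivAt_shift hV hG hp t
    rwa [h _ (add_mem_cylinder hp)] at this
  simpa using is_const_of_deriv_eq_zero (fun t => (h1 t).differentiableAt) (fun t => (h1 t).deriv)
    t 0

lemma pd_shift (i : Fin 4) (c : Coord) : pd i (fun y => G (y + c)) p = pd i G (p + c) := by
  simp [pd, fderiv_comp_add_right]

/-- The functions on the cylinder that do not depend on `r`. -/
def IndepR (V : Set (Fin 2 → ℝ)) (G : Coord → ℝ) : Prop :=
  ∀ p ∈ cylinder V, G (toHorizon p) = G p

lemma IndepR.pd_one (h : IndepR V G) (hp : p ∈ cylinder V) : pd 1 G p = 0 := by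
  refine pd_eq_zero_of_line (Eventually.of_forall fun t => ?_)
  have h1 : toHorizon (p + t • basisVec 1) = toHorizon p := by
    ext i; by_cases hi : i = 1 <;> simp [toHorizon_apply, basisVec_apply, hi]
  have h2 : p + t • basisVec 1 ∈ cylinder V := by
    rw [cylinder, mem_ofPred_eq, ← transverse_toHorizon, h1, transverse_toHorizon]
    exact hp
  rw [← h _ h2, h1, h p hp]

/-- The primitive `∫₀ᵘ g` in the coordinate `u`. -/
noncomputable def uPrim (g : Coord → ℝ) (p : Coord) : ℝ :=
  ∫ s in (0 : ℝ)..p 0, g (p + (s - p 0) • basisVec 0)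

lemma contDiffOn_uPrim (hV : IsOpen V) (hg : ContDiffOn ℝ ∞ g (cylinder V)) :
    ContDiffOn ℝ ∞ (uPrim g) (cylinder V) := by
  let L : Coord × ℝ → Coord := fun w => w.1 + (w.2 * w.1 0 - w.1 0) • basisVec 0
  have hL : ContDiff ℝ ∞ L := by
    have h0 : ContDiff ℝ ∞ fun w : Coord × ℝ => w.1 0 := contDiff_apply ℝ ℝ 0 |>.comp contDiff_fst
    exact contDiff_fst.add (((contDiff_snd.mul h0).sub h0).smul contDiff_const)
  have hmem : ∀ p ∈ cylinder V, ∀ t, L (p, t) ∈ cylinder V := fun p hp t => add_mem_cylinder hp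
  have h1 : ContDiffOn ℝ ∞ (fun w => g (L w)) (L ⁻¹' cylinder V) :=
    hg.comp hL.contDiffOn fun w hw => hw
  have h2 := contDiffOn_integral_param ((cylinder_open hV).preimage hL.continuous) h1
    (A := cylinder V) fun p hp t _ => hmem p hp t
  have h0 : ContDiffOn ℝ ∞ (fun p : Coord => p 0) (cylinder V) := by fun_prop
  refine (h0.mul h2).congr fun p _ => ?_
  have h3 := intervalIntegral.mul_integral_comp_mul_right (a := 0) (b := 1)
    (f := fun s : ℝ => g (p + (s - p 0) • basisVec 0)) (p 0)
  rw [zero_mul, one_mul] at h3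
  exact h3.symm

lemma continuous_on_line (hg : ContDiffOn ℝ ∞ g (cylinder V)) (hp : p ∈ cylinder V) :
    Continuous fun s : ℝ => g (p + (s - p 0) • basisVec 0) :=
  hg.continuousOn.comp_continuous (by fun_prop) fun s => add_mem_cylinder hp

lemma uPrim_shift (t : ℝ) :
    uPrim g (p + t • basisVec 0) = ∫ s in (0 : ℝ)..p 0 + t, g (p + (s - p 0) • basisVec 0) := by
  have h0 : (p + t • basisVec 0) 0 = p 0 + t := by simp [basisVec_apply]
  rw [uPrim, h0]
  refine intervalIntegral.integral_congr fun s _ => ?_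
  rw [add_assoc, ← add_smul]
  congr 3
  ring

lemma pd_uPrim (hV : IsOpen V) (hg : ContDiffOn ℝ ∞ g (cylinder V)) (hp : p ∈ cylinder V) :
    pd 0 (uPrim g) p = g p := by
  have hd := hasDerivAt_line (i := 0) (differentiableAt_of_contDiffOn (cylinder_open hV)
    (contDiffOn_uPrim hV hg) (by simp) hp)
  have hc := continuous_on_line hg hp
  have h1 : HasDerivAt (fun t : ℝ => ∫ s in (0 : ℝ)..p 0 + t, g (p + (s - p 0) • basisVec 0))
      (g p) 0 := by
    have h2 := intervalIntegral.integral_hasDerivAt_right (hc.intervalIntegrable 0 (p 0))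
      (hc.stronglyMeasurableAtFilter _ _) hc.continuousAt
    have h3 := HasDerivAt.scomp_of_eq (0 : ℝ) h2 ((hasDerivAt_id (0 : ℝ)).const_add (p 0)) (by simp)
    simp only [one_smul, sub_self, zero_smul, add_zero] at h3
    exact h3
  simp only [uPrim_shift] at hd
  exact hd.unique h1

lemma uPrim_indepR (h : IndepR V g) : IndepR V (uPrim g) := by
  intro p hp
  rw [uPrim, uPrim, toHorizon_of_ne p (by simp)]
  refine intervalIntegral.integral_congr fun s _ => ?_
  rw [← toHorizon_add, h _ (add_mem_cylinder hp)]

lemma uPrim_shift_pos (hg : ContDiffOn ℝ ∞ g (cylinder V)) (hpos : ∀ y ∈ cylinder V, 0 < g y)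
    (hp : p ∈ cylinder V) {t : ℝ} (ht : 0 < t) : 0 < uPrim g (p + t • basisVec 0) - uPrim g p := by
  have hc := continuous_on_line hg hp
  rw [uPrim_shift, uPrim, intervalIntegral.integral_interval_sub_left (hc.intervalIntegrable _ _)
    (hc.intervalIntegrable _ _)]
  exact intervalIntegral.intervalIntegral_pos_of_pos_on (hc.intervalIntegrable _ _)
    (fun s _ => hpos _ (add_mem_cylinder hp)) (by linarith)

end Cylinder

section Rescaling

variable {V : Set (Fin 2 → ℝ)} {P : ℝ}

/-- If `∂_A f = ∂_u h_A` with periodic `f` and `h_A`, then the integral of `f` over a period does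
not depend on the generator. -/
lemma exists_period_integral (hV : IsOpen V) (hVc : IsConnected V) {f : Coord → ℝ}
    {h : Fin 4 → Coord → ℝ} (hf : ContDiffOn ℝ ∞ f (cylinder V)) (hfr : IndepR V f)
    (hh : ∀ b, ContDiffOn ℝ ∞ (h b) (cylinder V))
    (hhP : ∀ b, ∀ p ∈ cylinder V, h b (p + P • basisVec 0) = h b p)
    (hfh : ∀ p ∈ cylinder V, ∀ b ≠ 1, pd b f p = pd 0 (h b) p) :
    ∃ m, ∀ p ∈ cylinder V, uPrim f (p + P • basisVec 0) - uPrim f p = m := by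
  have hO := cylinder_open hV
  have hJ := contDiffOn_uPrim hV hf
  have hsh : ContDiffOn ℝ ∞ (fun p => uPrim f (p + P • basisVec 0)) (cylinder V) :=
    hJ.comp (by fun_prop) fun p hp => add_mem_cylinder hp
  have hD := hsh.sub hJ
  have hd := fun {G : Coord → ℝ} {p} (hG : ContDiffOn ℝ ∞ G (cylinder V)) (hp : p ∈ cylinder V) =>
    differentiableAt_of_contDiffOn hO hG (by simp) hp
  have hpd : ∀ p ∈ cylinder V, ∀ b,
      pd b (fun p => uPrim f (p + P • basisVec 0) - uPrim f p) p = 0 := by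
    intro p hp b
    rw [pd_sub (hd hsh hp) (hd hJ hp), pd_shift]
    by_cases hb : b = 1
    · rw [hb, (uPrim_indepR hfr).pd_one hp, (uPrim_indepR hfr).pd_one (add_mem_cylinder hp),
        sub_zero]
    -- `∂_b ∫ f - h_b` is constant along the generators.
    have hc : ContDiffOn ℝ ∞ (fun y => pd b (uPrim f) y - h b y) (cylinder V) :=
      (contDiffOn_pd hO hJ b).sub (hh b)
    have h1 := shift_eq_of_pd_zero hV hc (fun y hy => by
      rw [pd_sub (hd (contDiffOn_pd hO hJ b) hy) (hd (hh b) hy), pd_comm hO hJ hy,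
        pd_congr_of_eqOn hO hy (fun z hz => pd_uPrim hV hf hz), hfh y hy b hb, sub_self]) hp P
    simp only [hhP b p hp] at h1
    linarith
  obtain ⟨x, hx⟩ := hVc.nonempty
  let p₀ : Coord := ![0, 0, x 0, x 1]
  have hp₀ : p₀ ∈ cylinder V := by
    have : transverse p₀ = x := by ext i; fin_cases i <;> simp [transverse, p₀]
    rwa [cylinder, mem_ofPred_eq, this]
  refine ⟨uPrim f (p₀ + P • basisVec 0) - uPrim f p₀, fun p hp => ?_⟩
  refine hO.is_const_of_fderiv_eq_zero (𝕜 := ℝ)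
    (f := fun p => uPrim f (p + P • basisVec 0) - uPrim f p)
    (isPreconnected_cylinder hVc.isPreconnected)
    (hD.differentiableOn (by simp)) (fun y hy => ?_) hp hp₀
  refine ContinuousLinearMap.coe_inj.1 (LinearMap.pi_ext' fun i => LinearMap.ext_ring ?_)
  simpa [pd, basisVec] using hpd y hy i

/-- The new coordinate `u'` on the horizon: the generators carry a parameter of period `P`, in
which the surface gravity is the mean `κ` of the given one. If `E` is the exponential of the
integral of the surface gravity, then this parameter is proportional to the logarithm of the
integral of `E` over a period if `κ ≠ 0`, and to the integral of `E` if `κ = 0`. -/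
theorem exists_rescaling (hV : IsOpen V) (hP : 0 < P) {f : Coord → ℝ}
    (hf : ContDiffOn ℝ ∞ f (cylinder V)) (hfr : IndepR V f)
    {m : ℝ} (hm : ∀ p ∈ cylinder V, uPrim f (p + P • basisVec 0) - uPrim f p = m) :
    ∃ (κ : ℝ) (U : Coord → ℝ), ContDiffOn ℝ ∞ U (cylinder V) ∧ IndepR V U ∧
      (∀ p ∈ cylinder V, U (p + P • basisVec 0) = U p + P) ∧
      (∀ p ∈ cylinder V, 0 < pd 0 U p) ∧
      ∀ p ∈ cylinder V, f p * pd 0 U p + 2 * pd 0 (pd 0 U) p = -2 * κ * pd 0 U p ^ 2 := by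
  have hO := cylinder_open hV
  have hd := fun {G : Coord → ℝ} {p} (hG : ContDiffOn ℝ ∞ G (cylinder V)) (hp : p ∈ cylinder V) =>
    differentiableAt_of_contDiffOn hO hG (by simp) hp
  obtain ⟨κ, hκ⟩ : ∃ κ, m = -2 * κ * P := ⟨-m / (2 * P), by field_simp⟩
  -- Let `E = exp (-J / 2)` for a primitive `J` of `f`, and let `I` be the integral of `E` over the
  -- period ahead, which has derivative `E (p + P) - E p = (exp (κ * P) - 1) * E p`. Then
  -- `pd 0 U = c * E / I` solves the equation if `κ * c = exp (κ * P) - 1`.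
  set J := uPrim f with hJdef
  have hJ : ContDiffOn ℝ ∞ J (cylinder V) := contDiffOn_uPrim hV hf
  have hJr : IndepR V J := uPrim_indepR hfr
  set E : Coord → ℝ := fun p => Real.exp (-(1 / 2) * J p) with hE
  have hEs : ContDiffOn ℝ ∞ E (cylinder V) := (contDiffOn_const.mul hJ).exp
  have hEr : IndepR V E := fun p hp => by simp only [hE, hJr p hp]
  have hEpos : ∀ p, 0 < E p := fun p => Real.exp_pos _
  have hEP : ∀ p ∈ cylinder V, E (p + P • basisVec 0) = Real.exp (κ * P) * E p := by
    intro p hp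
    simp only [hE, ← Real.exp_add]
    rw [← sub_add_cancel (J (p + P • basisVec 0)) (J p), hm p hp, hκ]
    congr 1
    ring
  have hE' : ∀ p ∈ cylinder V, pd 0 E p = -(1 / 2) * f p * E p := by
    intro p hp
    have h1 := hasDerivAt_line (i := 0) (hd hEs hp)
    have h2 := ((hasDerivAt_line (i := 0) (hd hJ hp)).const_mul (-(1 / 2))).exp
    rw [h1.unique h2, pd_uPrim hV hf hp]
    simp only [zero_smul, add_zero, hE]
    ring
  set Q := uPrim E with hQdef
  have hQ : ContDiffOn ℝ ∞ Q (cylinder V) := contDiffOn_uPrim hV hEs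
  have hQr : IndepR V Q := uPrim_indepR hEr
  set I : Coord → ℝ := fun p => Q (p + P • basisVec 0) - Q p with hI
  have hQs : ContDiffOn ℝ ∞ (fun p => Q (p + P • basisVec 0)) (cylinder V) :=
    hQ.comp (by fun_prop) fun p hp => add_mem_cylinder hp
  have hIs : ContDiffOn ℝ ∞ I (cylinder V) := hQs.sub hQ
  have hIr : IndepR V I := fun p hp => by
    simp only [hI]
    rw [← toHorizon_add, hQr _ (add_mem_cylinder hp), hQr p hp]
  have hIpos : ∀ p ∈ cylinder V, 0 < I p := fun p hp =>
    uPrim_shift_pos hEs (fun y _ => hEpos y) hp hP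
  have hI' : ∀ p ∈ cylinder V, pd 0 I p = (Real.exp (κ * P) - 1) * E p := by
    intro p hp
    rw [hI, pd_sub (hd hQs hp) (hd hQ hp), pd_shift, pd_uPrim hV hEs hp,
      pd_uPrim hV hEs (add_mem_cylinder hp), hEP p hp]
    ring
  have hIP : ∀ p ∈ cylinder V, I (p + P • basisVec 0) = Real.exp (κ * P) * I p := by
    intro p hp
    have hs := hQs.sub (contDiffOn_const (c := Real.exp (κ * P)) |>.mul hQ)
    have h1 := shift_eq_of_pd_zero hV hs (fun y hy => by
      rw [pd_sub (hd hQs hy) ((hd hQ hy).const_mul _), pd_shift, pd_const_mul _ (hd hQ hy),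
        pd_uPrim hV hEs hy, pd_uPrim hV hEs (add_mem_cylinder hy), hEP y hy, sub_self]) hp P
    simp only [hI] at h1 ⊢
    linarith
  obtain ⟨c, U, hc, hcκ, hU, hUr, hUP, hU'⟩ : ∃ (c : ℝ) (U : Coord → ℝ), 0 < c ∧
      κ * c = Real.exp (κ * P) - 1 ∧ ContDiffOn ℝ ∞ U (cylinder V) ∧ IndepR V U ∧
      (∀ p ∈ cylinder V, U (p + P • basisVec 0) = U p + P) ∧
      ∀ p ∈ cylinder V, pd 0 U p = c * E p / I p := by
    by_cases hκ0 : κ = 0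
    · refine ⟨P, fun p => P * Q p / I p, hP, by simp [hκ0],
        (contDiffOn_const.mul hQ).div hIs fun p hp => (hIpos p hp).ne',
        fun p hp => by simp only [hQr p hp, hIr p hp], fun p hp => ?_, fun p hp => ?_⟩
      · have h1 := hIP p hp
        rw [hκ0, zero_mul, Real.exp_zero, one_mul] at h1
        have h2 := (hIpos p hp).ne'
        have h3 : Q (p + P • basisVec 0) = I p + Q p := by simp [hI]
        simp only [h1, h3]
        field_simp
        ring
      · have h1 := hasDerivAt_line (i := 0) (hd ((contDiffOn_const (c := P)).mul hQ |>.div hIs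
          fun p hp => (hIpos p hp).ne') hp)
        have h2 := ((hasDerivAt_line (i := 0) (hd hQ hp)).const_mul P).div
          (hasDerivAt_line (i := 0) (hd hIs hp)) (by simpa using (hIpos p hp).ne')
        have h3 := h1.unique h2
        rw [hI' p hp, hκ0, pd_uPrim hV hEs hp] at h3
        have h4 := (hIpos p hp).ne'
        simp only [zero_smul, add_zero, zero_mul, Real.exp_zero, sub_self, mul_zero, sub_zero] at h3
        refine h3.trans ?_
        field_simp
    · have hc : 0 < (Real.exp (κ * P) - 1) / κ := by
        rcases lt_or_gt_of_ne hκ0 with h | h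
        · refine div_pos_of_neg_of_neg ?_ h
          have : Real.exp (κ * P) < 1 := by
            rw [Real.exp_lt_one_iff]; exact mul_neg_of_neg_of_pos h hP
          linarith
        · refine div_pos ?_ h
          have : 1 < Real.exp (κ * P) := Real.one_lt_exp_iff.2 (by positivity)
          linarith
      have hs : ContDiffOn ℝ ∞ (fun p => κ⁻¹ * Real.log (I p)) (cylinder V) :=
        contDiffOn_const.mul (hIs.log fun p hp => (hIpos p hp).ne')
      refine ⟨(Real.exp (κ * P) - 1) / κ, fun p => κ⁻¹ * Real.log (I p), hc, by field_simp, hs,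
        fun p hp => by simp only [hIr p hp], fun p hp => ?_, fun p hp => ?_⟩
      · simp only [hIP p hp]
        rw [Real.log_mul (Real.exp_pos _).ne' (hIpos p hp).ne', Real.log_exp]
        field_simp
        ring
      · have h1 := hasDerivAt_line (i := 0) (hd hs hp)
        have h2 := ((hasDerivAt_line (i := 0) (hd hIs hp)).log
          (by simpa using (hIpos p hp).ne')).const_mul κ⁻¹
        rw [h1.unique h2, hI' p hp]
        simp only [zero_smul, add_zero]
        field_simp
  refine ⟨κ, U, hU, hUr, hUP, fun p hp => ?_, fun p hp => ?_⟩
  · rw [hU' p hp]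
    exact div_pos (mul_pos hc (hEpos p)) (hIpos p hp)
  · have hw := pd_congr_of_eqOn (i := 0) hO hp hU'
    have h1 := hasDerivAt_line (i := 0) (hd (((contDiffOn_const (c := c)).mul hEs).div hIs
      fun p hp => (hIpos p hp).ne') hp)
    have h2 := ((hasDerivAt_line (i := 0) (hd hEs hp)).const_mul c).div
      (hasDerivAt_line (i := 0) (hd hIs hp)) (by simpa using (hIpos p hp).ne')
    have h3 : pd 0 (fun y => c * E y / I y) p = _ := h1.unique h2
    simp only [zero_smul, add_zero] at h3
    rw [hI' p hp, hE' p hp, ← hcκ] at h3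
    have h5 := (hIpos p hp).ne'
    rw [hw, h3, hU' p hp]
    field_simp
    ring

end Rescaling

/-! ### The parameter as a coordinate, and the method of characteristics -/

lemma exists_equiv_of_injective (A : Coord →L[ℝ] Coord) (h : ∀ v, A v = 0 → v = 0) :
    ∃ B : Coord ≃L[ℝ] Coord, (B : Coord →L[ℝ] Coord) = A := by
  have hinj : Function.Injective (A : Coord →ₗ[ℝ] Coord) :=
    (injective_iff_map_eq_zero _).2 h
  refine ⟨(LinearEquiv.ofInjectiveEndo _ hinj).toContinuousLinearEquiv, ?_⟩
  ext v
  rfl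

lemma coord_eq_sum (v : Coord) : v = ∑ i, v i • basisVec i := by
  ext j
  simp [basisVec_apply]

lemma fderiv_apply_eq_sum (G : Coord → ℝ) (p v : Coord) :
    fderiv ℝ G p v = ∑ i, v i * pd i G p := by
  conv_lhs => rw [coord_eq_sum v]
  simp [pd, map_sum]

lemma pd_comp {G : Coord → ℝ} {Y : Coord → Coord} {p : Coord} (b : Fin 4)
    (hG : DifferentiableAt ℝ G (Y p)) (hY : DifferentiableAt ℝ Y p) :
    pd b (fun y => G (Y y)) p = ∑ i, pd i G (Y p) * pd b (fun y => Y y i) p := by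
  have h1 : fderiv ℝ (fun y => G (Y y)) p = (fderiv ℝ G (Y p)).comp (fderiv ℝ Y p) :=
    fderiv_comp p hG hY
  have h2 : ∀ i, pd b (fun y => Y y i) p = fderiv ℝ Y p (basisVec b) i := by
    intro i
    rw [pd, fderiv_apply hY]
    rfl
  rw [pd, h1, ContinuousLinearMap.comp_apply, fderiv_apply_eq_sum]
  exact Finset.sum_congr rfl fun i _ => by rw [h2, mul_comm]

section GeneratorCoordinate

variable {V : Set (Fin 2 → ℝ)} {P σ : ℝ} {U : Coord → ℝ}

lemma shift_int (hUP : ∀ p ∈ cylinder V, U (p + P • basisVec 0) = U p + σ * P) {p : Coord}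
    (hp : p ∈ cylinder V) (n : ℕ) : U (p + (n * P) • basisVec 0) = U p + n * (σ * P) ∧
      U (p + (-(n * P)) • basisVec 0) = U p - n * (σ * P) := by
  induction n with
  | zero => simp
  | succ n ih =>
    constructor
    · have h1 := hUP _ (add_mem_cylinder (t := n * P) hp)
      rw [add_assoc, ← add_smul, ih.1] at h1
      push_cast
      rw [show ((n : ℝ) + 1) * P = n * P + P by ring, h1]
      ring
    · have h1 := hUP _ (add_mem_cylinder (t := -((n + 1 : ℝ) * P)) hp)
      rw [add_assoc, ← add_smul, show -((n + 1 : ℝ) * P) + P = -(n * P) by ring, ih.2] at h1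
      push_cast
      linarith

/-- The replacement of the coordinate `u` by `U`. -/
noncomputable def replaceU (U : Coord → ℝ) (p : Coord) : Coord := p + (U p - p 0) • basisVec 0

lemma replaceU_zero (p : Coord) : replaceU U p 0 = U p := by simp [replaceU, basisVec_apply]

lemma replaceU_of_ne (p : Coord) {i : Fin 4} (hi : i ≠ 0) : replaceU U p i = p i := by
  simp [replaceU, basisVec_apply, hi]

lemma hasFDerivAt_replaceU {p : Coord} (hU : DifferentiableAt ℝ U p) :
    HasFDerivAt (replaceU U) (ContinuousLinearMap.id ℝ Coord +
      (fderiv ℝ U p - ContinuousLinearMap.proj (R := ℝ) (φ := fun _ : Fin 4 => ℝ) 0).smulRight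
        (basisVec 0)) p := by
  have h0 : HasFDerivAt (fun y : Coord => y 0)
    (ContinuousLinearMap.proj (R := ℝ) (φ := fun _ : Fin 4 => ℝ) 0) p := hasFDerivAt_apply 0 p
  exact (hasFDerivAt_id p).add ((hU.hasFDerivAt.sub h0).smul_const (basisVec 0))

/-- A function `U` that is strictly monotone along the generators and quasi-periodic is a
coordinate on the cylinder. -/
theorem exists_generator_coordinate (hV : IsOpen V) (hP : 0 < P) (hσ : σ * σ = 1)
    (hU : ContDiffOn ℝ ∞ U (cylinder V))
    (hUP : ∀ p ∈ cylinder V, U (p + P • basisVec 0) = U p + σ * P)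
    (hU' : ∀ p ∈ cylinder V, 0 < σ * pd 0 U p) :
    ∃ e : OpenPartialHomeomorph Coord Coord, e.source = cylinder V ∧ e.target = cylinder V ∧
      (e : Coord → Coord) = replaceU U ∧ ContDiffOn ℝ ∞ e.symm (cylinder V) := by
  have hO := cylinder_open hV
  have hmono : ∀ p ∈ cylinder V, StrictMono fun t : ℝ => σ * U (p + t • basisVec 0) := by
    intro p hp
    refine strictMono_of_deriv_pos fun t => ?_
    rw [((hasDerivAt_shift hV hU hp t).const_mul σ).deriv]
    exact hU' _ (add_mem_cylinder hp)
  have hsm : ContDiffOn ℝ ∞ (replaceU U) (cylinder V) :=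
    contDiff_id.contDiffOn.add ((hU.sub (by fun_prop)).smul contDiffOn_const)
  have hinj : InjOn (replaceU U) (cylinder V) := by
    intro p hp q hq hpq
    have h0 : U p = U q := by
      rw [← replaceU_zero (U := U) p, hpq, replaceU_zero]
    have hi : ∀ i, i ≠ 0 → p i = q i := fun i hi => by
      rw [← replaceU_of_ne (U := U) p hi, hpq, replaceU_of_ne q hi]
    have hq' : q = p + (q 0 - p 0) • basisVec 0 := by
      ext i
      by_cases h : i = 0
      · simp [h, basisVec_apply]
      · simp [h, basisVec_apply, hi i h]
    have h1 : (fun t : ℝ => σ * U (p + t • basisVec 0)) (q 0 - p 0) =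
        (fun t : ℝ => σ * U (p + t • basisVec 0)) 0 := by
      simp only
      rw [← hq', zero_smul, add_zero, h0]
    rw [hq', (hmono p hp).injective h1, zero_smul, add_zero]
  have hder : ∀ p ∈ cylinder V, ∃ A : Coord ≃L[ℝ] Coord,
      (A : Coord →L[ℝ] Coord) = fderiv ℝ (replaceU U) p := by
    intro p hp
    have hd := differentiableAt_of_contDiffOn hO hU (by simp) hp
    refine exists_equiv_of_injective _ fun v hv => ?_
    rw [(hasFDerivAt_replaceU hd).fderiv] at hv
    have hc : ∀ i, v i + (fderiv ℝ U p v - v 0) * basisVec 0 i = 0 := fun i => congrFun hv i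
    have hi : ∀ i, i ≠ 0 → v i = 0 := fun i hi => by simpa [basisVec_apply, hi] using hc i
    have h0 := hc 0
    rw [fderiv_apply_eq_sum, Fin.sum_univ_four, hi 1 (by simp), hi 2 (by simp), hi 3 (by simp),
      basisVec_apply] at h0
    simp at h0
    have hne : pd 0 U p ≠ 0 := fun h => by have := hU' p hp; simp [h] at this
    ext i
    by_cases h : i = 0
    · rw [h]; exact h0.resolve_right hne
    · exact hi i h
  obtain ⟨e, hes, hef, hsymm⟩ := exists_smooth_inverse_of_injOn hO hsm hinj hder
  have het : e.target = cylinder V := by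
    have hmem : ∀ p, replaceU U p ∈ cylinder V ↔ p ∈ cylinder V := by
      intro p
      simp only [cylinder, mem_ofPred_eq, replaceU, transverse_add_smul_zero]
    rw [← e.image_source_eq_target, hes, hef]
    ext q
    constructor
    · rintro ⟨p, hp, rfl⟩
      exact (hmem p).2 hp
    · intro hq
      have hcont : Continuous fun t : ℝ => σ * U (q + t • basisVec 0) :=
        continuous_iff_continuousAt.2 fun t =>
          ((hasDerivAt_shift hV hU hq t).const_mul σ).continuousAt
      have hsurj : σ * q 0 ∈ range fun t : ℝ => σ * U (q + t • basisVec 0) := by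
        obtain ⟨n, hn⟩ := exists_nat_ge (|σ * q 0 - σ * U q| / P)
        have hn' : |σ * q 0 - σ * U q| ≤ n * P := (div_le_iff₀ hP).1 hn
        have hs := shift_int hUP hq n
        have hk : σ * (n * (σ * P)) = n * P := by
          rw [show σ * (n * (σ * P)) = σ * σ * (n * P) by ring, hσ, one_mul]
        refine mem_range_of_exists_le_of_exists_ge hcont ⟨-(n * P), ?_⟩ ⟨n * P, ?_⟩
        · rw [hs.2]
          rw [mul_sub, hk]
          linarith [neg_abs_le (σ * q 0 - σ * U q)]
        · rw [hs.1]
          rw [mul_add, hk]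
          linarith [le_abs_self (σ * q 0 - σ * U q)]
      obtain ⟨t, ht⟩ := hsurj
      have hσ0 : σ ≠ 0 := fun h => by simp [h] at hσ
      have ht' : U (q + t • basisVec 0) = q 0 := mul_left_cancel₀ hσ0 ht
      refine ⟨q + t • basisVec 0, add_mem_cylinder hq, ?_⟩
      ext i
      by_cases hi : i = 0
      · rw [hi, replaceU_zero, ht']
      · rw [replaceU_of_ne _ hi]; simp [basisVec_apply, hi]
  exact ⟨e, hes, het, hef, het ▸ hsymm⟩

end GeneratorCoordinate

section Characteristics

variable {V : Set (Fin 2 → ℝ)} {ε : (Fin 2 → ℝ) → ℝ}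

lemma toHorizon_add_smul_one (p : Coord) : toHorizon p + p 1 • basisVec 1 = p := by
  ext i
  by_cases hi : i = 1 <;> simp [toHorizon_apply, basisVec_apply, hi]

lemma toHorizon_line_mem {p : Coord} (hp : p ∈ region V ε) {t : ℝ} (ht : |t| < ε (transverse p)) :
    toHorizon p + t • basisVec 1 ∈ region V ε := by
  have h1 : transverse (toHorizon p + t • basisVec 1) = transverse p := by
    simp [transverse, toHorizon_apply, basisVec_apply]
  refine ⟨by rw [h1]; exact hp.1, ?_⟩
  rw [h1]
  simpa [toHorizon_apply, basisVec_apply] using ht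

lemma toHorizon_mem_region {p : Coord} (hp : p ∈ region V ε) : toHorizon p ∈ region V ε := by
  have := toHorizon_line_mem hp (t := 0) (by simpa using (abs_nonneg _).trans_lt hp.2)
  simpa using this

lemma hasDerivAt_line_one {R : Set Coord} (hR : IsOpen R) {G : Coord → ℝ}
    (hG : ContDiffOn ℝ ∞ G R) {q : Coord} {t : ℝ} (ht : q + t • basisVec 1 ∈ R) :
    HasDerivAt (fun t : ℝ => G (q + t • basisVec 1)) (pd 1 G (q + t • basisVec 1)) t := by
  have h1 := hasDerivAt_line (i := 1) (differentiableAt_of_contDiffOn hR hG (by simp) ht)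
  have h2 := HasDerivAt.scomp_of_eq (g₁ := fun s : ℝ => G (q + t • basisVec 1 + s • basisVec 1))
      t h1 ((hasDerivAt_id t).sub_const t) (by simp)
  rw [one_smul] at h2
  refine h2.congr_of_eventuallyEq (Eventually.of_forall fun s => ?_)
  simp only [Function.comp_apply, id]
  rw [add_assoc, ← add_smul, add_sub_cancel]

lemma eq_toHorizon_of_pd_one (hR : IsOpen (region V ε)) {G : Coord → ℝ}
    (hG : ContDiffOn ℝ ∞ G (region V ε)) (h : ∀ y ∈ region V ε, pd 1 G y = 0) {p : Coord}
    (hp : p ∈ region V ε) : G p = G (toHorizon p) := by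
  have hmem : ∀ t ∈ Metric.ball (0 : ℝ) (ε (transverse p)),
      toHorizon p + t • basisVec 1 ∈ region V ε := fun t ht =>
    toHorizon_line_mem hp (by simpa using ht)
  have hd : ∀ t ∈ Metric.ball (0 : ℝ) (ε (transverse p)),
      HasDerivAt (fun t : ℝ => G (toHorizon p + t • basisVec 1)) 0 t := fun t ht => by
    have := hasDerivAt_line_one hR hG (hmem t ht)
    rwa [h _ (hmem t ht)] at this
  have h0 : 0 < ε (transverse p) := (abs_nonneg _).trans_lt hp.2
  have := Metric.isOpen_ball.is_const_of_deriv_eq_zero (convex_ball (0 : ℝ) _).isPreconnected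
    (fun s hs => (hd s hs).differentiableAt.differentiableWithinAt) (fun s hs => (hd s hs).deriv)
    (show p 1 ∈ Metric.ball (0 : ℝ) (ε (transverse p)) by simpa using hp.2)
    (Metric.mem_ball_self h0)
  simpa only [toHorizon_add_smul_one, zero_smul, add_zero] using this

/-- The method of characteristics: if `(Y, M)` solves Hamilton's equations in the variable `r` with
a Hamiltonian `K` that is homogeneous of degree two in the momenta, and if `K = 0` and the momentum
restricts to `dU` at `r = 0`, then the pullback of the canonical one-form `M dY` is `dU`. -/
theorem canonical_form_eq (hR : IsOpen (region V ε)) {Y M a c : Fin 4 → Coord → ℝ}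
    {K U : Coord → ℝ} (hY : ∀ i, ContDiffOn ℝ ∞ (Y i) (region V ε))
    (hM : ∀ i, ContDiffOn ℝ ∞ (M i) (region V ε)) (ha : ∀ i, ContDiffOn ℝ ∞ (a i) (region V ε))
    (hK : ContDiffOn ℝ ∞ K (region V ε)) (hU : IndepR V U) (hUs : ContDiffOn ℝ ∞ U (region V ε))
    (hYr : ∀ p ∈ region V ε, ∀ i, pd 1 (Y i) p = a i p)
    (hMr : ∀ p ∈ region V ε, ∀ i, pd 1 (M i) p = c i p)
    (hdK : ∀ p ∈ region V ε, ∀ b,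
      pd b K p = ∑ i, a i p * pd b (M i) p - ∑ i, c i p * pd b (Y i) p)
    (hhom : ∀ p ∈ region V ε, 2 * K p = ∑ i, M i p * a i p)
    (hK0 : ∀ p ∈ region V ε, p 1 = 0 → K p = 0)
    (hY0 : ∀ p ∈ region V ε, p 1 = 0 → ∀ i, Y i p = p i)
    (hM0 : ∀ p ∈ region V ε, p 1 = 0 → ∀ b, b ≠ 1 → M b p = pd b U p) :
    ∀ p ∈ region V ε, ∀ b, ∑ i, M i p * pd b (Y i) p = pd b U p := by
  have hd := fun {G : Coord → ℝ} {p} (hG : ContDiffOn ℝ ∞ G (region V ε)) (hp : p ∈ region V ε) =>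
    differentiableAt_of_contDiffOn hR hG (by simp) hp
  have hKz : ∀ p ∈ region V ε, K p = 0 := by
    intro p hp
    rw [eq_toHorizon_of_pd_one hR hK (fun y hy => ?_) hp]
    · exact hK0 _ (toHorizon_mem_region hp) (toHorizon_one p)
    · rw [hdK y hy]
      simp only [hYr y hy, hMr y hy]
      rw [sub_eq_zero]
      exact Finset.sum_congr rfl fun i _ => mul_comm _ _
  have hpdU : ∀ b, ∀ y ∈ region V ε, pd 1 (pd b U) y = 0 := by
    intro b y hy
    rw [pd_comm hR hUs hy, pd_congr_of_eqOn (G := fun _ => 0) hR hy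
      (fun z hz => hU.pd_one hz.1), pd_const]
  intro p hp b
  have hAs : ∀ b, ContDiffOn ℝ ∞ (fun p => ∑ i, M i p * pd b (Y i) p) (region V ε) := fun b =>
    ContDiffOn.sum fun i _ => (hM i).mul (contDiffOn_pd hR (hY i) b)
  have hAr : ∀ y ∈ region V ε, pd 1 (fun p => ∑ i, M i p * pd b (Y i) p) y = 0 := by
    intro y hy
    have hYb := fun i => hd (contDiffOn_pd hR (hY i) b) hy
    rw [pd_sum _ fun i _ => (hd (hM i) hy).fun_mul (hYb i)]
    have h1 : ∀ i, pd 1 (fun p => M i p * pd b (Y i) p) y =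
        c i y * pd b (Y i) y + M i y * pd b (a i) y := by
      intro i
      rw [pd_mul (hd (hM i) hy) (hYb i), hMr y hy, pd_comm hR (hY i) hy,
        pd_congr_of_eqOn hR hy (fun z hz => hYr z hz i)]
    have h2 : ∑ i, (pd b (M i) y * a i y + M i y * pd b (a i) y) = 0 := by
      have h3 : pd b (fun p => ∑ i, M i p * a i p) y = 0 := by
        rw [pd_congr_of_eqOn (G := fun _ => 0) hR hy
          (fun z hz => by simp only; rw [← hhom z hz, hKz z hz, mul_zero]), pd_const]
      rw [pd_sum _ fun i _ => (hd (hM i) hy).fun_mul (hd (ha i) hy)] at h3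
      rw [← h3]
      exact Finset.sum_congr rfl fun i _ => (pd_mul (hd (hM i) hy) (hd (ha i) hy)).symm
    have h4 : ∑ i, a i y * pd b (M i) y - ∑ i, c i y * pd b (Y i) y = 0 := by
      rw [← hdK y hy, pd_congr_of_eqOn (G := fun _ => 0) hR hy (fun z hz => hKz z hz), pd_const]
    simp only [h1]
    rw [Finset.sum_add_distrib] at h2 ⊢
    have h5 : ∑ i, pd b (M i) y * a i y = ∑ i, a i y * pd b (M i) y :=
      Finset.sum_congr rfl fun i _ => mul_comm _ _
    linarith
  by_cases hb : b = 1
  · subst hb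
    rw [hU.pd_one hp.1]
    simp only [hYr p hp]
    rw [← hhom p hp, hKz p hp, mul_zero]
  have h0 := toHorizon_mem_region hp
  rw [eq_toHorizon_of_pd_one hR (hAs b) hAr hp,
    eq_toHorizon_of_pd_one hR (contDiffOn_pd hR hUs b) (hpdU b) hp]
  have hYb : ∀ i, pd b (Y i) (toHorizon p) = if i = b then 1 else 0 := by
    intro i
    rw [← pd_coord i (p := toHorizon p)]
    refine pd_congr_horizon (hd (hY i) h0) (by fun_prop) hb (toHorizon_one p) ?_
    filter_upwards [hR.mem_nhds h0] with y hy hy1 using hY0 y hy hy1 i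
  simp only [hYb]
  rw [← hM0 _ h0 (toHorizon_one p) b hb]
  simp

end Characteristics

/-! ### The null geodesic flow off the horizon -/

section FlowTranslation

variable {E : Type*} [NormedAddCommGroup E] [NormedSpace ℝ E] {X : E → E} {Ω : Set E} {c : E}

lemma IsTrajectory.add (h : ∀ z ∈ Ω, z + c ∈ Ω ∧ X (z + c) = X z) {r : ℝ} {z : E} {γ : ℝ → E}
    (hγ : IsTrajectory X Ω r z γ) : IsTrajectory X Ω r (z + c) (fun t => γ t + c) where
  start := by rw [hγ.start]
  mem t ht := (h _ (hγ.mem t ht)).1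
  hasDerivAt t ht := by
    rw [(h _ (hγ.mem t ht)).2]
    exact (hγ.hasDerivAt t ht).add_const c

lemma flow_add (hΩ : IsOpen Ω) (hX : ContDiffOn ℝ ∞ X Ω)
    (h : ∀ z ∈ Ω, z + c ∈ Ω ∧ X (z + c) = X z) {w : ℝ × E}
    (hw : ∃ γ, IsTrajectory X Ω w.1 w.2 γ) : flow X Ω (w.1, w.2 + c) = flow X Ω w + c := by
  obtain ⟨γ, hγ⟩ := hw
  rw [flow_eq hΩ hX (hγ.add h), show w = (w.1, w.2) from rfl, flow_eq hΩ hX hγ]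

lemma add_mem_flowDomain (hΩ : IsOpen Ω) (hX : ContDiffOn ℝ ∞ X Ω)
    (h : ∀ z ∈ Ω, z + c ∈ Ω ∧ X (z + c) = X z) {w : ℝ × E} (hw : w ∈ flowDomain X Ω) :
    (w.1, w.2 + c) ∈ flowDomain X Ω := by
  obtain ⟨B, hB, hwB, hs, ht⟩ := hw
  let j : ℝ × E → ℝ × E := fun y => (y.1, y.2 - c)
  have hj : ContDiff ℝ ∞ j := contDiff_fst.prodMk (contDiff_snd.sub contDiff_const)
  have hjc : ∀ y : ℝ × E, ((j y).1, (j y).2 + c) = y := fun y => by simp [j]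
  refine ⟨j ⁻¹' B, hB.preimage hj.continuous, by simpa [j] using hwB, ?_, fun y hy => ?_⟩
  · have h1 : ContDiffOn ℝ ∞ (fun y => flow X Ω (j y) + c) (j ⁻¹' B) :=
      (hs.comp hj.contDiffOn fun y hy => hy).add contDiffOn_const
    refine h1.congr fun y hy => ?_
    rw [← flow_add hΩ hX h (ht _ hy), hjc]
  · obtain ⟨γ, hγ⟩ := ht _ hy
    have h2 := hγ.add h
    exact ⟨_, by simpa [j] using h2⟩

end FlowTranslation

section Hamiltonian

/-- The Hamiltonian `g^{ab}(y) ξ_a ξ_b / 2` of the geodesics, with the inverse metric in Gaussian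
null coordinates. -/
noncomputable def NullForm.hamiltonian (F : NullForm) (z : Coord × Coord) : ℝ :=
  (1 / 2 : ℝ) * ∑ a, ∑ b, F.inv z.1 a b * z.2 a * z.2 b

/-- The Hamiltonian vector field of the geodesics. -/
noncomputable def NullForm.hamVec (F : NullForm) (z : Coord × Coord) : Coord × Coord :=
  (fun i => ∑ b, F.inv z.1 i b * z.2 b,
    fun i => -((1 / 2 : ℝ) * ∑ a, ∑ b, pd i (fun y => F.inv y a b) z.1 * z.2 a * z.2 b))

variable {F : NullForm} {P : ℝ} {Ω : Set Coord}

lemma inv_symm {p : Coord} (hq : (-F.q p).PosDef) (a b : Fin 4) : F.inv p a b = F.inv p b a := by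
  have h1 : (F.metric p)ᵀ = F.metric p := by ext i j; exact metric_symm hq j i
  have h2 : ((F.metric p)⁻¹)ᵀ = (F.metric p)⁻¹ := by rw [Matrix.transpose_nonsing_inv, h1]
  rw [inv_metric hq] at h2
  exact congrFun (congrFun h2 b) a

lemma contDiffOn_hamVec (hF : F.IsAdmissible P Ω) (hΩ : IsOpen Ω) :
    ContDiffOn ℝ ∞ F.hamVec (Ω ×ˢ univ) := by
  have hfst : MapsTo Prod.fst (Ω ×ˢ (univ : Set Coord)) Ω := fun z hz => hz.1
  have hm : ∀ i, ContDiff ℝ ∞ fun z : Coord × Coord => z.2 i := fun i =>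
    (contDiff_apply ℝ ℝ i).comp contDiff_snd
  refine ContDiffOn.prodMk (contDiffOn_pi.2 fun i => ?_) (contDiffOn_pi.2 fun i => ?_)
  · exact ContDiffOn.sum fun b _ =>
      ((hF.contDiffOn_inv i b).comp contDiff_fst.contDiffOn hfst).mul (hm b).contDiffOn
  · refine (contDiffOn_const.mul (ContDiffOn.sum fun a _ => ContDiffOn.sum fun b _ => ?_)).neg
    exact (((contDiffOn_pd hΩ (hF.contDiffOn_inv a b) i).comp contDiff_fst.contDiffOn hfst).mul
      (hm a).contDiffOn).mul (hm b).contDiffOn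

/-- The differential of the Hamiltonian in terms of the Hamiltonian vector field. -/
lemma pd_hamiltonian (hF : F.IsAdmissible P Ω) (hΩ : IsOpen Ω) {Z : Coord → Coord × Coord}
    {p : Coord} (hZ : DifferentiableAt ℝ Z p) (hp : (Z p).1 ∈ Ω) (b : Fin 4) :
    pd b (fun y => F.hamiltonian (Z y)) p =
      ∑ i, (F.hamVec (Z p)).1 i * pd b (fun y => (Z y).2 i) p -
        ∑ i, (F.hamVec (Z p)).2 i * pd b (fun y => (Z y).1 i) p := by
  have hY : DifferentiableAt ℝ (fun y => (Z y).1) p := hZ.fst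
  have hM : ∀ i, DifferentiableAt ℝ (fun y => (Z y).2 i) p := fun i =>
    differentiableAt_pi.1 hZ.snd i
  have hJ : ∀ a c, DifferentiableAt ℝ (fun y => F.inv (Z y).1 a c) p := fun a c =>
    DifferentiableAt.comp (g := fun q => F.inv q a c) (f := fun y => (Z y).1) p
      (differentiableAt_of_contDiffOn hΩ (hF.contDiffOn_inv a c) (by simp) hp) hY
  have hJ' : ∀ a c, pd b (fun y => F.inv (Z y).1 a c) p =
      ∑ i, pd i (fun q => F.inv q a c) (Z p).1 * pd b (fun y => (Z y).1 i) p := fun a c =>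
    pd_comp (G := fun q => F.inv q a c) (Y := fun y => (Z y).1) b
      (differentiableAt_of_contDiffOn hΩ (hF.contDiffOn_inv a c) (by simp) hp) hY
  have h1 : ∀ a c, DifferentiableAt ℝ (fun y => F.inv (Z y).1 a c * (Z y).2 a * (Z y).2 c) p :=
    fun a c => ((hJ a c).fun_mul (hM a)).fun_mul (hM c)
  have hs : ∀ a, DifferentiableAt ℝ (fun y => ∑ c, F.inv (Z y).1 a c * (Z y).2 a * (Z y).2 c) p :=
    fun a => DifferentiableAt.fun_sum fun c _ => h1 a c
  have h2 : ∀ a c, pd b (fun y => F.inv (Z y).1 a c * (Z y).2 a * (Z y).2 c) p =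
      (∑ i, pd i (fun q => F.inv q a c) (Z p).1 * pd b (fun y => (Z y).1 i) p) * (Z p).2 a *
        (Z p).2 c + (F.inv (Z p).1 a c * (Z p).2 c * pd b (fun y => (Z y).2 a) p +
        F.inv (Z p).1 c a * (Z p).2 a * pd b (fun y => (Z y).2 c) p) := by
    intro a c
    rw [pd_mul ((hJ a c).fun_mul (hM a)) (hM c), pd_mul (hJ a c) (hM a), hJ',
      inv_symm (hF.neg_def _ hp) c a]
    ring
  have h3 : pd b (fun y => F.hamiltonian (Z y)) p =
      (1 / 2 : ℝ) * ∑ a, ∑ c, pd b (fun y => F.inv (Z y).1 a c * (Z y).2 a * (Z y).2 c) p := by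
    unfold NullForm.hamiltonian
    rw [pd_const_mul _ (DifferentiableAt.fun_sum fun a _ => hs a), pd_sum _ fun a _ => hs a]
    simp only [pd_sum _ fun c (_ : c ∈ Finset.univ) => h1 _ c]
  rw [h3]
  simp only [h2, Finset.sum_add_distrib]
  rw [Finset.sum_comm (f := fun a c => F.inv (Z p).1 c a * (Z p).2 a * pd b (fun y => (Z y).2 c) p)]
  have h4 : ∑ i, (F.hamVec (Z p)).1 i * pd b (fun y => (Z y).2 i) p =
      ∑ a, ∑ c, F.inv (Z p).1 a c * (Z p).2 c * pd b (fun y => (Z y).2 a) p := by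
    simp only [NullForm.hamVec, Finset.sum_mul]
  have h5 : ∑ i, (F.hamVec (Z p)).2 i * pd b (fun y => (Z y).1 i) p =
      -((1 / 2 : ℝ) * ∑ a, ∑ c, (∑ i, pd i (fun q => F.inv q a c) (Z p).1 *
        pd b (fun y => (Z y).1 i) p) * (Z p).2 a * (Z p).2 c) := by
    simp only [NullForm.hamVec, Finset.sum_mul, Finset.mul_sum, ← Finset.sum_neg_distrib, neg_mul]
    rw [Finset.sum_comm]
    refine Finset.sum_congr rfl fun a _ => ?_
    rw [Finset.sum_comm]
    refine Finset.sum_congr rfl fun c _ => Finset.sum_congr rfl fun i _ => ?_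
    ring
  rw [h4, h5]
  ring

lemma two_mul_hamiltonian (z : Coord × Coord) :
    2 * F.hamiltonian z = ∑ i, z.2 i * (F.hamVec z).1 i := by
  simp only [NullForm.hamiltonian, NullForm.hamVec, Finset.mul_sum]
  refine Finset.sum_congr rfl fun a _ => Finset.sum_congr rfl fun b _ => ?_
  ring

lemma metric_mulVec_hamVec {z : Coord × Coord} (hq : (-F.q z.1).PosDef) :
    F.metric z.1 *ᵥ (F.hamVec z).1 = z.2 := by
  have h : (F.hamVec z).1 = F.inv z.1 *ᵥ z.2 := rfl
  rw [h, Matrix.mulVec_mulVec, metric_mul_inv hq, Matrix.one_mulVec]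

lemma inv_add {t : ℝ} {p : Coord} (hf : F.f (p + t • basisVec 0) = F.f p)
    (hh : F.h (p + t • basisVec 0) = F.h p) (hq : F.q (p + t • basisVec 0) = F.q p) :
    F.inv (p + t • basisVec 0) = F.inv p := by
  simp [NullForm.inv, NullForm.hUp, hf, hh, hq, add_smul_zero_one, -Pi.add_apply]

lemma metric_add {t : ℝ} {p : Coord} (hf : F.f (p + t • basisVec 0) = F.f p)
    (hh : F.h (p + t • basisVec 0) = F.h p) (hq : F.q (p + t • basisVec 0) = F.q p) :
    F.metric (p + t • basisVec 0) = F.metric p := by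
  simp [NullForm.metric, hf, hh, hq, add_smul_zero_one, -Pi.add_apply]

lemma add_mem_region {V : Set (Fin 2 → ℝ)} {ε : (Fin 2 → ℝ) → ℝ} {p : Coord} (t : ℝ) :
    p + t • basisVec 0 ∈ region V ε ↔ p ∈ region V ε := by
  simp only [region, mem_ofPred_eq, transverse_add_smul_zero, add_smul_zero_one]

lemma admissible_shift {V : Set (Fin 2 → ℝ)} {ε : (Fin 2 → ℝ) → ℝ}
    (hF : F.IsAdmissible P (region V ε)) {t : ℝ} (ht : t = P ∨ t = -P) {p : Coord}
    (hp : p ∈ region V ε) : F.f (p + t • basisVec 0) = F.f p ∧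
      F.h (p + t • basisVec 0) = F.h p ∧ F.q (p + t • basisVec 0) = F.q p := by
  rcases ht with rfl | rfl
  · exact ⟨hF.periodic_f p hp, hF.periodic_h p hp, hF.periodic_q p hp⟩
  · have hp' := (add_mem_region (-P)).2 hp
    have h1 := hF.periodic_f _ hp'
    have h2 := hF.periodic_h _ hp'
    have h3 := hF.periodic_q _ hp'
    rw [add_assoc, ← add_smul, neg_add_cancel, zero_smul, add_zero] at h1 h2 h3
    exact ⟨h1.symm, h2.symm, h3.symm⟩

lemma hamVec_shift {V : Set (Fin 2 → ℝ)} {ε : (Fin 2 → ℝ) → ℝ} (hΩ : IsOpen (region V ε))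
    (hF : F.IsAdmissible P (region V ε)) {t : ℝ} (ht : t = P ∨ t = -P) :
    ∀ z ∈ region V ε ×ˢ (univ : Set Coord), z + (t • basisVec 0, 0) ∈ region V ε ×ˢ univ ∧
      F.hamVec (z + (t • basisVec 0, 0)) = F.hamVec z := by
  have hinv : ∀ y ∈ region V ε, F.inv (y + t • basisVec 0) = F.inv y := fun y hy =>
    have h := admissible_shift hF ht hy
    inv_add h.1 h.2.1 h.2.2
  rintro ⟨y, ξ⟩ ⟨hy, -⟩
  refine ⟨⟨(add_mem_region t).2 hy, mem_univ _⟩, ?_⟩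
  have hpd : ∀ i a b, pd i (fun y => F.inv y a b) (y + t • basisVec 0) =
      pd i (fun y => F.inv y a b) y := by
    intro i a b
    rw [← pd_shift (G := fun y => F.inv y a b)]
    exact pd_congr_of_eqOn hΩ hy fun z hz => by simp only [hinv z hz]
  simp only [NullForm.hamVec, Prod.mk_add_mk, add_zero, hinv y hy, hpd]

end Hamiltonian

section NullGeodesics

variable {F : NullForm} {P δ σ : ℝ} {V : Set (Fin 2 → ℝ)} {U : Coord → ℝ}

/-- The covector on the horizon that restricts to `dU` there and is null. -/
noncomputable def NullForm.nullCovector (F : NullForm) (U : Coord → ℝ) (p : Coord) : Coord :=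
  ![pd 0 U p, -(∑ A : Fin 2, ∑ B : Fin 2, (F.q p)⁻¹ A B * pd (![2, 3] A) U p *
    pd (![2, 3] B) U p) / (2 * pd 0 U p), pd 2 U p, pd 3 U p]

/-- The initial point in phase space of the null geodesic through `p`. -/
noncomputable def NullForm.initial (F : NullForm) (U : Coord → ℝ) (p : Coord) : Coord × Coord :=
  (toHorizon p, F.nullCovector U (toHorizon p))

/-- The geodesic flow on phase space, for the parameter `r`, that starts on the horizon with the
null covector over `dU`. -/
noncomputable def NullForm.nullFlow (F : NullForm) (U : Coord → ℝ) (V : Set (Fin 2 → ℝ)) (δ : ℝ)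
    (p : Coord) : Coord × Coord :=
  flow F.hamVec (region V (fun _ => δ) ×ˢ univ) (p 1, F.initial U p)

/-- The points of the cylinder near which `nullFlow` is defined and smooth. -/
def NullForm.nullFlowDomain (F : NullForm) (U : Coord → ℝ) (V : Set (Fin 2 → ℝ)) (δ : ℝ) :
    Set Coord :=
  {p | p ∈ cylinder V ∧
    (p 1, F.initial U p) ∈ flowDomain F.hamVec (region V (fun _ => δ) ×ˢ univ)}

lemma toHorizon_mem_region_of_cylinder (hδ : 0 < δ) {p : Coord} (hp : p ∈ cylinder V) :
    toHorizon p ∈ region V (fun _ => δ) :=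
  ⟨toHorizon_mem_cylinder hp, by simpa using hδ⟩

lemma contDiffOn_initial (hF : F.IsAdmissible P (region V fun _ => δ)) (hδ : 0 < δ)
    (hV : IsOpen V) (hU : ContDiffOn ℝ ∞ U (cylinder V)) (hU0 : ∀ p ∈ cylinder V, pd 0 U p ≠ 0) :
    ContDiffOn ℝ ∞ (F.initial U) (cylinder V) := by
  have hH : ContDiffOn ℝ ∞ toHorizon (cylinder V) := toHorizon.contDiff.contDiffOn
  have hm : MapsTo toHorizon (cylinder V) (cylinder V) := fun p hp => toHorizon_mem_cylinder hp
  have hm' : MapsTo toHorizon (cylinder V) (region V fun _ => δ) := fun p hp =>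
    toHorizon_mem_region_of_cylinder hδ hp
  have hp : ∀ b, ContDiffOn ℝ ∞ (fun p => pd b U (toHorizon p)) (cylinder V) := fun b =>
    (contDiffOn_pd (cylinder_open hV) hU b).comp hH hm
  have hq : ∀ A B, ContDiffOn ℝ ∞ (fun p => (F.q (toHorizon p))⁻¹ A B) (cylinder V) := fun A B =>
    (hF.contDiffOn_qInv A B).comp hH hm'
  refine hH.prodMk (contDiffOn_pi.2 fun i => ?_)
  fin_cases i
  · exact hp 0
  · exact (ContDiffOn.sum fun A _ => ContDiffOn.sum fun B _ =>
      ((hq A B).mul (hp _)).mul (hp _)).neg.div (contDiffOn_const.mul (hp 0))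
      fun p hp => mul_ne_zero two_ne_zero (hU0 _ (toHorizon_mem_cylinder hp))
  · exact hp 2
  · exact hp 3

lemma isOpen_phaseSpace (hV : IsOpen V) :
    IsOpen (region V (fun _ => δ) ×ˢ (univ : Set Coord)) :=
  (isOpen_region hV continuousOn_const).prod isOpen_univ

lemma initial_add_smul_one (p : Coord) (t : ℝ) :
    F.initial U (p + t • basisVec 1) = F.initial U p := by
  have h1 : toHorizon (p + t • basisVec 1) = toHorizon p := by
    ext i; by_cases hi : i = 1 <;> simp [toHorizon_apply, basisVec_apply, hi]
  rw [NullForm.initial, h1, NullForm.initial]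

lemma initial_add (hF : F.IsAdmissible P (region V fun _ => δ)) (hδ : 0 < δ) (hV : IsOpen V)
    (hU : ContDiffOn ℝ ∞ U (cylinder V))
    (hUP : ∀ p ∈ cylinder V, U (p + P • basisVec 0) = U p + σ * P) {p : Coord}
    (hp : p ∈ cylinder V) :
    F.initial U (p + P • basisVec 0) = F.initial U p + (P • basisVec 0, 0) := by
  have hpd : ∀ b, pd b U (toHorizon p + P • basisVec 0) = pd b U (toHorizon p) := by
    intro b
    have hm := toHorizon_mem_cylinder hp
    rw [← pd_shift, pd_congr_of_eqOn (G := fun y => U y + σ * P) (cylinder_open hV) hm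
      fun y hy => hUP y hy, pd_add (differentiableAt_of_contDiffOn (cylinder_open hV) hU (by simp)
      hm) (by fun_prop), pd_const, add_zero]
  have hq := hF.periodic_q _ (toHorizon_mem_region_of_cylinder hδ hp)
  simp only [NullForm.initial, toHorizon_add, Prod.mk_add_mk, add_zero, NullForm.nullCovector,
    hpd, hq]

lemma isOpen_nullFlowDomain (hF : F.IsAdmissible P (region V fun _ => δ)) (hδ : 0 < δ)
    (hV : IsOpen V) (hU : ContDiffOn ℝ ∞ U (cylinder V)) (hU0 : ∀ p ∈ cylinder V, pd 0 U p ≠ 0) :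
    IsOpen (F.nullFlowDomain U V δ) := by
  have h : ContinuousOn (fun p : Coord => (p 1, F.initial U p)) (cylinder V) :=
    (by fun_prop : ContinuousOn (fun p : Coord => p 1) (cylinder V)).prodMk
      (contDiffOn_initial hF hδ hV hU hU0).continuousOn
  exact h.isOpen_inter_preimage (cylinder_open hV) isOpen_flowDomain

lemma contDiffOn_nullFlow (hF : F.IsAdmissible P (region V fun _ => δ)) (hδ : 0 < δ)
    (hV : IsOpen V) (hU : ContDiffOn ℝ ∞ U (cylinder V)) (hU0 : ∀ p ∈ cylinder V, pd 0 U p ≠ 0) :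
    ContDiffOn ℝ ∞ (F.nullFlow U V δ) (F.nullFlowDomain U V δ) := by
  have h : ContDiffOn ℝ ∞ (fun p : Coord => (p 1, F.initial U p)) (F.nullFlowDomain U V δ) :=
    ((by fun_prop : ContDiffOn ℝ ∞ (fun p : Coord => p 1) (cylinder V)).prodMk
      (contDiffOn_initial hF hδ hV hU hU0)).mono fun p hp => hp.1
  exact contDiffOn_flow.comp h fun p hp => hp.2

lemma initial_mem (hδ : 0 < δ) {p : Coord} (hp : p ∈ cylinder V) :
    F.initial U p ∈ region V (fun _ => δ) ×ˢ (univ : Set Coord) :=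
  ⟨toHorizon_mem_region_of_cylinder hδ hp, mem_univ _⟩

lemma horizon_mem_nullFlowDomain (hF : F.IsAdmissible P (region V fun _ => δ)) (hδ : 0 < δ)
    (hV : IsOpen V) {p : Coord} (hp : p ∈ cylinder V) (hp1 : p 1 = 0) :
    p ∈ F.nullFlowDomain U V δ := by
  refine ⟨hp, ?_⟩
  rw [hp1]
  exact zero_mem_flowDomain (isOpen_phaseSpace hV)
    (contDiffOn_hamVec hF (isOpen_region hV continuousOn_const)) (initial_mem hδ hp)

lemma nullFlow_horizon (hF : F.IsAdmissible P (region V fun _ => δ)) (hδ : 0 < δ)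
    (hV : IsOpen V) {p : Coord} (hp : p ∈ cylinder V) (hp1 : p 1 = 0) :
    F.nullFlow U V δ p = (p, F.nullCovector U p) := by
  rw [NullForm.nullFlow, hp1, flow_zero (isOpen_phaseSpace hV)
    (contDiffOn_hamVec hF (isOpen_region hV continuousOn_const)) (initial_mem hδ hp),
    NullForm.initial, toHorizon_eq_self hp1]

lemma nullFlow_mem (hF : F.IsAdmissible P (region V fun _ => δ)) (hV : IsOpen V) {p : Coord}
    (hp : p ∈ F.nullFlowDomain U V δ) : (F.nullFlow U V δ p).1 ∈ region V fun _ => δ :=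
  (flow_mem (isOpen_phaseSpace hV)
    (contDiffOn_hamVec hF (isOpen_region hV continuousOn_const)) hp.2).1

lemma fderiv_nullFlow_one (hF : F.IsAdmissible P (region V fun _ => δ)) (hδ : 0 < δ)
    (hV : IsOpen V) (hU : ContDiffOn ℝ ∞ U (cylinder V)) (hU0 : ∀ p ∈ cylinder V, pd 0 U p ≠ 0)
    {p : Coord} (hp : p ∈ F.nullFlowDomain U V δ) :
    fderiv ℝ (F.nullFlow U V δ) p (basisVec 1) = F.hamVec (F.nullFlow U V δ p) := by
  have hd := ((contDiffOn_nullFlow hF hδ hV hU hU0).contDiffAt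
    ((isOpen_nullFlowDomain hF hδ hV hU hU0).mem_nhds hp)).differentiableAt (by simp)
  have h1 := hasDerivAt_flow (isOpen_phaseSpace hV)
    (contDiffOn_hamVec hF (isOpen_region hV continuousOn_const)) hp.2
  have h2 := HasDerivAt.scomp_of_eq (0 : ℝ) h1 ((hasDerivAt_id (0 : ℝ)).const_add (p 1)) (by simp)
  rw [one_smul] at h2
  have h3 : HasDerivAt (fun t : ℝ => F.nullFlow U V δ (p + t • basisVec 1))
      (fderiv ℝ (F.nullFlow U V δ) p (basisVec 1)) 0 := by
    have h4 : HasDerivAt (fun t : ℝ => p + t • basisVec 1) (basisVec 1) 0 := by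
      simpa using ((hasDerivAt_id (0 : ℝ)).smul_const (basisVec 1)).const_add p
    exact HasFDerivAt.comp_hasDerivAt_of_eq (0 : ℝ) hd.hasFDerivAt h4 (by simp)
  refine h3.unique (h2.congr_of_eventuallyEq (Eventually.of_forall fun t => ?_))
  simp only [NullForm.nullFlow, initial_add_smul_one, Function.comp_apply, id]
  congr 2
  simp [basisVec_apply]

lemma nullFlow_add (hF : F.IsAdmissible P (region V fun _ => δ)) (hδ : 0 < δ) (hV : IsOpen V)
    (hU : ContDiffOn ℝ ∞ U (cylinder V))
    (hUP : ∀ p ∈ cylinder V, U (p + P • basisVec 0) = U p + σ * P) {p : Coord}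
    (hp : p ∈ F.nullFlowDomain U V δ) :
    F.nullFlow U V δ (p + P • basisVec 0) = F.nullFlow U V δ p + (P • basisVec 0, 0) := by
  have hR := isOpen_region hV (continuousOn_const (c := δ))
  rw [NullForm.nullFlow, initial_add hF hδ hV hU hUP hp.1, add_smul_zero_one]
  exact flow_add (isOpen_phaseSpace hV) (contDiffOn_hamVec hF hR)
    (hamVec_shift hR hF (Or.inl rfl)) (exists_isTrajectory hp.2)

lemma add_mem_nullFlowDomain (hF : F.IsAdmissible P (region V fun _ => δ)) (hδ : 0 < δ)
    (hV : IsOpen V) (hU : ContDiffOn ℝ ∞ U (cylinder V))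
    (hUP : ∀ p ∈ cylinder V, U (p + P • basisVec 0) = U p + σ * P) {p : Coord} :
    p + P • basisVec 0 ∈ F.nullFlowDomain U V δ ↔ p ∈ F.nullFlowDomain U V δ := by
  have hR := isOpen_region hV (continuousOn_const (c := δ))
  have hX := contDiffOn_hamVec hF hR
  constructor
  · rintro ⟨hp, hw⟩
    have hp' : p ∈ cylinder V := by
      rwa [cylinder, mem_ofPred_eq, transverse_add_smul_zero] at hp
    refine ⟨hp', ?_⟩
    rw [initial_add hF hδ hV hU hUP hp', add_smul_zero_one] at hw
    have h1 := add_mem_flowDomain (isOpen_phaseSpace hV) hX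
      (hamVec_shift hR hF (Or.inr rfl)) hw
    have e : F.initial U p + (P • basisVec 0, 0) + ((-P) • basisVec 0, 0) = F.initial U p := by
      refine Prod.ext ?_ ?_ <;> simp
    rwa [e] at h1
  · rintro ⟨hp, hw⟩
    refine ⟨add_mem_cylinder hp, ?_⟩
    rw [initial_add hF hδ hV hU hUP hp, add_smul_zero_one]
    exact add_mem_flowDomain (isOpen_phaseSpace hV) hX (hamVec_shift hR hF (Or.inl rfl)) hw

end NullGeodesics

/-! ### Injectivity near the horizon -/

section InjectiveNeighborhood

/-- Radii that can be chosen locally constant can be chosen continuously. -/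
lemma exists_continuous_radius {X : Type*} [PseudoMetricSpace X] {V : Set X}
    {Good : X → ℝ → Prop} (hmono : ∀ x ρ ρ', Good x ρ → 0 < ρ' → ρ' ≤ ρ → Good x ρ')
    (hloc : ∀ x ∈ V, ∃ ρ > 0, ∀ᶠ y in 𝓝 x, Good y ρ) :
    ∃ ε : X → ℝ, ContinuousOn ε V ∧ (∀ x ∈ V, 0 < ε x) ∧ ∀ x ∈ V, Good x (ε x) := by
  obtain ⟨g, hg⟩ := exists_continuous_forall_mem_convex_of_local_const
    (X := V) (t := fun x => {ρ : ℝ | 0 < ρ ∧ Good x ρ}) (fun x => by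
      refine Set.OrdConnected.convex ⟨fun a ha b hb c hc => ?_⟩
      exact ⟨ha.1.trans_le hc.1, hmono _ _ _ hb.2 (ha.1.trans_le hc.1) hc.2⟩)
    (fun x => by
      obtain ⟨ρ, hρ, h⟩ := hloc x x.2
      refine ⟨ρ, ?_⟩
      filter_upwards [(continuous_subtype_val.tendsto x).eventually h] with y hy
      exact ⟨hρ, hy⟩)
  classical
  let ε : X → ℝ := fun x => if h : x ∈ V then g ⟨x, h⟩ else 1
  have hε : ∀ x (h : x ∈ V), ε x = g ⟨x, h⟩ := fun x h => dif_pos h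
  refine ⟨ε, ?_, fun x hx => ?_, fun x hx => ?_⟩
  · rw [continuousOn_iff_continuous_domRestrict]
    exact g.continuous.congr fun x => (hε x x.2).symm
  · rw [hε x hx]; exact (hg _).1
  · rw [hε x hx]; exact (hg ⟨x, hx⟩).2

variable {V : Set (Fin 2 → ℝ)} {P : ℝ} {W : Set Coord} {Ψ : Coord → Coord}

lemma add_int_smul_mem (h : ∀ p, p + P • basisVec 0 ∈ W ↔ p ∈ W) (n : ℤ) (p : Coord) :
    p + (n * P) • basisVec 0 ∈ W ↔ p ∈ W := by
  induction n with
  | zero => simp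
  | succ n ih =>
    rw [← ih, ← h (p + ((n : ℤ) * P) • basisVec 0), add_assoc, ← add_smul]
    push_cast
    rw [add_one_mul]
  | pred n ih =>
    rw [← ih, ← h (p + _ • basisVec 0), add_assoc, ← add_smul]
    push_cast
    rw [sub_one_mul, sub_add_cancel]

lemma apply_add_int_smul (h : ∀ p, p + P • basisVec 0 ∈ W ↔ p ∈ W)
    (hΨ : ∀ p ∈ W, Ψ (p + P • basisVec 0) = Ψ p + P • basisVec 0) (n : ℤ) {p : Coord}
    (hp : p ∈ W) : Ψ (p + (n * P) • basisVec 0) = Ψ p + (n * P) • basisVec 0 := by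
  induction n with
  | zero => simp
  | succ n ih =>
    have h1 := hΨ _ ((add_int_smul_mem h n p).2 hp)
    rw [ih, add_assoc, ← add_smul, add_assoc, ← add_smul, ← add_one_mul] at h1
    exact_mod_cast h1
  | pred n ih =>
    have h1 := hΨ _ ((add_int_smul_mem h (-n - 1) p).2 hp)
    rw [add_assoc, ← add_smul, ← add_one_mul] at h1
    push_cast at h1 ih ⊢
    rw [sub_add_cancel, ih] at h1
    rw [eq_comm, ← add_right_cancel_iff (a := P • basisVec 0), ← h1, add_assoc, ← add_smul,
      ← add_one_mul, sub_add_cancel]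

/-- The segment `u ∈ [a, b]` of the generator of the horizon with transverse coordinates `x`. -/
def generatorSegment (a b : ℝ) (x : Fin 2 → ℝ) : Set Coord :=
  (fun u : ℝ => (![u, 0, x 0, x 1] : Coord)) '' Icc a b

lemma isCompact_generatorSegment (a b : ℝ) (x : Fin 2 → ℝ) :
    IsCompact (generatorSegment a b x) := by
  refine isCompact_Icc.image (continuous_pi fun i => ?_)
  fin_cases i <;> simp <;> fun_prop

lemma mem_generatorSegment {a b : ℝ} {x : Fin 2 → ℝ} {p : Coord} (hp : p ∈ generatorSegment a b x) :
    transverse p = x ∧ p 1 = 0 := by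
  obtain ⟨u, -, rfl⟩ := hp
  refine ⟨?_, by simp⟩
  ext i; fin_cases i <;> simp [transverse]

lemma mem_thickening_generatorSegment {a b ρ : ℝ} {x : Fin 2 → ℝ} {p : Coord}
    (hp : p ∈ region (Metric.ball x ρ) fun _ => ρ) (h0 : p 0 ∈ Icc a b) :
    p ∈ Metric.thickening ρ (generatorSegment a b x) := by
  have hρ : 0 < ρ := (abs_nonneg _).trans_lt hp.2
  refine Metric.mem_thickening_iff.2 ⟨_, ⟨p 0, h0, rfl⟩, ?_⟩
  have h1 := (dist_pi_lt_iff hρ).1 hp.1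
  rw [dist_pi_lt_iff hρ]
  intro i
  fin_cases i
  · simpa using hρ
  · simpa [Real.dist_eq] using hp.2
  · simpa [transverse] using h1 0
  · simpa [transverse] using h1 1

lemma exists_shift_mem_Icc (hP : 0 < P) (p : Coord) :
    ∃ n : ℤ, (p + (n * P) • basisVec 0) 0 ∈ Icc 0 P := by
  obtain ⟨n, hn, -⟩ := existsUnique_add_zsmul_mem_Ico hP (p 0) 0
  refine ⟨n, ?_⟩
  simp only [zsmul_eq_mul, zero_add] at hn
  simpa [basisVec_apply] using Ico_subset_Icc_self hn

lemma exists_region_subset (hP : 0 < P) (hW : IsOpen W)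
    (h : ∀ p, p + P • basisVec 0 ∈ W ↔ p ∈ W)
    (h0 : ∀ p : Coord, transverse p ∈ V → p 1 = 0 → p ∈ W) {x : Fin 2 → ℝ} (hx : x ∈ V) :
    ∃ ρ > 0, region (Metric.ball x ρ) (fun _ => ρ) ⊆ W := by
  obtain ⟨ρ, hρ, hsub⟩ := (isCompact_generatorSegment 0 P x).exists_thickening_subset_open hW
    fun p hp => by
      obtain ⟨h1, h2⟩ := mem_generatorSegment hp
      exact h0 p (h1 ▸ hx) h2
  refine ⟨ρ, hρ, fun p hp => ?_⟩
  obtain ⟨n, hn⟩ := exists_shift_mem_Icc hP p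
  exact (add_int_smul_mem h n p).1
    (hsub (mem_thickening_generatorSegment ((add_mem_region _).2 hp) hn))

lemma region_ball_subset {x y : Fin 2 → ℝ} {ρ ρ' : ℝ} (h : dist y x + ρ' ≤ ρ) :
    region (Metric.ball y ρ') (fun _ => ρ') ⊆ region (Metric.ball x ρ) fun _ => ρ := by
  have h1 : ρ' ≤ ρ := by linarith [dist_nonneg (x := y) (y := x)]
  exact fun p hp => ⟨Metric.ball_subset_ball' (by linarith) hp.1, hp.2.trans_le h1⟩

/-- Injectivity near a whole generator. As `Ψ` moves `u` by less than `1`, two points with the same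
image have `u` closer than `2`; after a translation by periods both lie over the compact segment
`u ∈ [-2, P + 2]`, where local injectivity and injectivity on the horizon suffice. -/
lemma exists_region_injOn (hP : 0 < P) (hW : IsOpen W)
    (h : ∀ p, p + P • basisVec 0 ∈ W ↔ p ∈ W)
    (h0 : ∀ p : Coord, transverse p ∈ V → p 1 = 0 → p ∈ W) (hc : ContinuousOn Ψ W)
    (hΨ : ∀ p ∈ W, Ψ (p + P • basisVec 0) = Ψ p + P • basisVec 0)
    (hΨ0 : ∀ p : Coord, transverse p ∈ V → p 1 = 0 → Ψ p = p)
    (hΨ1 : ∀ p ∈ W, |Ψ p 0 - p 0| < 1)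
    (hloc : ∀ p : Coord, transverse p ∈ V → p 1 = 0 → ∃ S ∈ 𝓝 p, InjOn Ψ S)
    {x : Fin 2 → ℝ} (hx : x ∈ V) :
    ∃ ρ > 0, region (Metric.ball x ρ) (fun _ => ρ) ⊆ W ∧
      InjOn Ψ (region (Metric.ball x ρ) fun _ => ρ) := by
  have hK : ∀ p ∈ generatorSegment (-2) (P + 2) x, transverse p ∈ V ∧ p 1 = 0 := fun p hp =>
    ⟨(mem_generatorSegment hp).1 ▸ hx, (mem_generatorSegment hp).2⟩
  obtain ⟨S, hS, hinj⟩ := InjOn.exists_mem_nhdsSet (f := Ψ)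
    (s := generatorSegment (-2) (P + 2) x)
    (fun p hp q hq hpq => by
      rwa [hΨ0 p (hK p hp).1 (hK p hp).2, hΨ0 q (hK q hq).1 (hK q hq).2] at hpq)
    (isCompact_generatorSegment _ _ x)
    (fun p hp => hc.continuousAt (hW.mem_nhds (h0 p (hK p hp).1 (hK p hp).2)))
    (fun p hp => hloc p (hK p hp).1 (hK p hp).2)
  obtain ⟨S', hS', hKS, hSS⟩ := mem_nhdsSet_iff_exists.1 hS
  obtain ⟨ρ₁, hρ₁, hsub⟩ :=
    (isCompact_generatorSegment (-2) (P + 2) x).exists_thickening_subset_open hS' hKS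
  obtain ⟨ρ₂, hρ₂, hsub₂⟩ := exists_region_subset hP hW h h0 hx
  have hρ := lt_min hρ₁ hρ₂
  have hr₁ : region (Metric.ball x (min ρ₁ ρ₂)) (fun _ => min ρ₁ ρ₂) ⊆
      region (Metric.ball x ρ₁) fun _ => ρ₁ :=
    region_ball_subset (by simp)
  have hr₂ : region (Metric.ball x (min ρ₁ ρ₂)) (fun _ => min ρ₁ ρ₂) ⊆ W :=
    (region_ball_subset (by simp)).trans hsub₂
  refine ⟨min ρ₁ ρ₂, hρ, hr₂, fun p hp q hq hpq => ?_⟩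
  obtain ⟨n, hn⟩ := exists_shift_mem_Icc hP p
  have hp1 := hΨ1 p (hr₂ hp)
  have hq1 := hΨ1 q (hr₂ hq)
  rw [hpq] at hp1
  have hpq0 : |q 0 - p 0| < 2 := by
    rw [abs_lt] at *
    constructor <;> linarith [hp1.1, hp1.2, hq1.1, hq1.2]
  have he : Ψ (p + (n * P) • basisVec 0) = Ψ (q + (n * P) • basisVec 0) := by
    rw [apply_add_int_smul h hΨ n (hr₂ hp), apply_add_int_smul h hΨ n (hr₂ hq), hpq]
  have hq0 : (q + (n * P) • basisVec 0) 0 = (p + (n * P) • basisVec 0) 0 + (q 0 - p 0) := by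
    simp only [Pi.add_apply]; ring
  have h2 := hinj
    (hSS (hsub (mem_thickening_generatorSegment ((add_mem_region (n * P)).2 (hr₁ hp))
      ⟨by linarith [hn.1], by linarith [hn.2]⟩)))
    (hSS (hsub (mem_thickening_generatorSegment ((add_mem_region (n * P)).2 (hr₁ hq))
      ⟨by rw [hq0]; linarith [hn.1, (abs_lt.1 hpq0).1],
        by rw [hq0]; linarith [hn.2, (abs_lt.1 hpq0).2]⟩))) he
  exact add_right_cancel h2

/-- A periodic local diffeomorphism that fixes the horizon is injective on some region around it.
Two points with the same image have transverse coordinates close to those of the image, relative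
to the larger one of the two radii on which local injectivity is known. -/
theorem exists_injective_region (hP : 0 < P) (hW : IsOpen W)
    (h : ∀ p, p + P • basisVec 0 ∈ W ↔ p ∈ W) (hWV : W ⊆ cylinder V)
    (h0 : ∀ p : Coord, transverse p ∈ V → p 1 = 0 → p ∈ W) (hc : ContinuousOn Ψ W)
    (hΨ : ∀ p ∈ W, Ψ (p + P • basisVec 0) = Ψ p + P • basisVec 0)
    (hΨ0 : ∀ p : Coord, transverse p ∈ V → p 1 = 0 → Ψ p = p)
    (hloc : ∀ p : Coord, transverse p ∈ V → p 1 = 0 → ∃ S ∈ 𝓝 p, InjOn Ψ S) :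
    ∃ ε : (Fin 2 → ℝ) → ℝ, ContinuousOn ε V ∧ (∀ x ∈ V, 0 < ε x) ∧ region V ε ⊆ W ∧
      InjOn Ψ (region V ε) := by
  -- first restrict to the points that `Ψ` moves by less than one in the direction of `u`
  let W₁ : Set Coord := W ∩ (fun p => |Ψ p 0 - p 0|) ⁻¹' Iio 1
  have hc0 : ContinuousOn (fun p => |Ψ p 0 - p 0|) W :=
    (((continuous_apply 0).comp_continuousOn hc).sub (continuous_apply 0).continuousOn).abs
  have hW₁ : IsOpen W₁ := hc0.isOpen_inter_preimage hW isOpen_Iio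
  have hcomp : ∀ p ∈ W, ∀ i, Ψ (p + P • basisVec 0) i - (p + P • basisVec 0) i = Ψ p i - p i := by
    intro p hp i
    rw [hΨ p hp]; simp
  have h₁ : ∀ p, p + P • basisVec 0 ∈ W₁ ↔ p ∈ W₁ := by
    intro p
    constructor
    · rintro ⟨hp, hp1⟩
      have hp' := (h p).1 hp
      refine ⟨hp', ?_⟩
      rwa [mem_preimage, hcomp p hp'] at hp1
    · rintro ⟨hp, hp1⟩
      refine ⟨(h p).2 hp, ?_⟩
      rwa [mem_preimage, hcomp p hp]
  have h0₁ : ∀ p : Coord, transverse p ∈ V → p 1 = 0 → p ∈ W₁ := fun p hp hp1 =>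
    ⟨h0 p hp hp1, by simp [hΨ0 p hp hp1]⟩
  have hc₁ := hc.mono (inter_subset_left : W₁ ⊆ W)
  obtain ⟨δ, hδc, hδ, hgood⟩ := exists_continuous_radius (V := V)
    (Good := fun x ρ => region (Metric.ball x ρ) (fun _ => ρ) ⊆ W₁ ∧
      InjOn Ψ (region (Metric.ball x ρ) fun _ => ρ))
    (fun x ρ ρ' hρ _ hle => by
      have := region_ball_subset (x := x) (y := x) (ρ := ρ) (ρ' := ρ') (by simpa using hle)
      exact ⟨this.trans hρ.1, hρ.2.mono this⟩)
    (fun x hx => by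
      obtain ⟨ρ, hρ, hsub, hinj⟩ := exists_region_injOn hP hW₁ h₁ h0₁ hc₁
        (fun p hp => hΨ p hp.1) hΨ0 (fun p hp => hp.2) hloc hx
      refine ⟨ρ / 2, half_pos hρ, ?_⟩
      filter_upwards [Metric.ball_mem_nhds x (half_pos hρ)] with y hy
      have hyx : dist y x < ρ / 2 := hy
      have := region_ball_subset (x := x) (y := y) (ρ := ρ) (ρ' := ρ / 2) (by linarith)
      exact ⟨this.trans hsub, hinj.mono this⟩)
  let W₂ : Set Coord := W₁ ∩ ((fun p : Coord => (|p 1| - δ (transverse p) / 2,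
    dist (transverse (Ψ p)) (transverse p) - δ (transverse p) / 4)) ⁻¹' (Iio 0 ×ˢ Iio 0))
  have hδc' : ContinuousOn (fun p => δ (transverse p)) W₁ :=
    hδc.comp continuous_transverse.continuousOn fun p hp => hWV hp.1
  have hW₂ : IsOpen W₂ := by
    refine ContinuousOn.isOpen_inter_preimage ?_ hW₁ (isOpen_Iio.prod isOpen_Iio)
    refine ContinuousOn.prodMk ?_ ?_
    · exact (by fun_prop : ContinuousOn (fun p : Coord => |p 1|) W₁).sub (hδc'.div_const 2)
    · exact (continuous_dist.comp_continuousOn ((continuous_transverse.comp_continuousOn hc₁).prodMk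
        continuous_transverse.continuousOn)).sub (hδc'.div_const 4)
  have htr : ∀ p ∈ W₁, dist (transverse (Ψ (p + P • basisVec 0))) (transverse p) =
      dist (transverse (Ψ p)) (transverse p) := by
    intro p hp
    rw [hΨ p hp.1, transverse_add_smul_zero]
  have h₂ : ∀ p, p + P • basisVec 0 ∈ W₂ ↔ p ∈ W₂ := by
    intro p
    constructor
    · rintro ⟨hp, hp1⟩
      have hp' := (h₁ p).1 hp
      refine ⟨hp', ?_⟩
      simpa only [mem_preimage, transverse_add_smul_zero, add_smul_zero_one, htr p hp'] using hp1
    · rintro ⟨hp, hp1⟩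
      refine ⟨(h₁ p).2 hp, ?_⟩
      simpa only [mem_preimage, transverse_add_smul_zero, add_smul_zero_one, htr p hp] using hp1
  have h0₂ : ∀ p : Coord, transverse p ∈ V → p 1 = 0 → p ∈ W₂ := by
    intro p hp hp1
    refine ⟨h0₁ p hp hp1, ?_⟩
    have := hδ _ hp
    simp [hp1, hΨ0 p hp hp1, this]
  obtain ⟨ε, hεc, hε, hεW⟩ := exists_continuous_radius (V := V)
    (Good := fun x ρ => ∀ p : Coord, transverse p = x → |p 1| < ρ → p ∈ W₂)
    (fun x ρ ρ' hρ _ hle p hp hp1 => hρ p hp (hp1.trans_le hle))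
    (fun x hx => by
      obtain ⟨ρ, hρ, hsub⟩ := exists_region_subset hP hW₂ h₂ h0₂ hx
      refine ⟨ρ, hρ, ?_⟩
      filter_upwards [Metric.ball_mem_nhds x hρ] with y hy p hp hp1
      exact hsub ⟨hp ▸ hy, hp1⟩)
  have hsub : region V ε ⊆ W₂ := fun p hp => hεW _ hp.1 p rfl hp.2
  refine ⟨ε, hεc, hε, fun p hp => (hsub hp).1.1, ?_⟩
  have key : ∀ p ∈ region V ε, ∀ q ∈ region V ε, Ψ p = Ψ q →
      δ (transverse q) ≤ δ (transverse p) → p = q := by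
    intro p hp q hq hpq hle
    obtain ⟨-, hp1, hp2⟩ := hsub hp
    obtain ⟨-, hq1, hq2⟩ := hsub hq
    simp only [mem_Iio] at hp1 hp2 hq1 hq2
    rw [hpq] at hp2
    have h3 := dist_triangle_left (transverse q) (transverse p) (transverse (Ψ q))
    have h4 := hδ _ hp.1
    refine (hgood _ hp.1).2 ⟨Metric.mem_ball_self h4, by linarith⟩ ⟨?_, by linarith⟩ hpq
    rw [Metric.mem_ball]
    linarith
  intro p hp q hq hpq
  rcases le_total (δ (transverse q)) (δ (transverse p)) with hle | hle
  · exact key p hp q hq hpq hle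
  · exact (key q hq p hp hpq.symm hle).symm

end InjectiveNeighborhood

/-! ### The chart adapted to the parameter -/

section NullGeodesicChart

variable {F : NullForm} {P δ σ : ℝ} {V : Set (Fin 2 → ℝ)} {U : Coord → ℝ}

lemma hamVec_horizon_one {y ξ : Coord} (hy : y 1 = 0) : (F.hamVec (y, ξ)).1 1 = ξ 0 := by
  simp [NullForm.hamVec, NullForm.inv, Fin.sum_univ_four, hy]

lemma hamiltonian_nullCovector {p : Coord} (hp1 : p 1 = 0) (hU0 : pd 0 U p ≠ 0) :
    F.hamiltonian (p, F.nullCovector U p) = 0 := by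
  simp [NullForm.hamiltonian, NullForm.nullCovector, NullForm.inv, Fin.sum_univ_four,
    Fin.sum_univ_two, hp1]
  field_simp
  ring

lemma pd_apply {G : Coord → Coord} {p : Coord} (hG : DifferentiableAt ℝ G p) (b i : Fin 4) :
    pd b (fun y => G y i) p = fderiv ℝ G p (basisVec b) i := by
  rw [pd, fderiv_apply hG]
  rfl

/-- A map that fixes the horizon and moves points off it in the direction of `r` is a local
diffeomorphism there. -/
lemma exists_equiv_of_horizon {R : Set Coord} (hR : IsOpen R) {Ψ : Coord → Coord} {p : Coord}
    (hp : p ∈ R) (hp1 : p 1 = 0) (hΨ : DifferentiableAt ℝ Ψ p)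
    (hΨ0 : ∀ y ∈ R, y 1 = 0 → Ψ y = y) (h1 : fderiv ℝ Ψ p (basisVec 1) 1 ≠ 0) :
    ∃ A : Coord ≃L[ℝ] Coord, (A : Coord →L[ℝ] Coord) = fderiv ℝ Ψ p := by
  refine exists_equiv_of_injective _ fun v hv => ?_
  have hb : ∀ b ≠ 1, fderiv ℝ Ψ p (basisVec b) = basisVec b := by
    intro b hb
    ext i
    rw [← pd_apply hΨ, basisVec_apply, ← pd_coord i (p := p)]
    refine pd_congr_horizon (differentiableAt_pi.1 hΨ i) (by fun_prop) hb hp1 ?_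
    filter_upwards [hR.mem_nhds hp] with y hy hy1
    rw [hΨ0 y hy hy1]
  rw [coord_eq_sum v, map_sum] at hv
  simp only [map_smul, Fin.sum_univ_four, hb 0 (by decide), hb 2 (by decide),
    hb 3 (by decide)] at hv
  have hc := fun i => congrFun hv i
  have h2 : v 1 = 0 := by
    have := hc 1
    simp [basisVec_apply] at this
    tauto
  ext i
  have := hc i
  fin_cases i <;> simp [basisVec_apply, h2] at this ⊢ <;> assumption

/-- The width `ε` is glued from local ones by a partition of unity on `V`, hence is only continuous
and may tend to `0` at the boundary of `V`. -/
lemma exists_null_region (hF : F.IsAdmissible P (region V fun _ => δ)) (hδ : 0 < δ)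
    (hV : IsOpen V) (hU : ContDiffOn ℝ ∞ U (cylinder V)) (hU0 : ∀ p ∈ cylinder V, pd 0 U p ≠ 0)
    (hP : 0 < P) (hUP : ∀ p ∈ cylinder V, U (p + P • basisVec 0) = U p + σ * P) :
    ∃ ε : (Fin 2 → ℝ) → ℝ, ContinuousOn ε V ∧ (∀ x ∈ V, 0 < ε x) ∧
      region V ε ⊆ F.nullFlowDomain U V δ ∧
      InjOn (fun p => (F.nullFlow U V δ p).1) (region V ε) ∧
      ∀ p ∈ region V ε, ∃ A : Coord ≃L[ℝ] Coord,
        (A : Coord →L[ℝ] Coord) = fderiv ℝ (fun p => (F.nullFlow U V δ p).1) p := by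
  set D := F.nullFlowDomain U V δ with hDdef
  set Ψ : Coord → Coord := fun p => (F.nullFlow U V δ p).1 with hΨdef
  have hD : IsOpen D := isOpen_nullFlowDomain hF hδ hV hU hU0
  have hΨs : ContDiffOn ℝ ∞ Ψ D := (contDiffOn_nullFlow hF hδ hV hU hU0).fst
  have hΨd : ∀ p ∈ D, DifferentiableAt ℝ Ψ p := fun p hp =>
    (hΨs.contDiffAt (hD.mem_nhds hp)).differentiableAt (by simp)
  have hDP : ∀ p, p + P • basisVec 0 ∈ D ↔ p ∈ D := fun p =>
    add_mem_nullFlowDomain hF hδ hV hU hUP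
  have hΨP : ∀ p ∈ D, Ψ (p + P • basisVec 0) = Ψ p + P • basisVec 0 := fun p hp => by
    simp only [hΨdef, nullFlow_add hF hδ hV hU hUP hp, Prod.fst_add]
  have hΨ0 : ∀ p, p ∈ cylinder V → p 1 = 0 → Ψ p = p := fun p hp hp1 => by
    simp only [hΨdef, nullFlow_horizon hF hδ hV hp hp1]
  have hDh : ∀ p, p ∈ cylinder V → p 1 = 0 → p ∈ D := fun p hp hp1 =>
    horizon_mem_nullFlowDomain hF hδ hV hp hp1
  let W : Set Coord := D ∩ fderiv ℝ Ψ ⁻¹' range ContinuousLinearEquiv.toContinuousLinearMap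
  have hW : IsOpen W := (hΨs.continuousOn_fderiv_of_isOpen hD (by simp)).isOpen_inter_preimage hD
    ContinuousLinearEquiv.isOpen
  have hfd : ∀ p ∈ D, fderiv ℝ Ψ (p + P • basisVec 0) = fderiv ℝ Ψ p := by
    intro p hp
    rw [← fderiv_comp_add_right]
    have : (fun y => Ψ (y + P • basisVec 0)) =ᶠ[𝓝 p] fun y => Ψ y + P • basisVec 0 := by
      filter_upwards [hD.mem_nhds hp] with y hy using hΨP y hy
    rw [this.fderiv_eq, fderiv_add_const]
  have hWh : ∀ p, p ∈ cylinder V → p 1 = 0 → p ∈ W := by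
    intro p hp hp1
    refine ⟨hDh p hp hp1, ?_⟩
    refine exists_equiv_of_horizon (cylinder_open hV) hp hp1 (hΨd p (hDh p hp hp1))
      (fun y hy hy1 => hΨ0 y hy hy1) ?_
    have h1 := ((contDiffOn_nullFlow hF hδ hV hU hU0).contDiffAt
      (hD.mem_nhds (hDh p hp hp1))).differentiableAt (by simp)
    have h2 : fderiv ℝ Ψ p (basisVec 1) = (fderiv ℝ (F.nullFlow U V δ) p (basisVec 1)).1 := by
      rw [hΨdef, fderiv.fst h1]
      rfl
    rw [h2, fderiv_nullFlow_one hF hδ hV hU hU0 (hDh p hp hp1),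
      nullFlow_horizon hF hδ hV hp hp1, hamVec_horizon_one hp1]
    exact hU0 p hp
  obtain ⟨ε, hεc, hε, hsub, hinj⟩ := exists_injective_region (V := V) (W := W) (Ψ := Ψ) hP hW
    (fun p => by
      constructor
      · rintro ⟨hp, hA⟩
        have hp' := (hDP p).1 hp
        exact ⟨hp', by rwa [mem_preimage, hfd p hp'] at hA⟩
      · rintro ⟨hp, hA⟩
        exact ⟨(hDP p).2 hp, by rwa [mem_preimage, hfd p hp]⟩)
    (fun p hp => hp.1.1) hWh (hΨs.continuousOn.mono inter_subset_left)
    (fun p hp => hΨP p hp.1) hΨ0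
    (fun p hp hp1 => by
      obtain ⟨e, hpe, -, hef, -⟩ := exists_local_smooth_inverse hD hΨs (hDh p hp hp1)
        (hWh p hp hp1).2
      exact ⟨e.source, e.open_source.mem_nhds hpe, hef ▸ e.injOn⟩)
  exact ⟨ε, hεc, hε, hsub.trans inter_subset_left, hinj, fun p hp => (hsub hp).2⟩

/-- The lines of `r` are null geodesics, orthogonal to the level sets of `U`. -/
lemma scalarProd_nullFlow (hF : F.IsAdmissible P (region V fun _ => δ)) (hδ : 0 < δ)
    (hV : IsOpen V) (hU : ContDiffOn ℝ ∞ U (cylinder V)) (hU0 : ∀ p ∈ cylinder V, pd 0 U p ≠ 0)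
    (hUr : IndepR V U) {ε : (Fin 2 → ℝ) → ℝ} (hε : ContinuousOn ε V)
    (hsub : region V ε ⊆ F.nullFlowDomain U V δ) {p : Coord} (hp : p ∈ region V ε) (w : Coord) :
    scalarProd F.metric (F.nullFlow U V δ p).1
      (fderiv ℝ (fun p => (F.nullFlow U V δ p).1) p (basisVec 1))
      (fderiv ℝ (fun p => (F.nullFlow U V δ p).1) p w) = fderiv ℝ U p w := by
  set Z := F.nullFlow U V δ with hZdef
  have hR := isOpen_region hV hε
  have hΩ := isOpen_region hV (continuousOn_const (c := δ))
  have hcyl : region V ε ⊆ cylinder V := fun p hp => hp.1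
  have hZ : ContDiffOn ℝ ∞ Z (region V ε) := (contDiffOn_nullFlow hF hδ hV hU hU0).mono hsub
  have hZd : ∀ p ∈ region V ε, DifferentiableAt ℝ Z p := fun p hp =>
    (hZ.contDiffAt (hR.mem_nhds hp)).differentiableAt (by simp)
  have hmem : ∀ p ∈ region V ε, (Z p).1 ∈ region V fun _ => δ := fun p hp =>
    nullFlow_mem hF hV (hsub hp)
  have h1 : ∀ p ∈ region V ε, fderiv ℝ Z p (basisVec 1) = F.hamVec (Z p) := fun p hp =>
    fderiv_nullFlow_one hF hδ hV hU hU0 (hsub hp)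
  have hfst : ∀ p ∈ region V ε, ∀ v, fderiv ℝ (fun p => (Z p).1) p v = (fderiv ℝ Z p v).1 :=
    fun p hp v => by rw [fderiv.fst (hZd p hp)]; rfl
  have hsnd : ∀ p ∈ region V ε, ∀ v, fderiv ℝ (fun p => (Z p).2) p v = (fderiv ℝ Z p v).2 :=
    fun p hp v => by rw [fderiv.snd (hZd p hp)]; rfl
  have hXs : ContDiffOn ℝ ∞ (fun p => F.hamVec (Z p)) (region V ε) :=
    (contDiffOn_hamVec hF hΩ).comp hZ fun p hp => ⟨hmem p hp, mem_univ _⟩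
  have hhom := fun p => two_mul_hamiltonian (F := F) (Z p)
  have hKs : ContDiffOn ℝ ∞ (fun p => F.hamiltonian (Z p)) (region V ε) := by
    have : ContDiffOn ℝ ∞ (fun p => (1 / 2 : ℝ) * ∑ i, (Z p).2 i * (F.hamVec (Z p)).1 i)
        (region V ε) :=
      contDiffOn_const.mul (ContDiffOn.sum fun i _ =>
        (contDiffOn_pi.1 hZ.snd i).mul (contDiffOn_pi.1 hXs.fst i))
    refine this.congr fun p _ => ?_
    rw [← hhom p]; ring
  have key := canonical_form_eq hR (Y := fun i p => (Z p).1 i) (M := fun i p => (Z p).2 i)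
    (a := fun i p => (F.hamVec (Z p)).1 i) (c := fun i p => (F.hamVec (Z p)).2 i)
    (K := fun p => F.hamiltonian (Z p)) (U := U)
    (fun i => contDiffOn_pi.1 hZ.fst i) (fun i => contDiffOn_pi.1 hZ.snd i)
    (fun i => contDiffOn_pi.1 hXs.fst i) hKs hUr (hU.mono hcyl)
    (fun p hp i => by rw [pd_apply (hZd p hp).fst, hfst p hp, h1 p hp])
    (fun p hp i => by rw [pd_apply (hZd p hp).snd, hsnd p hp, h1 p hp])
    (fun p hp b => pd_hamiltonian hF hΩ (hZd p hp) (hmem p hp) b)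
    (fun p hp => hhom p)
    (fun p hp hp1 => by
      simp only [hZdef, nullFlow_horizon hF hδ hV (hcyl hp) hp1]
      exact hamiltonian_nullCovector hp1 (hU0 p (hcyl hp)))
    (fun p hp hp1 i => by simp only [hZdef, nullFlow_horizon hF hδ hV (hcyl hp) hp1])
    (fun p hp hp1 b hb => by
      simp only [hZdef, nullFlow_horizon hF hδ hV (hcyl hp) hp1, NullForm.nullCovector]
      fin_cases b <;> simp at hb ⊢)
    p hp
  have hq := hF.neg_def _ (hmem p hp)
  rw [scalarProd_comm (fun i j => metric_symm hq i j), scalarProd, hfst p hp w, hfst p hp (basisVec 1), h1 p hp,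
    metric_mulVec_hamVec hq, fderiv_apply_eq_sum]
  have h4 : ∀ i, (fderiv ℝ Z p w).1 i = ∑ b, w b * pd b (fun y => (Z y).1 i) p := by
    intro i
    rw [← hfst p hp, ← fderiv_apply_eq_sum, fderiv_apply (hZd p hp).fst]
    rfl
  simp only [dotProduct, h4, Finset.sum_mul]
  rw [Finset.sum_comm]
  refine Finset.sum_congr rfl fun b _ => ?_
  rw [← key b, Finset.mul_sum]
  exact Finset.sum_congr rfl fun i _ => by ring

end NullGeodesicChart

section AdaptedChart

variable {N : ElementaryNeighborhood} {s : ℤˣ} {U : Coord → ℝ}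

lemma apply_add_unit_smul {P : ℝ} {V : Set (Fin 2 → ℝ)}
    (hUP : ∀ p ∈ cylinder V, U (p + P • basisVec 0) = U p + (s : ℤ) * P) {p : Coord}
    (hp : p ∈ cylinder V) : U (p + ((s : ℤ) * P) • basisVec 0) = U p + P := by
  rcases Int.units_eq_one_or s with rfl | rfl
  · simpa using hUP p hp
  · have := hUP _ (add_mem_cylinder (t := -P) hp)
    rw [add_assoc, ← add_smul, neg_add_cancel, zero_smul, add_zero] at this
    simp at this ⊢
    linarith

/-- The coordinates in which `∂/∂r` is the null geodesic field off the horizon with `g(∂/∂r, ·)`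
equal to `dU`, and in which `U` replaces `u`. -/
theorem exists_adapted_chart (hU : ContDiffOn ℝ ∞ U (cylinder N.V)) (hUr : IndepR N.V U)
    (hUP : ∀ p ∈ cylinder N.V, U (p + N.P • basisVec 0) = U p + (s : ℤ) * N.P)
    (hU' : ∀ p ∈ cylinder N.V, 0 < ((s : ℤ) : ℝ) * pd 0 U p) :
    ∃ (ε : (Fin 2 → ℝ) → ℝ) (e : OpenPartialHomeomorph Coord Coord),
      ContinuousOn ε N.V ∧ (∀ x ∈ N.V, 0 < ε x) ∧ e.source = region N.V ε ∧
      e.target ⊆ N.domain ∧ N.horizon ⊆ e.target ∧ ContDiffOn ℝ ∞ e e.source ∧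
      ContDiffOn ℝ ∞ e.symm e.target ∧
      (∀ p ∈ region N.V ε, e p 1 = 0 ↔ p 1 = 0) ∧
      (∀ p ∈ region N.V ε, p 1 = 0 → ∀ i ≠ 0, e p i = p i) ∧
      (∀ p ∈ region N.V ε, p 1 = 0 → U (e p) = p 0) ∧
      (∀ p ∈ region N.V ε, ∀ w, scalarProd N.metric (e p) (fderiv ℝ e p (basisVec 1))
        (fderiv ℝ e p w) = w 0) ∧
      (∀ p ∈ region N.V ε,
        e (p + N.P • basisVec 0) = e p + (((s : ℤ) : ℝ) * N.P) • basisVec 0) ∧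
      ∀ p ∈ region N.V ε, ∀ v, fderiv ℝ e p v = 0 → v = 0 := by
  have hV := N.V_open
  have hP := N.P_pos
  have hδ := N.ε_pos
  have hF := N.admissible
  have hσ : ((s : ℤ) : ℝ) * (s : ℤ) = 1 := by
    rcases Int.units_eq_one_or s with rfl | rfl <;> simp
  have hU0 : ∀ p ∈ cylinder N.V, pd 0 U p ≠ 0 := fun p hp h => by
    simpa [h] using hU' p hp
  obtain ⟨χ, hχs, hχt, hχ, hχsymm⟩ := exists_generator_coordinate hV hP hσ hU hUP hU'
  obtain ⟨ε, hεc, hε, hsub, hinj, hA⟩ := exists_null_region hF hδ hV hU hU0 hP hUP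
  set Ψ : Coord → Coord := fun p => (N.form.nullFlow U N.V N.ε p).1 with hΨdef
  have hR := isOpen_region hV hεc
  have hΨs : ContDiffOn ℝ ∞ Ψ (region N.V ε) :=
    ((contDiffOn_nullFlow hF hδ hV hU hU0).mono hsub).fst
  have hΨd : ∀ p ∈ region N.V ε, DifferentiableAt ℝ Ψ p := fun p hp =>
    (hΨs.contDiffAt (hR.mem_nhds hp)).differentiableAt (by simp)
  have hΨ0 : ∀ p, p ∈ cylinder N.V → p 1 = 0 → Ψ p = p := fun p hp hp1 => by
    simp only [hΨdef, nullFlow_horizon hF hδ hV hp hp1]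
  obtain ⟨ψ, hψs, hψ, hψsymm⟩ := exists_smooth_inverse_of_injOn hR hΨs hinj hA
  let φ : Coord → Coord := χ.symm
  have hφmem : ∀ p ∈ cylinder N.V, φ p ∈ cylinder N.V := fun p hp => by
    rw [← hχs]; exact χ.map_target (hχt ▸ hp)
  have hχφ : ∀ p ∈ cylinder N.V, replaceU U (φ p) = p := fun p hp => by
    rw [← hχ]; exact χ.right_inv (hχt ▸ hp)
  have hφχ : ∀ p ∈ cylinder N.V, φ (replaceU U p) = p := fun p hp => by
    rw [← hχ]; exact χ.left_inv (hχs ▸ hp)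
  have hφi : ∀ p ∈ cylinder N.V, ∀ i ≠ 0, φ p i = p i := fun p hp i hi => by
    rw [← replaceU_of_ne (U := U) (φ p) hi, hχφ p hp]
  have hφ0 : ∀ p ∈ cylinder N.V, U (φ p) = p 0 := fun p hp => by
    rw [← replaceU_zero (U := U) (φ p), hχφ p hp]
  have hφreg : ∀ p ∈ cylinder N.V, φ p ∈ region N.V ε ↔ p ∈ region N.V ε := by
    intro p hp
    have ht : transverse (φ p) = transverse p := by
      simp [transverse, hφi p hp 2 (by decide), hφi p hp 3 (by decide)]
    simp only [region, mem_ofPred_eq, ht, hφi p hp 1 (by decide)]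
  let e := χ.symm.trans ψ
  have hecoe : (e : Coord → Coord) = Ψ ∘ φ := by
    rw [← hψ]; rfl
  have hes : e.source = region N.V ε := by
    ext p
    rw [OpenPartialHomeomorph.trans_source, OpenPartialHomeomorph.symm_source, hχt, hψs]
    exact ⟨fun h => (hφreg p h.1).1 h.2, fun h => ⟨h.1, (hφreg p h.1).2 h⟩⟩
  have hcyl : region N.V ε ⊆ cylinder N.V := fun p hp => hp.1
  have hφs : ContDiffOn ℝ ∞ φ (cylinder N.V) := hχsymm
  have hO := cylinder_open hV
  have hφd : ∀ p ∈ cylinder N.V, DifferentiableAt ℝ φ p := fun p hp =>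
    (hφs.contDiffAt (hO.mem_nhds hp)).differentiableAt (by simp)
  have hUd : ∀ p ∈ cylinder N.V, DifferentiableAt ℝ U p := fun p hp =>
    differentiableAt_of_contDiffOn hO hU (by simp) hp
  have hes' : ContDiffOn ℝ ∞ e (region N.V ε) := by
    rw [hecoe]
    exact hΨs.comp (hφs.mono hcyl) fun p hp => (hφreg p (hcyl hp)).2 hp
  have hfd : ∀ p ∈ region N.V ε, ∀ v,
      fderiv ℝ e p v = fderiv ℝ Ψ (φ p) (fderiv ℝ φ p v) := by
    intro p hp v
    rw [hecoe, fderiv_comp p (hΨd _ ((hφreg p (hcyl hp)).2 hp)) (hφd p (hcyl hp))]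
    rfl
  have hdU : ∀ p ∈ cylinder N.V, ∀ v, fderiv ℝ U (φ p) (fderiv ℝ φ p v) = v 0 := by
    intro p hp v
    have h1 : fderiv ℝ (fun y => U (φ y)) p = (fderiv ℝ U (φ p)).comp (fderiv ℝ φ p) :=
      fderiv_comp p (hUd _ (hφmem p hp)) (hφd p hp)
    have h2 : (fun y => U (φ y)) =ᶠ[𝓝 p] fun y => y 0 := by
      filter_upwards [hO.mem_nhds hp] with y hy using hφ0 y hy
    rw [← ContinuousLinearMap.comp_apply, ← h1, h2.fderiv_eq, (hasFDerivAt_apply 0 p).fderiv]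
    rfl
  have hinvd : ∀ p ∈ cylinder N.V, ∀ v, fderiv ℝ (replaceU U) (φ p) (fderiv ℝ φ p v) = v := by
    intro p hp v
    have h1 : fderiv ℝ (fun y => replaceU U (φ y)) p =
        (fderiv ℝ (replaceU U) (φ p)).comp (fderiv ℝ φ p) :=
      fderiv_comp p (hasFDerivAt_replaceU (hUd _ (hφmem p hp))).differentiableAt (hφd p hp)
    have h2 : (fun y => replaceU U (φ y)) =ᶠ[𝓝 p] id := by
      filter_upwards [hO.mem_nhds hp] with y hy using hχφ y hy
    rw [← ContinuousLinearMap.comp_apply, ← h1, h2.fderiv_eq, fderiv_id]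
    rfl
  have hφ1 : ∀ p ∈ cylinder N.V, fderiv ℝ φ p (basisVec 1) = basisVec 1 := by
    intro p hp
    have hq := hφmem p hp
    have h1 : fderiv ℝ (fun y => φ (replaceU U y)) (φ p) =
        (fderiv ℝ φ (replaceU U (φ p))).comp (fderiv ℝ (replaceU U) (φ p)) :=
      fderiv_comp (φ p) (by rw [hχφ p hp]; exact hφd p hp)
        (hasFDerivAt_replaceU (hUd _ hq)).differentiableAt
    have h2 : (fun y => φ (replaceU U y)) =ᶠ[𝓝 (φ p)] id := by
      filter_upwards [hO.mem_nhds hq] with y hy using hφχ y hy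
    have h3 : fderiv ℝ (replaceU U) (φ p) (basisVec 1) = basisVec 1 := by
      have h4 : fderiv ℝ U (φ p) (basisVec 1) = 0 := hUr.pd_one hq
      rw [(hasFDerivAt_replaceU (hUd _ hq)).fderiv]
      simp [h4, basisVec_apply 1 0]
    rw [h2.fderiv_eq, fderiv_id, hχφ p hp] at h1
    have h5 := congrArg (fun A : Coord →L[ℝ] Coord => A (basisVec 1)) h1
    simp only [ContinuousLinearMap.comp_apply, h3, ContinuousLinearMap.id_apply] at h5
    exact h5.symm
  have hhor : ∀ p ∈ region N.V ε, p 1 = 0 → e p = φ p := by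
    intro p hp hp1
    rw [hecoe, Function.comp_apply, hΨ0 _ (hφmem p (hcyl hp))]
    rw [hφi p (hcyl hp) 1 (by decide), hp1]
  have hhsub : ∀ y ∈ N.horizon, ∃ p ∈ region N.V ε, p 1 = 0 ∧ e p = y := by
    rintro y ⟨hy, hy1⟩
    have hyc : y ∈ cylinder N.V := hy.1
    have hyr : replaceU U y ∈ cylinder N.V := by
      rw [← hχt, ← hχ]; exact χ.map_source (hχs ▸ hyc)
    have hyR : y ∈ region N.V ε := ⟨hyc, by rw [hy1, abs_zero]; exact hε _ hyc⟩
    have h1 : replaceU U y 1 = 0 := by rw [replaceU_of_ne _ (by decide), hy1]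
    have h2 : replaceU U y ∈ region N.V ε := by
      rw [← hφreg _ hyr, hφχ y hyc]; exact hyR
    exact ⟨_, h2, h1, by rw [hhor _ h2 h1, hφχ y hyc]⟩
  have hedom : ∀ p ∈ region N.V ε, e p ∈ N.domain := fun p hp => by
    rw [hecoe]
    exact nullFlow_mem hF hV (hsub ((hφreg p (hcyl hp)).2 hp))
  have hinjd : ∀ p ∈ region N.V ε, ∀ v, fderiv ℝ e p v = 0 → v = 0 := by
    intro p hp v hv
    obtain ⟨A, hA'⟩ := hA _ ((hφreg p (hcyl hp)).2 hp)
    rw [hfd p hp, ← hA'] at hv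
    have h1 : fderiv ℝ φ p v = 0 := A.map_eq_zero_iff.1 hv
    rw [← hinvd p (hcyl hp) v, h1, map_zero]
  refine ⟨ε, e, hεc, hε, hes, ?_, ?_, hes ▸ hes', ?_, ?_, ?_, ?_, ?_, ?_, ?_⟩
  · intro y hy
    have hx := e.map_target hy
    rw [← e.right_inv hy]
    exact hedom _ (hes ▸ hx)
  · intro y hy
    obtain ⟨p, hp, -, rfl⟩ := hhsub y hy
    exact e.map_source (hes ▸ hp)
  · refine contDiffOn_symm_of_fderiv (hes ▸ hes') fun p hp => ?_
    rw [hes] at hp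
    refine exists_equiv_of_injective _ fun v hv => ?_
    exact hinjd p hp v hv
  · intro p hp
    refine ⟨fun h => ?_, fun h => ?_⟩
    · obtain ⟨p', hp', hp1', he⟩ := hhsub (e p) ⟨hedom p hp, h⟩
      rwa [e.injOn (hes ▸ hp') (hes ▸ hp) he] at hp1'
    · rw [hhor p hp h, hφi p (hcyl hp) 1 (by decide), h]
  · intro p hp hp1 i hi
    rw [hhor p hp hp1, hφi p (hcyl hp) i hi]
  · intro p hp hp1
    rw [hhor p hp hp1, hφ0 p (hcyl hp)]
  · intro p hp w
    rw [hfd p hp, hfd p hp, hφ1 p (hcyl hp), ← hdU p (hcyl hp) w, hecoe]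
    exact scalarProd_nullFlow hF hδ hV hU hU0 hUr hεc hsub ((hφreg p (hcyl hp)).2 hp) _
  · intro p hp
    have hq := hφmem p (hcyl hp)
    have h1 : φ (p + N.P • basisVec 0) = φ p + (((s : ℤ) : ℝ) * N.P) • basisVec 0 := by
      have h2 := hφχ _ (add_mem_cylinder (t := ((s : ℤ) : ℝ) * N.P) hq)
      rw [← h2]
      congr 1
      ext i
      by_cases hi : i = 0
      · subst hi
        rw [replaceU_zero, apply_add_unit_smul hUP hq, hφ0 p (hcyl hp)]
        simp [basisVec_apply]
      · rw [replaceU_of_ne _ hi]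
        simp [basisVec_apply, hi, hφi p (hcyl hp) i hi]
    rw [hecoe, Function.comp_apply, h1]
    exact apply_add_int_smul (Ψ := Ψ) (fun p => add_mem_nullFlowDomain hF hδ hV hU hUP)
      (fun p hp => by simp only [hΨdef, nullFlow_add hF hδ hV hU hUP hp, Prod.fst_add]) _
      (hsub ((hφreg p (hcyl hp)).2 hp))
  · exact hinjd

end AdaptedChart

/-! ### Signature, division by `r`, and pullbacks of the metric -/

section Signature

variable {F : NullForm} {y : Coord}

lemma scalarProd_metric (L w : Coord) : scalarProd F.metric y L w =
    L 0 * (w 1 + y 1 * F.f y * w 0 / 2 + y 1 * (F.h y 0 * w 2 + F.h y 1 * w 3)) +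
    w 0 * (L 1 + y 1 * F.f y * L 0 / 2 + y 1 * (F.h y 0 * L 2 + F.h y 1 * L 3)) +
    ![L 2, L 3] ⬝ᵥ (F.q y *ᵥ ![w 2, w 3]) := by
  simp [scalarProd_eq_sum, NullForm.metric, Fin.sum_univ_four, dotProduct, Matrix.mulVec,
    Fin.sum_univ_two]
  ring

/-- In signature `(+,-,-,-)` a vector orthogonal to a null vector and not proportional to it is
spacelike. -/
lemma scalarProd_neg_of_orthogonal (hq : (-F.q y).PosDef) {L w : Coord} (hL : L ≠ 0)
    (hLL : scalarProd F.metric y L L = 0) (hLw : scalarProd F.metric y L w = 0)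
    (hw : ∀ c : ℝ, w ≠ c • L) : scalarProd F.metric y w w < 0 := by
  have hsymm := scalarProd_comm (fun i j => metric_symm hq i j)
  -- subtracting a multiple of the null vector does not change the square
  have key : ∀ w : Coord, scalarProd F.metric y L w = 0 → w 0 = 0 → (∀ c : ℝ, w ≠ c • L) →
      scalarProd F.metric y w w < 0 := by
    intro w hLw hw0 hw
    by_contra hneg
    rw [not_lt, scalarProd_metric, hw0] at hneg
    have h1 := neg_of_neg_posDef hq (w := ![w 2, w 3]) (by linarith)
    have h2 : w 2 = 0 := congrFun h1 0
    have h3 : w 3 = 0 := congrFun h1 1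
    rw [scalarProd_metric, h1, hw0, h2, h3] at hLw
    simp only [Matrix.mulVec_zero, dotProduct_zero] at hLw
    have h4 : L 0 * w 1 = 0 := by linarith
    rcases mul_eq_zero.1 h4 with h5 | h5
    · rw [scalarProd_metric, h5] at hLL
      have h6 := neg_of_neg_posDef hq (w := ![L 2, L 3]) (by linarith)
      have h7 : L 2 = 0 := congrFun h6 0
      have h8 : L 3 = 0 := congrFun h6 1
      have h9 : L 1 ≠ 0 := fun h9 => hL (by ext i; fin_cases i <;> simp [h5, h7, h8, h9])
      refine hw (w 1 / L 1) ?_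
      ext i
      fin_cases i <;> simp [h5, h7, h8, h9, hw0, h2, h3]
    · exact hw 0 (by ext i; fin_cases i <;> simp [hw0, h2, h3, h5])
  by_cases h0 : L 0 = 0
  · have h1 := hLL
    rw [scalarProd_metric, h0] at h1
    have h6 := neg_of_neg_posDef hq (w := ![L 2, L 3]) (by linarith)
    have h7 : L 2 = 0 := congrFun h6 0
    have h8 : L 3 = 0 := congrFun h6 1
    have h9 : L 1 ≠ 0 := fun h9 => hL (by ext i; fin_cases i <;> simp [h0, h7, h8, h9])
    refine key w hLw ?_ hw
    have h10 := hLw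
    rw [scalarProd_metric, h6, h0, h7, h8] at h10
    simp only [zero_dotProduct] at h10
    have h11 : w 0 * L 1 = 0 := by linarith
    exact (mul_eq_zero.1 h11).resolve_right h9
  · have h1 := key (w + (-(w 0 / L 0)) • L)
      (by rw [scalarProd_add_right, scalarProd_smul_right, hLL, hLw]; ring)
      (by simp [h0])
      (fun c hc => hw (c + w 0 / L 0) (by
        rw [add_smul, ← hc, add_assoc, ← add_smul]; simp))
    rw [scalarProd_add_right, scalarProd_add_left, scalarProd_add_left, scalarProd_smul_left,
      scalarProd_smul_right, scalarProd_smul_left, scalarProd_smul_right, hLL, hsymm w L, hLw] at h1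
    linarith

end Signature

section Hadamard

variable {V : Set (Fin 2 → ℝ)} {ε : (Fin 2 → ℝ) → ℝ} {G : Coord → ℝ} {p : Coord}

/-- The smooth extension of `G / r` to `r = 0`, for a function `G` that vanishes there. -/
noncomputable def rQuotient (G : Coord → ℝ) (p : Coord) : ℝ :=
  ∫ t in (0 : ℝ)..1, pd 1 G (toHorizon p + (t * p 1) • basisVec 1)

lemma scaled_line_mem (hp : p ∈ region V ε) {t : ℝ} (ht : t ∈ Icc (0 : ℝ) 1) :
    toHorizon p + (t * p 1) • basisVec 1 ∈ region V ε := by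
  refine toHorizon_line_mem hp ?_
  rw [abs_mul, abs_of_nonneg ht.1]
  exact (mul_le_of_le_one_left (abs_nonneg _) ht.2).trans_lt hp.2

lemma contDiffOn_rQuotient (hR : IsOpen (region V ε)) (hG : ContDiffOn ℝ ∞ G (region V ε)) :
    ContDiffOn ℝ ∞ (rQuotient G) (region V ε) := by
  have hj : ContDiff ℝ ∞ fun x : Coord × ℝ => toHorizon x.1 + (x.2 * x.1 1) • basisVec 1 := by
    have h1 : ContDiff ℝ ∞ fun x : Coord × ℝ => x.1 1 :=
      (contDiff_apply ℝ ℝ (1 : Fin 4)).comp contDiff_fst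
    exact (toHorizon.contDiff.comp contDiff_fst).add ((contDiff_snd.mul h1).smul contDiff_const)
  exact contDiffOn_integral_param (hR.preimage hj.continuous)
    ((contDiffOn_pd hR hG 1).comp hj.contDiffOn fun x hx => hx)
    fun x hx t ht => scaled_line_mem hx ht

lemma r_mul_rQuotient (hR : IsOpen (region V ε)) (hG : ContDiffOn ℝ ∞ G (region V ε))
    (hp : p ∈ region V ε) (h0 : G (toHorizon p) = 0) : p 1 * rQuotient G p = G p := by
  have hd : ∀ t ∈ Icc (0 : ℝ) 1, HasDerivAt (fun t => G (toHorizon p + (t * p 1) • basisVec 1))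
      (p 1 * pd 1 G (toHorizon p + (t * p 1) • basisVec 1)) t := by
    intro t ht
    exact HasDerivAt.scomp (g₁ := fun t => G (toHorizon p + t • basisVec 1)) t
      (hasDerivAt_line_one hR hG (scaled_line_mem hp ht)) (hasDerivAt_mul_const (p 1))
  have hc : ContinuousOn (fun t : ℝ => p 1 * pd 1 G (toHorizon p + (t * p 1) • basisVec 1))
      (uIcc 0 1) := by
    rw [uIcc_of_le zero_le_one]
    exact continuousOn_const.mul ((contDiffOn_pd hR hG 1).continuousOn.comp (by fun_prop)
      fun t ht => scaled_line_mem hp ht)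
  have h1 := intervalIntegral.integral_eq_sub_of_hasDerivAt
    (fun t ht => hd t (by rwa [uIcc_of_le zero_le_one] at ht)) hc.intervalIntegrable
  rw [intervalIntegral.integral_const_mul] at h1
  rw [rQuotient, h1]
  simp [toHorizon_add_smul_one, h0]

lemma rQuotient_horizon (hp1 : p 1 = 0) : rQuotient G p = pd 1 G p := by
  simp [rQuotient, hp1, toHorizon_eq_self hp1]

lemma rQuotient_add (hR : IsOpen (region V ε)) {t : ℝ}
    (hG : ∀ p ∈ region V ε, G (p + t • basisVec 0) = G p) (hp : p ∈ region V ε) :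
    rQuotient G (p + t • basisVec 0) = rQuotient G p := by
  refine intervalIntegral.integral_congr fun s hs => ?_
  rw [uIcc_of_le zero_le_one] at hs
  simp only [toHorizon_add, add_smul_zero_one]
  rw [add_right_comm, ← pd_shift]
  exact pd_congr_of_eqOn hR (scaled_line_mem hp hs) fun y hy => hG y hy

end Hadamard

section Pullback

variable {F : NullForm} {P : ℝ} {Ω R : Set Coord} {e : Coord → Coord} {p : Coord}

/-- The component `g(∂e/∂yᵃ, ∂e/∂yᵇ)` of the pullback of the metric `g` under `e`. -/
noncomputable def pullback (g : Coord → Matrix (Fin 4) (Fin 4) ℝ) (e : Coord → Coord)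
    (a b : Fin 4) (p : Coord) : ℝ :=
  scalarProd g (e p) (fderiv ℝ e p (basisVec a)) (fderiv ℝ e p (basisVec b))

lemma pullback_eq_sum (g : Coord → Matrix (Fin 4) (Fin 4) ℝ) (he : DifferentiableAt ℝ e p)
    (a b : Fin 4) : pullback g e a b p = ∑ i, ∑ j, pd a (fun y => e y i) p * g (e p) i j *
      pd b (fun y => e y j) p := by
  simp only [pullback, scalarProd_eq_sum, pd_apply he]

lemma scalarProd_fderiv (g : Coord → Matrix (Fin 4) (Fin 4) ℝ) (v w : Coord) :
    scalarProd g (e p) (fderiv ℝ e p v) (fderiv ℝ e p w) =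
      ∑ a, ∑ b, v a * pullback g e a b p * w b := by
  conv_lhs => rw [coord_eq_sum v, coord_eq_sum w]
  simp only [map_sum, map_smul, scalarProd, sum_dotProduct, Matrix.mulVec_sum, dotProduct_sum,
    smul_dotProduct, Matrix.mulVec_smul, dotProduct_smul, smul_eq_mul, pullback, Finset.mul_sum]
  rw [Finset.sum_comm]
  exact Finset.sum_congr rfl fun a _ => Finset.sum_congr rfl fun b _ => by ring

lemma contDiffOn_pullback (hF : F.IsAdmissible P Ω) (hR : IsOpen R) (he : ContDiffOn ℝ ∞ e R)
    (hm : MapsTo e R Ω) (a b : Fin 4) : ContDiffOn ℝ ∞ (pullback F.metric e a b) R := by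
  have hE : ∀ i a, ContDiffOn ℝ ∞ (fun p => pd a (fun y => e y i) p) R := fun i a =>
    contDiffOn_pd hR (contDiffOn_pi.1 he i) a
  have h : ContDiffOn ℝ ∞ (fun p => ∑ i, ∑ j, pd a (fun y => e y i) p * F.metric (e p) i j *
      pd b (fun y => e y j) p) R :=
    ContDiffOn.sum fun i _ => ContDiffOn.sum fun j _ =>
      ((hE i a).mul ((hF.contDiffOn_metric i j).comp he hm)).mul (hE j b)
  exact h.congr fun p hp =>
    pullback_eq_sum _ ((he.contDiffAt (hR.mem_nhds hp)).differentiableAt (by simp)) a b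

/-- The product rule for the components of the pullback. -/
lemma pd_pullback (hF : F.IsAdmissible P Ω) (hΩ : IsOpen Ω) (hR : IsOpen R)
    (he : ContDiffOn ℝ ∞ e R) (hm : MapsTo e R Ω) (hp : p ∈ R) (a b c : Fin 4) :
    pd c (pullback F.metric e a b) p =
      ∑ i, ∑ j, (∑ k, pd k (fun y => F.metric y i j) (e p) * pd c (fun y => e y k) p) *
        pd a (fun y => e y i) p * pd b (fun y => e y j) p +
      ∑ i, ∑ j, pd c (pd a fun y => e y i) p * F.metric (e p) i j * pd b (fun y => e y j) p +
      ∑ i, ∑ j, pd a (fun y => e y i) p * F.metric (e p) i j * pd c (pd b fun y => e y j) p := by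
  have hed : ∀ p ∈ R, DifferentiableAt ℝ e p := fun p hp =>
    (he.contDiffAt (hR.mem_nhds hp)).differentiableAt (by simp)
  have hE : ∀ i a, DifferentiableAt ℝ (pd a fun y => e y i) p := fun i a =>
    differentiableAt_of_contDiffOn hR (contDiffOn_pd hR (contDiffOn_pi.1 he i) a) (by simp) hp
  have hg : ∀ i j, DifferentiableAt ℝ (fun y => F.metric (e y) i j) p := fun i j =>
    differentiableAt_of_contDiffOn hR ((hF.contDiffOn_metric i j).comp he hm) (by simp) hp
  have hg' : ∀ i j, pd c (fun y => F.metric (e y) i j) p =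
      ∑ k, pd k (fun y => F.metric y i j) (e p) * pd c (fun y => e y k) p := fun i j =>
    pd_comp (G := fun y => F.metric y i j) c
      (differentiableAt_of_contDiffOn hΩ (hF.contDiffOn_metric i j) (by simp) (hm hp)) (hed p hp)
  have h1 : ∀ i j, DifferentiableAt ℝ (fun p => pd a (fun y => e y i) p * F.metric (e p) i j *
      pd b (fun y => e y j) p) p := fun i j => ((hE i a).fun_mul (hg i j)).fun_mul (hE j b)
  rw [pd_congr_of_eqOn hR hp fun y hy => pullback_eq_sum F.metric (hed y hy) a b,
    pd_sum _ fun i _ => DifferentiableAt.fun_sum fun j _ => h1 i j, ← Finset.sum_add_distrib,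
    ← Finset.sum_add_distrib]
  refine Finset.sum_congr rfl fun i _ => ?_
  rw [pd_sum _ fun j _ => h1 i j, ← Finset.sum_add_distrib, ← Finset.sum_add_distrib]
  refine Finset.sum_congr rfl fun j _ => ?_
  rw [pd_mul ((hE i a).fun_mul (hg i j)) (hE j b), pd_mul (hE i a) (hg i j), hg' i j]
  ring

/-- The transformation of `f` and `h_A` under a change of Gaussian null coordinates. The identity
`g(∂e/∂r, ∂e/∂yᵇ) = δᵇ_u` allows to express the `r`-derivatives by tangential ones. -/
theorem pd_one_pullback (hF : F.IsAdmissible P Ω) (hΩ : IsOpen Ω) (hR : IsOpen R)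
    (he : ContDiffOn ℝ ∞ e R) (hm : MapsTo e R Ω)
    (hq : ∀ y ∈ Ω, y 1 = 0 → ∀ A B, pd 0 (fun y => F.q y A B) y = 0)
    (hi : ∀ y ∈ R, y 1 = 0 → ∀ i ≠ 0, e y i = y i)
    (hL : ∀ y ∈ R, ∀ b, pullback F.metric e 1 b y = if b = 0 then 1 else 0)
    (hp : p ∈ R) (hp1 : p 1 = 0) {b : Fin 4} (hb : b ≠ 1) :
    pd 0 (fun y => e y 0) p * pd 1 (pullback F.metric e 0 b) p =
      pd 0 (fun y => e y 0) p * (∑ j, F.lin j (e p) * pd b (fun y => e y j) p) -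
        2 * pd 0 (pd b fun y => e y 0) p := by
  have hed : ∀ p ∈ R, DifferentiableAt ℝ e p := fun p hp =>
    (he.contDiffAt (hR.mem_nhds hp)).differentiableAt (by simp)
  have hei : ∀ i, ContDiffOn ℝ ∞ (fun y => e y i) R := fun i => contDiffOn_pi.1 he i
  have hE : ∀ i a, DifferentiableAt ℝ (pd a fun y => e y i) p := fun i a =>
    differentiableAt_of_contDiffOn hR (contDiffOn_pd hR (hei i) a) (by simp) hp
  have hep1 : e p 1 = 0 := by rw [hi p hp hp1 1 (by decide), hp1]
  have hEh : ∀ a ≠ 1, ∀ i ≠ 0, ∀ y ∈ R, y 1 = 0 → pd a (fun y => e y i) y = if i = a then 1 else 0 := by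
    intro a ha i hi0 y hy hy1
    rw [← pd_coord i (p := y)]
    refine pd_congr_horizon (differentiableAt_of_contDiffOn hR (hei i) (by simp) hy)
      (by fun_prop) ha hy1 ?_
    filter_upwards [hR.mem_nhds hy] with z hz hz1 using hi z hz hz1 i hi0
  have hE0 : ∀ i ≠ 0, pd 0 (fun y => e y i) p = 0 := fun i hi0 => by
    rw [hEh 0 (by decide) i hi0 p hp hp1, if_neg hi0]
  have hE00 : ∀ i ≠ 0, pd 0 (pd b fun y => e y i) p = 0 := by
    intro i hi0
    have := pd_congr_horizon (i := 0) (G := fun _ => if i = b then 1 else 0) (hE i b) (by fun_prop)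
      (by decide) hp1 (by
        filter_upwards [hR.mem_nhds hp] with z hz hz1 using hEh b hb i hi0 z hz hz1)
    rw [this, pd_const]
  have hm0 : ∀ j, F.metric (e p) 0 j = if j = 1 then 1 else 0 := by
    intro j
    fin_cases j <;> simp [NullForm.metric, hep1]
  have hmsymm : ∀ i j, F.metric (e p) i j = F.metric (e p) j i := fun i j =>
    metric_symm (hF.neg_def _ (hm hp)) i j
  have hdsymm : ∀ k i, pd k (fun y => F.metric y 0 i) (e p) =
      pd k (fun y => F.metric y i 0) (e p) := fun k i =>
    congrArg (fun G => pd k G (e p)) (funext fun y => metric_zero_comm i y)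
  -- the derivatives of the known components
  have e1 : pd 0 (pullback F.metric e 1 b) p = 0 := by
    rw [pd_congr_of_eqOn hR hp fun y hy => hL y hy b, pd_const]
  have e2 : pd b (pullback F.metric e 1 0) p = 0 := by
    rw [pd_congr_of_eqOn hR hp fun y hy => hL y hy 0, pd_const]
  have e3 : pd 0 (fun y => e y 0) p * pd 1 (fun y => e y 1) p = 1 := by
    have := hL p hp 0
    rw [pullback_eq_sum _ (hed p hp)] at this
    simp only [Fin.sum_univ_four, hE0 1 (by decide), hE0 2 (by decide), hE0 3 (by decide),
      hmsymm _ 0, hm0] at this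
    simp at this
    linarith
  rw [pd_pullback hF hΩ hR he hm hp] at e1 e2 ⊢
  have hcomm : ∀ a c i, pd c (pd a fun y => e y i) p = pd a (pd c fun y => e y i) p :=
    fun a c i => pd_comm hR (hei i) hp
  have t1 : ∀ i j, (∑ k, pd k (fun y => F.metric y i j) (e p) * pd 0 (fun y => e y k) p) = 0 := by
    intro i j
    simp [Fin.sum_univ_four, hE0, pd_zero_metric hep1 (hq _ (hm hp) hep1) i j]
  have t2 : ∀ i, (∑ k, pd k (fun y => F.metric y i 0) (e p) * pd b (fun y => e y k) p) = 0 := by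
    intro i
    refine Finset.sum_eq_zero fun k _ => ?_
    by_cases hk : k = 1
    · rw [hk, hEh b hb 1 (by decide) p hp hp1, if_neg hb.symm, mul_zero]
    · rw [pd_metric_eq_zero hep1 hk (by simp), zero_mul]
  have t3 : ∀ j, (∑ k, pd k (fun y => F.metric y 0 j) (e p) * pd 1 (fun y => e y k) p) =
      F.lin j (e p) * pd 1 (fun y => e y 1) p := by
    intro j
    rw [Finset.sum_eq_single 1 _ (by simp)]
    · by_cases hj : j = 1
      · subst hj
        rw [(pd_metric_one 1 0).2]
        simp [NullForm.lin]
      · rw [hdsymm, pd_one_metric_lin hF hΩ (hm hp) hep1 hj]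
    · intro k _ hk
      rw [pd_metric_eq_zero hep1 hk (by simp), zero_mul]
  have c1 : ∑ i, ∑ j, pd 1 (fun y => e y i) p * F.metric (e p) i j *
      pd 0 (pd b fun y => e y j) p =
      pd 1 (fun y => e y 1) p * pd 0 (pd b fun y => e y 0) p := by
    simp only [Fin.sum_univ_four, hE00 1 (by decide), hE00 2 (by decide), hE00 3 (by decide),
      hmsymm _ 0, hm0]
    simp
  have c2 : ∑ i, ∑ j, pd 0 (fun y => e y i) p * F.metric (e p) i j *
      pd b (pd 1 fun y => e y j) p = ∑ i, ∑ j, pd b (pd 1 fun y => e y i) p *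
      F.metric (e p) i j * pd 0 (fun y => e y j) p := by
    rw [Finset.sum_comm]
    refine Finset.sum_congr rfl fun i _ => Finset.sum_congr rfl fun j _ => ?_
    rw [hmsymm]
    ring
  have c3 : ∑ i, ∑ j, (∑ k, pd k (fun y => F.metric y i j) (e p) * pd b (fun y => e y k) p) *
      pd 1 (fun y => e y i) p * pd 0 (fun y => e y j) p = 0 := by
    simp only [Fin.sum_univ_four (f := fun j => _ * pd 0 (fun y => e y j) p), t2,
      hE0 1 (by decide), hE0 2 (by decide), hE0 3 (by decide)]
    simp
  have c4 : ∑ i, ∑ j, (∑ k, pd k (fun y => F.metric y i j) (e p) * pd 1 (fun y => e y k) p) *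
      pd 0 (fun y => e y i) p * pd b (fun y => e y j) p =
      ∑ j, F.lin j (e p) * pd b (fun y => e y j) p := by
    rw [Finset.sum_eq_single 0 (fun i _ hi0 => by simp [hE0 i hi0]) (by simp)]
    simp only [t3]
    refine Finset.sum_congr rfl fun j _ => ?_
    linear_combination F.lin j (e p) * pd b (fun y => e y j) p * e3
  simp only [t1, zero_mul, Finset.sum_const_zero, zero_add, c1] at e1
  simp only [hcomm 0 b, c1, c3, zero_add] at e2
  simp only [hcomm 0 1, hcomm b 1, c2, c4]
  linear_combination pd 0 (fun y => e y 0) p * e1 + pd 0 (fun y => e y 0) p * e2 -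
    2 * pd 0 (pd b fun y => e y 0) p * e3

end Pullback

/-! ### The metric functions in the new coordinates -/

section ZerothLaw

variable {R : Set Coord} {p : Coord} {κ : ℝ}

/-- If the surface gravity is constant in the new coordinates and `∂f/∂x^A = ∂h_A/∂u` in the old
ones, then `∂h_A/∂u = 0` in the new ones. Here `φ` is the old coordinate `u` as a function of the
new coordinates, `fe` and `le` are the old `f` and `h_A`, and `H` is the new `h_A`. -/
lemma pd_zero_of_transformed (hR : IsOpen R) {φ fe le H : Coord → ℝ} (hφ : ContDiffOn ℝ ∞ φ R)
    (hfe : DifferentiableAt ℝ fe p) (hle : DifferentiableAt ℝ le p) (hH : DifferentiableAt ℝ H p)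
    (hp : p ∈ R) (hp1 : p 1 = 0) {b : Fin 4} (hb : b ≠ 1) {fu m : ℝ} (hv : pd 0 φ p ≠ 0)
    (hA : ∀ y ∈ R, y 1 = 0 →
      pd 0 φ y * pd 0 φ y * fe y - 2 * pd 0 (pd 0 φ) y = -2 * κ * pd 0 φ y)
    (hB : ∀ y ∈ R, y 1 = 0 → pd 0 φ y * H y =
      pd 0 φ y * (pd b φ y * fe y + le y) - 2 * pd 0 (pd b φ) y)
    (h1 : pd 0 fe p = pd 0 φ p * fu) (h2 : pd b fe p = pd b φ p * fu + m)
    (h3 : pd 0 le p = pd 0 φ p * m) : pd 0 H p = 0 := by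
  have hs : ∀ i, ContDiffOn ℝ ∞ (pd i φ) R := fun i => contDiffOn_pd hR hφ i
  have hd : ∀ i, DifferentiableAt ℝ (pd i φ) p := fun i =>
    differentiableAt_of_contDiffOn hR (hs i) (by simp) hp
  have hdd : ∀ i, DifferentiableAt ℝ (pd 0 (pd i φ)) p := fun i =>
    differentiableAt_of_contDiffOn hR (contDiffOn_pd hR (hs i) 0) (by simp) hp
  have hA' := pd_congr_horizon (i := b)
    (F := fun y => pd 0 φ y * pd 0 φ y * fe y - 2 * pd 0 (pd 0 φ) y)
    (G := fun y => (-2 * κ) * pd 0 φ y)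
    ((((hd 0).fun_mul (hd 0)).fun_mul hfe).fun_sub ((hdd 0).const_mul 2)) ((hd 0).const_mul _) hb hp1
    (by filter_upwards [hR.mem_nhds hp] with y hy hy1 using hA y hy hy1)
  have hB' := pd_congr_horizon (i := 0) (F := fun y => pd 0 φ y * H y)
    (G := fun y => pd 0 φ y * (pd b φ y * fe y + le y) - 2 * pd 0 (pd b φ) y)
    ((hd 0).fun_mul hH) (((hd 0).fun_mul (((hd b).fun_mul hfe).fun_add hle)).fun_sub
      ((hdd b).const_mul 2)) (by decide) hp1
    (by filter_upwards [hR.mem_nhds hp] with y hy hy1 using hB y hy hy1)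
  rw [pd_sub (((hd 0).fun_mul (hd 0)).fun_mul hfe) ((hdd 0).const_mul 2), pd_const_mul _ (hdd 0),
    pd_const_mul _ (hd 0), pd_mul ((hd 0).fun_mul (hd 0)) hfe, pd_mul (hd 0) (hd 0), h2] at hA'
  rw [pd_mul (hd 0) hH, pd_sub ((hd 0).fun_mul (((hd b).fun_mul hfe).fun_add hle))
    ((hdd b).const_mul 2), pd_const_mul _ (hdd b),
    pd_mul (hd 0) (((hd b).fun_mul hfe).fun_add hle), pd_add ((hd b).fun_mul hfe) hle,
    pd_mul (hd b) hfe, h1, h3] at hB'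
  -- all mixed derivatives of `φ` are expressed by `∂_b ∂_u φ` and `∂_b ∂_u ∂_u φ`
  have c1 : pd 0 (pd b φ) p = pd b (pd 0 φ) p := pd_comm hR hφ hp
  have c2 : pd 0 (pd 0 (pd b φ)) p = pd b (pd 0 (pd 0 φ)) p := by
    rw [← pd_comm hR (hs 0) hp]
    exact pd_congr_of_eqOn hR hp fun y hy => pd_comm hR hφ hy
  have hAp := hA p hp hp1
  have hBp := hB p hp hp1
  rw [c1] at hB' hBp
  rw [c2] at hB'
  have h4 : pd 0 φ p * (pd 0 φ p * pd 0 H p) = 0 := by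
    linear_combination pd 0 φ p * hB' + pd 0 φ p * hA' - pd 0 (pd 0 φ) p * hBp -
      pd b (pd 0 φ) p * hAp
  simpa [hv] using h4

end ZerothLaw

section InducedForm

variable {F : NullForm} {P : ℝ} {Ω : Set Coord} {V : Set (Fin 2 → ℝ)} {ε : (Fin 2 → ℝ) → ℝ}
  {e : Coord → Coord} {p : Coord}

/-- The Gaussian null form of the pullback of the metric `g` under `e`. -/
noncomputable def inducedForm (g : Coord → Matrix (Fin 4) (Fin 4) ℝ) (e : Coord → Coord) :
    NullForm where
  f := rQuotient (pullback g e 0 0)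
  h p := ![rQuotient (pullback g e 0 2) p, rQuotient (pullback g e 0 3) p]
  q p := !![pullback g e 2 2 p, pullback g e 2 3 p; pullback g e 3 2 p, pullback g e 3 3 p]

lemma pd_chart_horizon {R : Set Coord} (hR : IsOpen R) (he : ContDiffOn ℝ ∞ e R)
    (hi : ∀ y ∈ R, y 1 = 0 → ∀ i ≠ 0, e y i = y i) (hp : p ∈ R) (hp1 : p 1 = 0) {a i : Fin 4}
    (ha : a ≠ 1) (hi0 : i ≠ 0) : pd a (fun y => e y i) p = if i = a then 1 else 0 := by
  rw [← pd_coord i (p := p)]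
  refine pd_congr_horizon (differentiableAt_of_contDiffOn hR (contDiffOn_pi.1 he i) (by simp) hp)
    (by fun_prop) ha hp1 ?_
  filter_upwards [hR.mem_nhds hp] with z hz hz1 using hi z hz hz1 i hi0

lemma pullback_comm (hq : (-F.q (e p)).PosDef) (a b : Fin 4) :
    pullback F.metric e a b p = pullback F.metric e b a p :=
  scalarProd_comm (fun i j => metric_symm hq i j) _ _

lemma pullback_horizon {R : Set Coord} (hR : IsOpen R) (he : ContDiffOn ℝ ∞ e R)
    (hi : ∀ y ∈ R, y 1 = 0 → ∀ i ≠ 0, e y i = y i) (hp : p ∈ R) (hp1 : p 1 = 0) {b : Fin 4}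
    (hb : b ≠ 1) : pullback F.metric e 0 b p = 0 := by
  have hep1 : e p 1 = 0 := by rw [hi p hp hp1 1 (by decide), hp1]
  rw [pullback_eq_sum _ ((he.contDiffAt (hR.mem_nhds hp)).differentiableAt (by simp)),
    Finset.sum_eq_single 0 _ (by simp)]
  · refine Finset.sum_eq_zero fun j _ => ?_
    by_cases hj : j = 1
    · rw [hj, pd_chart_horizon hR he hi hp hp1 hb (by decide), if_neg hb.symm, mul_zero]
    · have : F.metric (e p) 0 j = 0 := by
        rw [metric_zero_comm, F.metric_zero_right hj, hep1, zero_mul]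
      rw [this, mul_zero, zero_mul]
  · intro i _ hi0
    refine Finset.sum_eq_zero fun j _ => ?_
    rw [pd_chart_horizon hR he hi hp hp1 (by decide) hi0, if_neg hi0, zero_mul, zero_mul]

lemma inducedForm_metric (hF : F.IsAdmissible P Ω) (hR : IsOpen (region V ε))
    (he : ContDiffOn ℝ ∞ e (region V ε)) (hm : MapsTo e (region V ε) Ω)
    (hi : ∀ y ∈ region V ε, y 1 = 0 → ∀ i ≠ 0, e y i = y i)
    (hL : ∀ y ∈ region V ε, ∀ b, pullback F.metric e 1 b y = if b = 0 then 1 else 0)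
    (hp : p ∈ region V ε) (a b : Fin 4) :
    (inducedForm F.metric e).metric p a b = pullback F.metric e a b p := by
  have hc := pullback_comm (F := F) (e := e) (hF.neg_def _ (hm hp))
  have hq := fun {b : Fin 4} (hb : b ≠ 1) => r_mul_rQuotient hR
    (contDiffOn_pullback hF hR he hm 0 b) hp
    (pullback_horizon hR he hi (toHorizon_mem_region hp) (toHorizon_one p) hb)
  have q0 := hq (b := 0) (by decide)
  have q2 := hq (b := 2) (by decide)
  have q3 := hq (b := 3) (by decide)
  have l := hL p hp
  have l' := fun b => (hc b 1).trans (l b)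
  fin_cases a <;> fin_cases b <;>
    simp [NullForm.metric, inducedForm, q0, q2, q3, l, l', hc 2 0, hc 3 0]

lemma inducedForm_admissible (hF : F.IsAdmissible P Ω) (hR : IsOpen (region V ε))
    (he : ContDiffOn ℝ ∞ e (region V ε)) (hm : MapsTo e (region V ε) Ω)
    (hL : ∀ y ∈ region V ε, ∀ b, pullback F.metric e 1 b y = if b = 0 then 1 else 0)
    (hinj : ∀ y ∈ region V ε, ∀ v, fderiv ℝ e y v = 0 → v = 0)
    (hper : ∀ y ∈ region V ε, ∀ a b,
      pullback F.metric e a b (y + P • basisVec 0) = pullback F.metric e a b y) :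
    (inducedForm F.metric e).IsAdmissible P (region V ε) where
  smooth_f := contDiffOn_rQuotient hR (contDiffOn_pullback hF hR he hm 0 0)
  smooth_h A := by
    fin_cases A
    · exact contDiffOn_rQuotient hR (contDiffOn_pullback hF hR he hm 0 2)
    · exact contDiffOn_rQuotient hR (contDiffOn_pullback hF hR he hm 0 3)
  smooth_q A B := by
    fin_cases A <;> fin_cases B <;> exact contDiffOn_pullback hF hR he hm _ _
  periodic_f p hp := rQuotient_add hR (fun y hy => hper y hy 0 0) hp
  periodic_h p hp := by
    simp only [inducedForm, rQuotient_add hR (fun y hy => hper y hy 0 2) hp,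
      rQuotient_add hR (fun y hy => hper y hy 0 3) hp]
  periodic_q p hp := by simp only [inducedForm, hper p hp]
  neg_def p hp := by
    have hq := hF.neg_def _ (hm hp)
    have hc := pullback_comm (F := F) (e := e) hq
    refine Matrix.PosDef.of_dotProduct_mulVec_pos ?_ fun w hw => ?_
    · ext i j
      fin_cases i <;> fin_cases j <;> simp [inducedForm, hc 2 3]
    · let w' : Coord := ![0, 0, w 0, w 1]
      have h1 : scalarProd F.metric (e p) (fderiv ℝ e p w') (fderiv ℝ e p w') < 0 := by
        refine scalarProd_neg_of_orthogonal hq (L := fderiv ℝ e p (basisVec 1)) ?_ ?_ ?_ ?_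
        · intro h
          have := congrFun (hinj p hp _ h) 1
          simp [basisVec_apply] at this
        · exact (hL p hp 1).trans (by simp)
        · have := scalarProd_fderiv F.metric (e := e) (p := p) (basisVec 1) w'
          rw [this]
          simp [Fin.sum_univ_four, basisVec_apply, w', hL p hp]
        · intro c h
          rw [← map_smul, ← sub_eq_zero, ← map_sub] at h
          have h2 := hinj p hp _ h
          have h3 := congrFun h2 2
          have h4 := congrFun h2 3
          refine hw ?_
          ext i
          fin_cases i
          · simpa [w', basisVec_apply] using h3
          · simpa [w', basisVec_apply] using h4
      rw [scalarProd_fderiv] at h1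
      simp [Fin.sum_univ_four, w'] at h1
      simp [inducedForm, Matrix.mulVec, dotProduct, Fin.sum_univ_two]
      linarith

end InducedForm

/-! ### The zeroth law -/

section Conclusion

variable {N : ElementaryNeighborhood}

lemma pd_comp_toHorizon {G : Coord → ℝ} {p : Coord} (hG : DifferentiableAt ℝ G (toHorizon p))
    {b : Fin 4} (hb : b ≠ 1) : pd b (fun y => G (toHorizon y)) p = pd b G (toHorizon p) := by
  have h1 : toHorizon (basisVec b) = basisVec b :=
    toHorizon_eq_self (by rw [basisVec_apply, if_neg hb.symm])
  have h2 : fderiv ℝ (fun y => G (toHorizon y)) p =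
      (fderiv ℝ G (toHorizon p)).comp (toHorizon : Coord →L[ℝ] Coord) := by
    have := fderiv_comp p hG toHorizon.differentiableAt
    rwa [ContinuousLinearMap.fderiv] at this
  rw [pd, h2, ContinuousLinearMap.comp_apply, h1]
  rfl

/-- The new parameter on the generators of the horizon, increasing or decreasing in such a way that
its surface gravity is a constant `κ ≥ 0`. -/
lemma exists_generator_parameter {T : Coord → Matrix (Fin 4) (Fin 4) ℝ}
    (hEinstein : ∀ p ∈ N.domain, einstein N.metric p = (8 * Real.pi) • T p)
    (hDEC : DominantEnergy N.metric T N.τ N.domain)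
    (hq : ∀ p ∈ N.horizon, ∀ A B : Fin 2, pd 0 (fun y => N.form.q y A B) p = 0) :
    ∃ (κ : ℝ) (s : ℤˣ) (U : Coord → ℝ), 0 ≤ κ ∧ ContDiffOn ℝ ∞ U (cylinder N.V) ∧
      IndepR N.V U ∧
      (∀ p ∈ cylinder N.V, U (p + N.P • basisVec 0) = U p + (s : ℤ) * N.P) ∧
      (∀ p ∈ cylinder N.V, 0 < ((s : ℤ) : ℝ) * pd 0 U p) ∧
      ∀ p ∈ N.horizon,
        N.form.f p * pd 0 U p + 2 * pd 0 (pd 0 U) p = -2 * κ * pd 0 U p ^ 2 := by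
  have hF : N.form.IsAdmissible N.P N.domain := N.admissible
  have hO := cylinder_open N.V_open
  have hmem : MapsTo toHorizon (cylinder N.V) N.domain := fun p hp =>
    toHorizon_mem_region_of_cylinder N.ε_pos hp
  have hHs : ∀ {G : Coord → ℝ}, ContDiffOn ℝ ∞ G N.domain →
      ContDiffOn ℝ ∞ (fun p => G (toHorizon p)) (cylinder N.V) := fun hG =>
    hG.comp toHorizon.contDiff.contDiffOn hmem
  have hind : IndepR N.V fun p => N.form.f (toHorizon p) := fun p _ =>
    congrArg N.form.f (toHorizon_eq_self (toHorizon_one p))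
  have hpd : ∀ {G : Coord → ℝ}, ContDiffOn ℝ ∞ G N.domain → ∀ p ∈ cylinder N.V, ∀ b ≠ 1,
      pd b (fun y => G (toHorizon y)) p = pd b G (toHorizon p) := fun hG p hp b hb =>
    pd_comp_toHorizon (differentiableAt_of_contDiffOn N.isOpen_domain hG (by simp) (hmem hp)) hb
  obtain ⟨m, hm⟩ := exists_period_integral N.V_open N.V_connected (P := N.P)
    (h := fun b p => N.form.lin b (toHorizon p)) (hHs hF.smooth_f) hind
    (fun b => hHs (hF.contDiffOn_lin b))
    (fun b p hp => by
      have h1 := hF.periodic_f _ (hmem hp)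
      have h2 := hF.periodic_h _ (hmem hp)
      simp only [toHorizon_add, NullForm.lin, h1, h2])
    (fun p hp b hb => by
      rw [hpd hF.smooth_f p hp b hb, hpd (hF.contDiffOn_lin b) p hp 0 (by decide)]
      exact N.pd_f_eq_pd_h hEinstein hDEC hq ⟨hmem hp, toHorizon_one p⟩ hb)
  obtain ⟨κ, U, hU, hUr, hUP, hU0, hUeq⟩ :=
    exists_rescaling N.V_open N.P_pos (hHs hF.smooth_f) hind hm
  obtain ⟨s, hs⟩ : ∃ s : ℤˣ, κ * ((s : ℤ) : ℝ) = |κ| := by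
    rcases le_total 0 κ with h | h
    · exact ⟨1, by simp [abs_of_nonneg h]⟩
    · exact ⟨-1, by simp [abs_of_nonpos h]⟩
  have hss : ((s : ℤ) : ℝ) * (s : ℤ) = 1 := by
    rcases Int.units_eq_one_or s with h | h <;> simp [h]
  have hd : ∀ {G : Coord → ℝ} {p}, ContDiffOn ℝ ∞ G (cylinder N.V) → p ∈ cylinder N.V →
      DifferentiableAt ℝ G p := fun hG hp => differentiableAt_of_contDiffOn hO hG (by simp) hp
  have h1 : ∀ p ∈ cylinder N.V, pd 0 (fun y => ((s : ℤ) : ℝ) * U y) p = (s : ℤ) * pd 0 U p :=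
    fun p hp => pd_const_mul _ (hd hU hp)
  refine ⟨|κ|, s, fun p => (s : ℤ) * U p, abs_nonneg κ, contDiffOn_const.mul hU, ?_, ?_, ?_, ?_⟩
  · intro p hp
    simp only [hUr p hp]
  · intro p hp
    simp only [hUP p hp]; ring
  · intro p hp
    rw [h1 p hp, ← mul_assoc, hss, one_mul]
    exact hU0 p hp
  · rintro p ⟨hp, hp1⟩
    have hpc : p ∈ cylinder N.V := hp.1
    have h2 := hUeq p hpc
    rw [toHorizon_eq_self hp1] at h2
    rw [pd_congr_of_eqOn hO hpc h1, pd_const_mul _ (hd (contDiffOn_pd hO hU 0) hpc), h1 p hpc, ← hs]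
    linear_combination (s : ℤ) * h2 + 2 * κ * pd 0 U p ^ 2 * (s : ℤ) * hss

end Conclusion

end Horizon

open Horizon Set Filter Topology in
theorem proposition4p1 (N : Horizon.ElementaryNeighborhood)
    (T : Horizon.Coord → Matrix (Fin 4) (Fin 4) ℝ)
    (hEinstein : ∀ p ∈ N.domain, Horizon.einstein N.metric p = (8 * Real.pi) • T p)
    (hDEC : Horizon.DominantEnergy N.metric T N.τ N.domain)
    (hq : ∀ p ∈ N.horizon, ∀ A B : Fin 2, Horizon.pd 0 (fun y => N.form.q y A B) p = 0) :
    ∃ (κ : ℝ) (s : ℤˣ) (C : N.NullCoordinates s), 0 ≤ κ ∧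
      ∀ p ∈ Horizon.region C.V C.ε, p 1 = 0 →
        C.form.f p = -2 * κ ∧
        (∀ A : Fin 2, Horizon.pd 0 (fun y => C.form.h y A) p = 0) ∧
        (∀ a : Fin 4, Horizon.christoffel C.form.metric a 0 0 p =
          κ * Horizon.basisVec 0 a) := by
  obtain ⟨κ, s, U, hκ, hU, hUr, hUP, hU', hUeq⟩ :=
    exists_generator_parameter hEinstein hDEC hq
  obtain ⟨ε, e, hεc, hε, hes, het, hhor, hesm, hesymm, hiff, hi, hUe, hL, hequi, hinj⟩ :=
    exists_adapted_chart hU hUr hUP hU'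
  rw [hes] at hesm
  have hF : N.form.IsAdmissible N.P N.domain := N.admissible
  have hΩ := N.isOpen_domain
  have hR := isOpen_region N.V_open hεc
  have hO := cylinder_open N.V_open
  have hm : MapsTo e (region N.V ε) N.domain := fun p hp => het (e.map_source (hes ▸ hp))
  have hed : ∀ p ∈ region N.V ε, DifferentiableAt ℝ e p := fun p hp =>
    (hesm.contDiffAt (hR.mem_nhds hp)).differentiableAt (by simp)
  have hei := fun i => contDiffOn_pi.1 hesm i
  have hL' : ∀ y ∈ region N.V ε, ∀ b,
      pullback N.form.metric e 1 b y = if b = 0 then 1 else 0 := fun y hy b => by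
    refine (hL y hy (basisVec b)).trans ?_
    rw [basisVec_apply]
    simp only [eq_comm]
  have hpdh : ∀ p ∈ region N.V ε, p 1 = 0 → ∀ {a i : Fin 4}, a ≠ 1 → i ≠ 0 →
      pd a (fun y => e y i) p = if i = a then 1 else 0 := fun p hp hp1 {_ _} ha hi0 =>
    pd_chart_horizon hR hesm hi hp hp1 ha hi0
  have hper : ∀ y ∈ region N.V ε, ∀ a b, pullback N.form.metric e a b (y + N.P • basisVec 0) =
      pullback N.form.metric e a b y := by
    intro y hy a b
    have h1 : fderiv ℝ e (y + N.P • basisVec 0) = fderiv ℝ e y := by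
      rw [← fderiv_comp_add_right]
      have : (fun z => e (z + N.P • basisVec 0)) =ᶠ[𝓝 y]
          fun z => e z + (((s : ℤ) : ℝ) * N.P) • basisVec 0 := by
        filter_upwards [hR.mem_nhds hy] with z hz using hequi z hz
      rw [this.fderiv_eq, fderiv_add_const]
    have h2 : ((s : ℤ) : ℝ) * N.P = N.P ∨ ((s : ℤ) : ℝ) * N.P = -N.P := by
      rcases Int.units_eq_one_or s with h | h <;> simp [h]
    have h3 := admissible_shift hF h2 (hm hy)
    have h4 := metric_add h3.1 h3.2.1 h3.2.2
    simp only [pullback, scalarProd, h1, hequi y hy, h4]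
  have hadm := inducedForm_admissible hF hR hesm hm hL' hinj hper
  have hmet : ∀ p ∈ region N.V ε, ∀ a b, (inducedForm N.form.metric e).metric p a b =
      pullback N.form.metric e a b p := fun p hp a b =>
    inducedForm_metric hF hR hesm hm hi hL' hp a b
  -- the old coordinate `u` as a function of the new coordinates
  let φ : Coord → ℝ := fun y => e y 0
  have hφ : ContDiffOn ℝ ∞ φ (region N.V ε) := hei 0
  have hhorm : ∀ p ∈ region N.V ε, p 1 = 0 → e p ∈ N.horizon := fun p hp hp1 =>
    ⟨hm hp, (hiff p hp).2 hp1⟩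
  have hUd : ∀ p ∈ N.domain, DifferentiableAt ℝ U p := fun p hp =>
    differentiableAt_of_contDiffOn hO hU (by simp) hp.1
  have hsum0 : ∀ {G : Coord → ℝ} {p}, DifferentiableAt ℝ G (e p) → p ∈ region N.V ε → p 1 = 0 →
      pd 0 (fun y => G (e y)) p = pd 0 φ p * pd 0 G (e p) := by
    intro G p hG hp hp1
    rw [pd_comp 0 hG (hed p hp), Fin.sum_univ_four, hpdh p hp hp1 (by decide) (i := 1) (by decide),
      hpdh p hp hp1 (by decide) (i := 2) (by decide), hpdh p hp hp1 (by decide) (i := 3) (by decide)]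
    simp [φ, mul_comm]
  have hsumb : ∀ {G : Coord → ℝ} {p} {b : Fin 4}, b ≠ 0 → b ≠ 1 → DifferentiableAt ℝ G (e p) →
      p ∈ region N.V ε → p 1 = 0 →
      pd b (fun y => G (e y)) p = pd b φ p * pd 0 G (e p) + pd b G (e p) := by
    intro G p b hb0 hb hG hp hp1
    rw [pd_comp b hG (hed p hp), Fin.sum_univ_four, hpdh p hp hp1 hb (i := 1) (by decide),
      hpdh p hp hp1 hb (i := 2) (by decide), hpdh p hp hp1 hb (i := 3) (by decide)]
    fin_cases b <;> simp [φ, mul_comm] at hb0 hb ⊢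
  have hUv : ∀ p ∈ region N.V ε, p 1 = 0 → pd 0 φ p * pd 0 U (e p) = 1 := by
    intro p hp hp1
    rw [← hsum0 (hUd _ (hm hp)) hp hp1, pd_congr_horizon (i := 0) (F := fun y => U (e y)) (G := fun y => y 0)
      (DifferentiableAt.comp p (hUd _ (hm hp)) (hed p hp)) (by fun_prop) (by decide) hp1
      (by filter_upwards [hR.mem_nhds hp] with y hy hy1 using hUe y hy hy1), pd_coord]
    simp
  have hv : ∀ p ∈ region N.V ε, p 1 = 0 → pd 0 φ p ≠ 0 := fun p hp hp1 =>
    left_ne_zero_of_mul_eq_one (hUv p hp hp1)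
  have hA : ∀ y ∈ region N.V ε, y 1 = 0 →
      pd 0 φ y * pd 0 φ y * N.form.f (e y) - 2 * pd 0 (pd 0 φ) y = -2 * κ * pd 0 φ y := by
    intro p hp hp1
    have hU0d : DifferentiableAt ℝ (pd 0 U) (e p) :=
      differentiableAt_of_contDiffOn hO (contDiffOn_pd hO hU 0) (by simp) (hm hp).1
    have hvd : DifferentiableAt ℝ (pd 0 φ) p :=
      differentiableAt_of_contDiffOn hR (contDiffOn_pd hR hφ 0) (by simp) hp
    have hcd : DifferentiableAt ℝ (fun y => pd 0 U (e y)) p :=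
      DifferentiableAt.comp p hU0d (hed p hp)
    have h1 := pd_congr_horizon (i := 0) (G := fun _ => 1) (hvd.fun_mul hcd) (by fun_prop)
      (by decide) hp1 (by filter_upwards [hR.mem_nhds hp] with y hy hy1 using hUv y hy hy1)
    rw [pd_const, pd_mul hvd hcd, hsum0 hU0d hp hp1] at h1
    have h2 := hUeq (e p) (hhorm p hp hp1)
    have h3 := hUv p hp hp1
    generalize pd 0 φ p = v at *
    generalize pd 0 (pd 0 φ) p = w at *
    generalize pd 0 (pd 0 U) (e p) = b at *
    generalize pd 0 U (e p) = a at *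
    have hv0 : v ≠ 0 := left_ne_zero_of_mul_eq_one h3
    obtain rfl : a = 1 / v := by field_simp; linarith
    obtain rfl : b = -w / v ^ 3 := by field_simp at h1 ⊢; linarith
    field_simp at h2 ⊢
    linarith
  have hform : ∀ p ∈ region N.V ε, p 1 = 0 → ∀ b ≠ 1,
      pd 0 φ p * rQuotient (pullback N.form.metric e 0 b) p =
        pd 0 φ p * (∑ j, N.form.lin j (e p) * pd b (fun y => e y j) p) -
          2 * pd 0 (pd b φ) p := by
    intro p hp hp1 b hb
    rw [rQuotient_horizon hp1]
    exact pd_one_pullback hF hΩ hR hesm hm (fun y hy hy1 => hq y ⟨hy, hy1⟩) hi hL' hp hp1 hb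
  have hf' : ∀ p ∈ region N.V ε, p 1 = 0 → (inducedForm N.form.metric e).f p = -2 * κ := by
    intro p hp hp1
    have h1 := hform p hp hp1 0 (by decide)
    rw [Fin.sum_univ_four, hpdh p hp hp1 (by decide) (i := 1) (by decide),
      hpdh p hp hp1 (by decide) (i := 2) (by decide),
      hpdh p hp hp1 (by decide) (i := 3) (by decide)] at h1
    have h2 := hA p hp hp1
    refine mul_left_cancel₀ (hv p hp hp1) (h1.trans ?_)
    simp only [NullForm.lin, φ] at h2 ⊢
    simp
    linarith
  have hh' : ∀ p ∈ region N.V ε, p 1 = 0 → ∀ b ≠ 0, b ≠ 1 →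
      pd 0 (rQuotient (pullback N.form.metric e 0 b)) p = 0 := by
    intro p hp hp1 b hb0 hb
    have hfd : DifferentiableAt ℝ N.form.f (e p) :=
      differentiableAt_of_contDiffOn hΩ hF.smooth_f (by simp) (hm hp)
    have hld : DifferentiableAt ℝ (N.form.lin b) (e p) :=
      differentiableAt_of_contDiffOn hΩ (hF.contDiffOn_lin b) (by simp) (hm hp)
    refine pd_zero_of_transformed hR hφ (fe := fun y => N.form.f (e y))
      (le := fun y => N.form.lin b (e y)) (DifferentiableAt.comp p hfd (hed p hp))
      (DifferentiableAt.comp (g := N.form.lin b) p hld (hed p hp))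
      (differentiableAt_of_contDiffOn hR (contDiffOn_rQuotient hR
        (contDiffOn_pullback hF hR hesm hm 0 b)) (by simp) hp) hp hp1 hb (hv p hp hp1) hA
      ?_ (hsum0 hfd hp hp1) (hsumb hb0 hb hfd hp hp1) ?_
    · intro y hy hy1
      rw [hform y hy hy1 b hb, Fin.sum_univ_four, hpdh y hy hy1 hb (i := 1) (by decide),
        hpdh y hy hy1 hb (i := 2) (by decide), hpdh y hy hy1 hb (i := 3) (by decide)]
      fin_cases b <;> simp [φ, NullForm.lin, mul_comm] at hb0 hb ⊢
    · rw [hsum0 hld hp hp1, N.pd_f_eq_pd_h hEinstein hDEC hq (hhorm p hp hp1) hb]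
  let C : N.NullCoordinates s :=
    { V := N.V
      V_open := N.V_open
      ε := ε
      ε_continuous := hεc
      ε_pos := hε
      form := inducedForm N.form.metric e
      admissible := hadm
      toPoint := e
      source_eq := hes
      target_subset := het
      horizon_subset := hhor
      smooth := hes ▸ hesm
      smooth_symm := hesymm
      horizon_iff := hiff
      isometric := fun p hp v w => by
        rw [show N.metric = N.form.metric from rfl, scalarProd_fderiv, scalarProd_eq_sum]
        simp only [hmet p hp]
      equivariant := hequi
      k_future := fun p hp hp1 => by
        have h1 : fderiv ℝ e p (basisVec 0) = pd 0 φ p • basisVec 0 := by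
          ext i
          rw [← pd_apply (hed p hp)]
          by_cases hi0 : i = 0
          · subst hi0; simp [φ, basisVec_apply]
          · rw [hpdh p hp hp1 (by decide) hi0]
            simp [basisVec_apply, hi0]
        have h2 := N.k_future (e p) (hm hp) (hhorm p hp hp1).2
        have h3 := hU' (e p) (hm hp).1
        have h4 := hUv p hp hp1
        have h5 : 0 < pd 0 φ p * (s : ℤ) := by
          have h6 : 0 < pd 0 φ p ^ 2 := by have := hv p hp hp1; positivity
          have h7 := mul_pos h6 h3
          have h8 : pd 0 φ p ^ 2 * ((s : ℤ) * pd 0 U (e p)) = pd 0 φ p * (s : ℤ) := by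
            linear_combination pd 0 φ p * (s : ℤ) * h4
          rwa [h8] at h7
        rw [h1, scalarProd_smul_left, scalarProd_smul_right, ← mul_assoc]
        exact mul_pos h5 h2 }
  refine ⟨κ, s, C, hκ, fun p hp hp1 => ⟨hf' p hp hp1, fun A => ?_, fun a => ?_⟩⟩
  · fin_cases A
    · exact hh' p hp hp1 2 (by decide) (by decide)
    · exact hh' p hp hp1 3 (by decide) (by decide)
  · rw [christoffel_horizon_geodesic hadm hR hp hp1, hf' p hp hp1]
    ring
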